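/- Notation. Let $\mathbb{S}^p$ be the space of real symmetric $p\times p$ matrices with the trace inner product, $\mathbb{Z}=(\mathbb{S}^p)^K$ with the sum inner product and norm $\|\cdot\|$, and $\mathbb{Z}_{++}$ the set of $K$-tuples of positive definite matrices. For $X=(X^{(1)},\dots,X^{(K)})\in\mathbb{Z}$ write $X_{[ij]}=(X^{(1)}_{ij},\dots,X^{(K)}_{ij})\in\mathbb{R}^K$. Fix $\lambda_1,\lambda_2,\sigma_t>0$ and $S,\Omega_t,\Theta_t\in\mathbb{Z}$, and let $$\mathcal{P}(\Theta)=\lambda_1\sum_{k}\sum_{i\ne j}|\Theta^{(k)}_{ij}|+\lambda_2\sum_{i\neq j}\Big(\sum_k|\Theta^{(k)}_{ij}|^2\Big)^{1/2},\qquad f(\Omega)=\sum_k\big(-\log\det\Omega^{(k)}+\langle S^{(k)},\Omega^{(k)}\rangle\big)$$ for $\Omega\in\mathbb{Z}_{++}$, and $f(\Omega)=+\infty$ otherwise. The dual objective is $$\Upsilon_t(X)=\min_{\Omega,\Theta\in\mathbb{Z}}\Big\{f(\Omega)+\mathcal{P}(\Theta)+\langle\Omega-\Theta,X\rangle+\tfrac1{2\sigma_t}\|\Omega-\Omega_t\|^2+\tfrac1{2\sigma_t}\|\Theta-\Theta_t\|^2\Big\},\qquad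 X\in\mathbb{Z}.$$ Generalized Jacobians. Let $\phi^+(A)=Q\,\mathrm{Diag}(\phi^+(d_i))Q^T$ for $A=Q\,\mathrm{Diag}(d_i)Q^T\in\mathbb{S}^p$, where $\phi^+(x)=(\sqrt{x^2+4\sigma_t}+x)/2$. For $u\in\mathbb{R}^K$ let $\widehat\partial\mathrm{Prox}_\varphi(u)$ be the set of all $(I-\Sigma)\Lambda$ with $\Lambda\in\partial\mathrm{Prox}_{\lambda_1\|\cdot\|_1}(u)$ and $\Sigma\in\partial\Pi_{\mathbb{B}}(\mathrm{Prox}_{\lambda_1\|\cdot\|_1}(u))$, where $\mathrm{Prox}_g(u)=\arg\min_y\{g(y)+\frac12\|y-u\|^2\}$, $\Pi_{\mathbb{B}}$ is the projection onto the Euclidean ball of radius $\lambda_2$ centred at $0$, and $\partial$ is the Clarke generalized Jacobian. Let $\widehat\partial\mathrm{Prox}_{\mathcal{P}}(X)$ be the set of linear maps $\mathcal{W}:\mathbb{Z}\to\mathbb{Z}$ for which there are $M^{(ij)}\in\widehat\partial\mathrm{Prox}_\varphi(X_{[ij]})$, $i<j$, such that for all $Y\in\mathbb{Z}$: $(\mathcal{W}[Y])_{[ij]}=M^{(ij)}Y_{[ij]}$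 if $i<j$, $=Y_{[ii]}$ if $i=j$, and $=M^{(ji)}Y_{[ij]}$ if $j<i$. Let $\widehat\partial(\nabla\Upsilon_t)(X)$ be the set of linear maps $$\mathcal{V}[D]=-\sigma_t\Big((\phi^+)'\big(\Omega_t^{(k)}-\sigma_t(S^{(k)}+X^{(k)})\big)[D^{(k)}]\Big)_{k=1}^K-\sigma_t\mathcal{W}[D],\qquad \mathcal{W}\in\widehat\partial\mathrm{Prox}_{\mathcal{P}}\big((\Theta_t+\sigma_tX)/\sigma_t\big).$$ Algorithm (dual semismooth Newton method). Given $\bar\eta\in(0,1)$, $\tau\in(0,1]$, $\mu\in(0,1/2)$, $\rho\in(0,1)$ and $X_{t,0}\in\mathbb{Z}_{++}$, for $j=0,1,\dots$: choose $\mathcal{V}_j\in\widehat\partial(\nabla\Upsilon_t)(X_{t,j})$; let $D_j$ be an iterate of the conjugate gradient method, started at $0$, for the system $\mathcal{V}_j[D]=-\nabla\Upsilon_t(X_{t,j})$ that satisfies $$\|\mathcal{V}_j[D_j]+\nabla\Upsilon_t(X_{t,j})\|\le\min\big(\bar\eta,\|\nabla\Upsilon_t(X_{t,j})\|^{1+\tau}\big);$$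 let $m_j$ be the smallest integer $m\ge0$ with $\Upsilon_t(X_{t,j}+\rho^mD_j)\ge\Upsilon_t(X_{t,j})+\mu\rho^m\langle\nabla\Upsilon_t(X_{t,j}),D_j\rangle$; and set $X_{t,j+1}=X_{t,j}+\rho^{m_j}D_j$. Proposition. $\Upsilon_t$ has a unique maximizer $\overline X_t$ over $\mathbb{Z}$, and every infinite sequence $\{X_{t,j}\}_{j\ge0}$ generated by the algorithm converges to $\overline X_t$. The convergence is at least superlinear: $$\|X_{t,j+1}-\overline X_t\|=\mathcal{O}\big(\|X_{t,j}-\overline X_t\|^{1+\tau}\big)\qquad(j\to\infty),$$ so that $\|X_{t,j+1}-\overline X_t\|=o(\|X_{t,j}-\overline X_t\|)$, and the rate is quadratic, $\|X_{t,j+1}-\overline X_t\|=\mathcal{O}(\|X_{t,j}-\overline X_t\|^2)$, when $\tau=1$. -/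

import Mathlib

open Filter Topology Asymptotics Set

noncomputable section

namespace GGL

/-! ## The space of `K`-tuples of symmetric matrices -/

/-- Symmetric `p × p` real matrices, as a subspace of the Euclidean space of all entries
(so that the inner product is the trace inner product and the norm is the Frobenius norm). -/
def symSubmodule (p : ℕ) : Submodule ℝ (EuclideanSpace ℝ (Fin p × Fin p)) where
  carrier := {A | ∀ i j, A (i, j) = A (j, i)}
  add_mem' := by
    intro A B hA hB i j
    simp [hA i j, hB i j]
  zero_mem' := by
    intro i j
    simp
  smul_mem' := by
    intro c A hA i j
    simp [hA i j]

/-- The space `𝕊^p` of symmetric matrices with the Frobenius inner product. -/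
abbrev SymMat (p : ℕ) : Type := symSubmodule p

/-- The underlying matrix of an element of `𝕊^p`. -/
def SymMat.toMat {p : ℕ} (A : SymMat p) : Matrix (Fin p) (Fin p) ℝ :=
  Matrix.of fun i j => (A : EuclideanSpace ℝ (Fin p × Fin p)) (i, j)

theorem SymMat.isHermitian_toMat {p : ℕ} (A : SymMat p) : A.toMat.IsHermitian := by
  ext i j
  simpa [SymMat.toMat] using A.2 j i

/-- The element of `𝕊^p` given by a symmetric matrix. -/
def SymMat.ofMat {p : ℕ} (M : Matrix (Fin p) (Fin p) ℝ) (hM : M.IsHermitian) : SymMat p :=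
  ⟨WithLp.toLp 2 fun ij => M ij.1 ij.2, by
    intro i j
    simpa using (hM.apply i j).symm⟩

/-- The space `ℤ = 𝕊^p × ⋯ × 𝕊^p` (`K` copies), with `⟨X, Y⟩ = ∑ₖ ⟨X⁽ᵏ⁾, Y⁽ᵏ⁾⟩`. -/
abbrev ZSpace (K p : ℕ) : Type := PiLp 2 (fun _ : Fin K => SymMat p)

instance instCompleteSpaceSymMat (p : ℕ) : CompleteSpace (SymMat p) :=
  FiniteDimensional.complete ℝ (symSubmodule p)

instance instInnerProductSpaceZSpace (K p : ℕ) : InnerProductSpace ℝ (ZSpace K p) :=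
  PiLp.innerProductSpace (fun _ : Fin K => SymMat p)

instance instCompleteSpaceZSpace (K p : ℕ) : CompleteSpace (ZSpace K p) :=
  inferInstance

/-- The set of `K`-tuples of positive definite matrices. -/
def posDefTuples (K p : ℕ) : Set (ZSpace K p) := {X | ∀ k, (X k).toMat.PosDef}

/-- The vector `X_{[ij]} ∈ ℝ^K` of the `(i,j)` entries of the `K` matrices. -/
def group {K p : ℕ} (X : ZSpace K p) (i j : Fin p) : EuclideanSpace ℝ (Fin K) :=
  WithLp.toLp 2 fun k => (X k).toMat i j

/-! ## The dual objective of the proximal point subproblem -/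

/-- The group graphical Lasso regularizer. -/
def regularizer {K p : ℕ} (lam1 lam2 : ℝ) (Θ : ZSpace K p) : ℝ :=
  lam1 * ∑ k, ∑ i, ∑ j, (if i ≠ j then |(Θ k).toMat i j| else 0) +
    lam2 * ∑ i, ∑ j, (if i ≠ j then Real.sqrt (∑ k, |(Θ k).toMat i j| ^ 2) else 0)

/-- `f(Ω) = ∑ₖ (- log det Ω⁽ᵏ⁾ + ⟨S⁽ᵏ⁾, Ω⁽ᵏ⁾⟩)` on its effective domain `posDefTuples`
(the function is `+∞` elsewhere). -/
def logDetLoss {K p : ℕ} (S Ω : ZSpace K p) : ℝ :=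
  ∑ k, (-Real.log (Ω k).toMat.det + inner ℝ (S k) (Ω k))

/-- The Lagrangian `ℒ_t(Ω, Θ, X)` of the subproblem with proximal centre `(Ωt, Θt)` and
parameter `σ`, for `Ω` in the effective domain `posDefTuples` (it is `+∞` for other `Ω`). -/
def lagrangian {K p : ℕ} (lam1 lam2 σ : ℝ) (S Ωt Θt Ω Θ X : ZSpace K p) : ℝ :=
  logDetLoss S Ω + regularizer lam1 lam2 Θ + inner ℝ (Ω - Θ) X
    + 1 / (2 * σ) * ‖Ω - Ωt‖ ^ 2 + 1 / (2 * σ) * ‖Θ - Θt‖ ^ 2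

/-- The dual objective `Υ_t(X) = min_{Ω, Θ} ℒ_t(Ω, Θ, X)`. The minimum over all `Ω` is the
minimum over positive definite `Ω`, since the Lagrangian is `+∞` for the others. -/
def dualObj {K p : ℕ} (lam1 lam2 σ : ℝ) (S Ωt Θt X : ZSpace K p) : ℝ :=
  sInf {v | ∃ Ω Θ : ZSpace K p, Ω ∈ posDefTuples K p ∧
    v = lagrangian lam1 lam2 σ S Ωt Θt Ω Θ X}

/-! ## The surrogate generalized Jacobian of the gradient of the dual objective -/

/-- The scalar function `φ⁺_β(x) = (√(x² + 4β) + x) / 2`. -/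
def phiScalar (β x : ℝ) : ℝ := (Real.sqrt (x ^ 2 + 4 * β) + x) / 2

theorem isHermitian_phi {p : ℕ} (β : ℝ) (A : SymMat p) :
    (A.isHermitian_toMat.cfc (phiScalar β)).IsHermitian := by
  rw [← A.isHermitian_toMat.cfc_eq]
  exact cfc_predicate (R := ℝ) (p := IsSelfAdjoint) (phiScalar β) A.toMat

/-- The spectral function `φ⁺_β(A) = Q Diag(φ⁺_β(d₁), …, φ⁺_β(d_p)) Qᵀ` on `𝕊^p`, for
`A = Q Diag(d₁, …, d_p) Qᵀ`. -/
def phiPlus {p : ℕ} (β : ℝ) (A : SymMat p) : SymMat p :=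
  SymMat.ofMat (A.isHermitian_toMat.cfc (phiScalar β)) (isHermitian_phi β A)

/-- The Clarke generalized Jacobian of a (locally Lipschitz) map: the convex hull of all limits
of derivatives at points of differentiability. -/
def clarkeJacobian {E F : Type*} [NormedAddCommGroup E] [NormedSpace ℝ E]
    [NormedAddCommGroup F] [NormedSpace ℝ F] (G : E → F) (x : E) : Set (E →L[ℝ] F) :=
  convexHull ℝ {L | ∃ u : ℕ → E, Tendsto u atTop (𝓝 x) ∧
    (∀ n, DifferentiableAt ℝ G (u n)) ∧ Tendsto (fun n => fderiv ℝ G (u n)) atTop (𝓝 L)}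

/-- The proximal mapping `Prox_g(u) = argmin_y { g(y) + ½ ‖y - u‖² }`. -/
def prox {E : Type*} [NormedAddCommGroup E] (g : E → ℝ) (u : E) : E :=
  Classical.epsilon fun y => IsMinOn (fun z => g z + 1 / 2 * ‖z - u‖ ^ 2) univ y

/-- The Euclidean projection onto a (closed convex) set `C`. -/
def proj {E : Type*} [NormedAddCommGroup E] (C : Set E) (u : E) : E :=
  Classical.epsilon fun y => y ∈ C ∧ IsMinOn (fun z => ‖u - z‖) C y

/-- `Prox_{λ₁‖·‖₁}` on `ℝ^K`. -/
def proxL1 {K : ℕ} (lam1 : ℝ) : EuclideanSpace ℝ (Fin K) → EuclideanSpace ℝ (Fin K) :=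
  prox fun x => lam1 * ∑ k, |x k|

/-- Projection of `ℝ^K` onto the Euclidean ball of radius `λ₂`. -/
def projBall {K : ℕ} (lam2 : ℝ) : EuclideanSpace ℝ (Fin K) → EuclideanSpace ℝ (Fin K) :=
  proj (Metric.closedBall 0 lam2)

/-- The generalized Jacobian of `Prox_φ`, `φ = λ₁‖·‖₁ + λ₂‖·‖`: all `(I - Σ) Λ` with
`Σ ∈ ∂Π_B(Prox_{λ₁‖·‖₁}(u))` and `Λ ∈ ∂Prox_{λ₁‖·‖₁}(u)`. -/
def jacProxGroup {K : ℕ} (lam1 lam2 : ℝ) (u : EuclideanSpace ℝ (Fin K)) :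
    Set (EuclideanSpace ℝ (Fin K) →L[ℝ] EuclideanSpace ℝ (Fin K)) :=
  {M | ∃ Sg ∈ clarkeJacobian (projBall lam2) (proxL1 lam1 u),
    ∃ Lm ∈ clarkeJacobian (proxL1 lam1) u,
      M = (ContinuousLinearMap.id ℝ (EuclideanSpace ℝ (Fin K)) - Sg).comp Lm}

/-- The surrogate generalized Jacobian of the proximal mapping of the regularizer. -/
def jacProxReg {K p : ℕ} (lam1 lam2 : ℝ) (X : ZSpace K p) :
    Set (ZSpace K p →L[ℝ] ZSpace K p) :=
  {W | ∃ M : Fin p → Fin p → (EuclideanSpace ℝ (Fin K) →L[ℝ] EuclideanSpace ℝ (Fin K)),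
    (∀ i j, i < j → M i j ∈ jacProxGroup lam1 lam2 (group X i j)) ∧
    ∀ (Y : ZSpace K p) (i j : Fin p), group (W Y) i j =
      if i < j then M i j (group Y i j)
      else if i = j then group Y i j
      else M j i (group Y i j)}

/-- The surrogate generalized Jacobian of `∇Υ_t` at `X`: all maps
`D ↦ - σ ((φ⁺_σ)'(Ωt⁽ᵏ⁾ - σ (S⁽ᵏ⁾ + X⁽ᵏ⁾))[D⁽ᵏ⁾])ₖ - σ W[D]` with `W` in the surrogate
generalized Jacobian of the proximal mapping of the regularizer at `(Θt + σ X) / σ`. -/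
def jacGradDual {K p : ℕ} (lam1 lam2 σ : ℝ) (S Ωt Θt X : ZSpace K p) :
    Set (ZSpace K p →L[ℝ] ZSpace K p) :=
  {V | ∃ W ∈ jacProxReg lam1 lam2 (σ⁻¹ • (Θt + σ • X)),
    ∀ (D : ZSpace K p) (k : Fin K), V D k =
      -(σ • fderiv ℝ (phiPlus σ) (Ωt k - σ • (S k + X k)) (D k)) - σ • (W D) k}

/-! ## The conjugate gradient method and the dual semismooth Newton method -/

/-- A state of the conjugate gradient method: iterate, residual and search direction. -/
structure CGState (E : Type*) where
  x : E
  r : E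
  q : E

/-- One step of the conjugate gradient method for `A x = b`. (Once the residual is zero, the
convention `0 / 0 = 0` makes the iterate stationary.) -/
def cgStep {E : Type*} [NormedAddCommGroup E] [InnerProductSpace ℝ E] (A : E →L[ℝ] E)
    (s : CGState E) : CGState E :=
  let α : ℝ := inner ℝ s.r s.r / inner ℝ s.q (A s.q)
  let r' : E := s.r - α • A s.q
  let β : ℝ := inner ℝ r' r' / inner ℝ s.r s.r
  { x := s.x + α • s.q, r := r', q := r' + β • s.q }

/-- The `n`-th iterate of the conjugate gradient method for `A x = b`, started at `0`. -/
def cgIterate {E : Type*} [NormedAddCommGroup E] [InnerProductSpace ℝ E] (A : E →L[ℝ] E)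
    (b : E) (n : ℕ) : E :=
  ((cgStep A)^[n] { x := 0, r := b, q := b }).x

/-- `X : ℕ → ℤ` is an infinite sequence generated by the dual semismooth Newton method with
parameters `η`, `τ`, `μ`, `ρ`. At each iteration an element `V` of the surrogate generalized
Jacobian at the current point is chosen; the direction `D` is an iterate of the conjugate
gradient method for the Newton system `V[D] = -∇Υ_t(X_j)` (written in its positive definite form
`(-V)[D] = ∇Υ_t(X_j)`) that satisfies the inexactness criterion; and the step length is `ρ ^ m`
for the smallest `m` that passes the line search. -/
structure IsDualNewtonSeq {K p : ℕ} (lam1 lam2 σ : ℝ) (S Ωt Θt : ZSpace K p)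
    (η τ μ ρ : ℝ) (X : ℕ → ZSpace K p) : Prop where
  init : X 0 ∈ posDefTuples K p
  step : ∀ j : ℕ,
    ∃ V ∈ jacGradDual lam1 lam2 σ S Ωt Θt (X j),
    ∃ D : ZSpace K p, ∃ m : ℕ,
      (∃ n : ℕ, D = cgIterate (-V) (gradient (dualObj lam1 lam2 σ S Ωt Θt) (X j)) n) ∧
      ‖V D + gradient (dualObj lam1 lam2 σ S Ωt Θt) (X j)‖ ≤
        min η (‖gradient (dualObj lam1 lam2 σ S Ωt Θt) (X j)‖ ^ (1 + τ)) ∧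
      IsLeast {l : ℕ | dualObj lam1 lam2 σ S Ωt Θt (X j + ρ ^ l • D) ≥
        dualObj lam1 lam2 σ S Ωt Θt (X j) +
          μ * ρ ^ l * inner ℝ (gradient (dualObj lam1 lam2 σ S Ωt Θt) (X j)) D} m ∧
      X (j + 1) = X j + ρ ^ m • D

end GGL

end

/-!
The dual objective splits into a part that minimizes over `Ω` and a part that minimizes over `Θ`.
Both minimizers are explicit: `Ω = φ⁺(Ωt - σ (S + X))`, since `φ⁺` is the resolvent of
`Ω ↦ -σ Ω⁻¹`, and `Θ = σ Prox_P((Θt + σ X) / σ)`, where the proximal mapping of the regularizer acts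
on the off-diagonal groups as `(I - Π_B) ∘ Prox_{λ₁‖·‖₁}`. Optimality follows from two subgradient
inequalities, `SymMat.log_det_sub_le` and `inner_sub_proxReg_le`. The primal residual `Ω - Θ` is a
Lipschitz supergradient of the dual objective, hence its gradient (`hasGradientAt_dualObj`), and it
is injective. A suitable trial point of the Lagrangian shows that the dual objective tends to `-∞`
linearly (`exists_dualObj_le`), so there is exactly one maximizer.

The negatives of the generalized Jacobians are symmetric, bounded, and uniformly positive definite
on bounded sets (`jacGradDual_bounds`): the derivative of `φ⁺` at `A` is the inverse of
`H ↦ H + σ Ω⁻¹ H Ω⁻¹` with `Ω = φ⁺(A)`, and `(I - Σ) Λ` is positive semidefinite because `I - Σ` is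
a combination of `I` and `v vᵀ` for `v = Prox_{λ₁‖·‖₁}(u)`, whose support `Λ` fixes.

Global convergence (`newton_global`): a conjugate gradient iterate `D` is orthogonal to its residual
(`inner_cgIterate`), so `⟨∇Υ, D⟩ = -⟨V D, D⟩ ≥ c ‖D‖²`; the line search then takes steps bounded
below, the objective increases, and boundedness from above forces `D → 0` and `∇Υ → 0`.

Local convergence (`newton_local`) rests on two expansions at the maximizer `X̄`. The first is
strong semismoothness, `∇Υ(X) - ∇Υ(X̄) - V (X - X̄) = O(‖X - X̄‖²)` for every generalized Jacobian
`V` at `X` (`semismooth_dualGrad`). For `φ⁺` it is an exact second-order identity for matrix inverses, soft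
thresholding is piecewise affine, and the projection onto the ball is differentiable off the sphere
with an explicit remainder; convexity and closedness carry the estimate over to Clarke Jacobians.
It bounds the error of a full Newton step by `O(‖X - X̄‖ ^ (1 + τ))`. The second,
`Υ(X) ≤ Υ(X̄) + ½⟨∇Υ(X), X - X̄⟩ + O(‖X - X̄‖³)` (`dualObj_expansion`), is the trapezoidal rule;
with `μ < 1/2` it makes the line search accept the full step near `X̄`. For the nonsmooth part it is an
explicit computation, since by homogeneity the minimum over `Θ` is `-(σ/2)‖y‖²` up to a constant,
with `y` the proximal point.
-/

namespace GGL

/-! ### The conjugate gradient method -/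

section ConjugateGradient

variable {E : Type*} [NormedAddCommGroup E] [InnerProductSpace ℝ E]

/-- The `n`-th state of the conjugate gradient method for `A x = b`, started at `0`. -/
noncomputable def cgState (A : E →L[ℝ] E) (b : E) (n : ℕ) : CGState E :=
  (cgStep A)^[n] { x := 0, r := b, q := b }

/-- The step length of the conjugate gradient method in its `n`-th state. -/
noncomputable def cgAlpha (A : E →L[ℝ] E) (b : E) (n : ℕ) : ℝ :=
  inner ℝ (cgState A b n).r (cgState A b n).r / inner ℝ (cgState A b n).q (A (cgState A b n).q)

/-- The coefficient of the old search direction in the `(n + 1)`-st one. -/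
noncomputable def cgBeta (A : E →L[ℝ] E) (b : E) (n : ℕ) : ℝ :=
  inner ℝ (cgState A b (n + 1)).r (cgState A b (n + 1)).r /
    inner ℝ (cgState A b n).r (cgState A b n).r

variable (A : E →L[ℝ] E) (b : E)

theorem cgState_succ (n : ℕ) : cgState A b (n + 1) = cgStep A (cgState A b n) :=
  Function.iterate_succ_apply' _ _ _

theorem cgState_succ_x (n : ℕ) : (cgState A b (n + 1)).x =
    (cgState A b n).x + cgAlpha A b n • (cgState A b n).q := by
  rw [cgState_succ]; rfl

theorem cgState_succ_r (n : ℕ) : (cgState A b (n + 1)).r =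
    (cgState A b n).r - cgAlpha A b n • A (cgState A b n).q := by
  rw [cgState_succ]; rfl

theorem cgState_succ_q (n : ℕ) : (cgState A b (n + 1)).q =
    (cgState A b (n + 1)).r + cgBeta A b n • (cgState A b n).q := by
  unfold cgBeta
  rw [cgState_succ]; rfl

theorem cgState_r_eq (n : ℕ) : (cgState A b n).r = b - A (cgState A b n).x := by
  induction n with
  | zero => simp [cgState]
  | succ n ih =>
    rw [cgState_succ_r, cgState_succ_x, ih, map_add, map_smul]
    abel

/-- A vanishing residual makes the search direction vanish. -/
theorem cgState_q_eq_zero {n : ℕ} (h : (cgState A b n).r = 0) : (cgState A b n).q = 0 := by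
  cases n with
  | zero => simpa [cgState] using h
  | succ n => simp [cgState_succ_q, cgBeta, h]

variable {A}

/-- The orthogonality relations of the conjugate gradient method: the residual `r n` is orthogonal
to the earlier residuals and search directions, and the search direction `q n` is `A`-conjugate to
the earlier ones. -/
theorem cgState_orthogonality (hA : ∀ x y, inner ℝ (A x) y = inner ℝ x (A y))
    (hpos : ∀ x, inner ℝ x (A x) = 0 → x = 0) (n : ℕ) :
    inner ℝ (cgState A b n).r (cgState A b n).q = inner ℝ (cgState A b n).r (cgState A b n).r ∧
    ∀ i < n, inner ℝ (cgState A b n).r (cgState A b i).r = 0 ∧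
      inner ℝ (cgState A b n).r (cgState A b i).q = 0 ∧
      inner ℝ (cgState A b n).q (A (cgState A b i).q) = 0 := by
  induction n using Nat.strong_induction_on with
  | _ n ih =>
  cases n with
  | zero => exact ⟨rfl, fun i hi => absurd hi (Nat.not_lt_zero i)⟩
  | succ n =>
    obtain ⟨h1, h2⟩ := ih n (Nat.lt_succ_self n)
    set s := cgState A b with hs
    set a := cgAlpha A b with ha
    -- The defining property of the step length, which also holds after termination.
    have hα : ∀ k ≤ n, a k * inner ℝ (s k).q (A (s k).q) = inner ℝ (s k).r (s k).r := by
      intro k hk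
      by_cases h0 : inner ℝ (s k).q (A (s k).q) = 0
      · have hq : (s k).q = 0 := hpos _ h0
        have := (ih k (Nat.lt_succ_of_le hk)).1
        rw [hq, inner_zero_right] at this
        rw [h0, mul_zero, this]
      · rw [ha]; unfold cgAlpha; rw [← hs, div_mul_cancel₀ _ h0]
    have hβ : cgBeta A b n * inner ℝ (s n).r (s n).r = inner ℝ (s (n + 1)).r (s (n + 1)).r := by
      by_cases h0 : inner ℝ (s n).r (s n).r = 0
      · have hr : (s n).r = 0 := inner_self_eq_zero.1 h0
        have hq : (s n).q = 0 := cgState_q_eq_zero A b hr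
        have : (s (n + 1)).r = 0 := by rw [hs, cgState_succ_r, ← hs, hr, hq]; simp
        rw [this, hr]; simp
      · unfold cgBeta; rw [← hs, div_mul_cancel₀ _ h0]
    -- The search direction is `A`-conjugate to the earlier residuals.
    have hqr : ∀ i < n, inner ℝ (s n).q (A (s i).r) = 0 := by
      intro i hi
      cases i with
      | zero => exact (h2 0 hi).2.2
      | succ i =>
        have e : (s (i + 1)).r = (s (i + 1)).q - cgBeta A b i • (s i).q := by
          rw [hs, cgState_succ_q]; abel
        rw [e, map_sub, map_smul, inner_sub_right, inner_smul_right, (h2 _ hi).2.2,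
          (h2 i (by omega)).2.2]
        simp
    have hqrn : inner ℝ (s n).q (A (s n).r) = inner ℝ (s n).q (A (s n).q) := by
      cases n with
      | zero => rfl
      | succ i =>
        have e : (s (i + 1)).r = (s (i + 1)).q - cgBeta A b i • (s i).q := by
          rw [hs, cgState_succ_q]; abel
        rw [e, map_sub, map_smul, inner_sub_right, inner_smul_right, (h2 i (by omega)).2.2]
        simp
    have hrr : ∀ i < n + 1, inner ℝ (s (n + 1)).r (s i).r = 0 := by
      intro i hi
      rw [hs, cgState_succ_r, ← hs, ← ha, inner_sub_left, inner_smul_left, hA]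
      rcases Nat.lt_succ_iff_lt_or_eq.1 hi with hi | rfl
      · rw [(h2 i hi).1, hqr i hi]; simp
      · rw [hqrn]; simp [hα i le_rfl]
    have hrq : ∀ i < n + 1, inner ℝ (s (n + 1)).r (s i).q = 0 := by
      intro i hi
      rw [hs, cgState_succ_r, ← hs, ← ha, inner_sub_left, inner_smul_left, hA]
      rcases Nat.lt_succ_iff_lt_or_eq.1 hi with hi | rfl
      · rw [(h2 i hi).2.1, (h2 i hi).2.2]; simp
      · rw [h1]; simp [hα i le_rfl]
    refine ⟨?_, fun i hi => ⟨hrr i hi, hrq i hi, ?_⟩⟩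
    · conv_lhs => rw [hs, cgState_succ_q, ← hs, inner_add_right, inner_smul_right,
        hrq n (Nat.lt_succ_self n), mul_zero, add_zero]
    · by_cases hai : a i = 0
      · have : (s i).r = 0 := by
          have := hα i (Nat.le_of_lt_succ hi)
          rw [hai, zero_mul] at this
          exact inner_self_eq_zero.1 this.symm
        rw [cgState_q_eq_zero A b this]; simp
      · have e : a i • A (s i).q = (s i).r - (s (i + 1)).r := by
          rw [hs, cgState_succ_r, ← ha]; abel
        have e1 : a i * inner ℝ (s (n + 1)).r (A (s i).q) =
            - inner ℝ (s (n + 1)).r (s (i + 1)).r := by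
          rw [← inner_smul_right, e, inner_sub_right, hrr i hi, zero_sub]
        refine (mul_eq_zero.1 ?_).resolve_left hai
        rw [hs, cgState_succ_q, ← hs, inner_add_left, inner_smul_left, mul_add, e1]
        rcases Nat.lt_succ_iff_lt_or_eq.1 hi with hi | rfl
        · rw [(h2 i hi).2.2, hrr (i + 1) (by omega)]; simp
        · have := hα i le_rfl
          simp only [conj_trivial]
          rw [mul_left_comm, this, hβ]
          ring

/-- A conjugate gradient iterate is orthogonal to its residual: it minimizes the quadratic model
over a Krylov space that contains it. -/
theorem inner_cgIterate (hA : ∀ x y, inner ℝ (A x) y = inner ℝ x (A y))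
    (hpos : ∀ x, inner ℝ x (A x) = 0 → x = 0) (n : ℕ) :
    inner ℝ b (cgIterate A b n) = inner ℝ (A (cgIterate A b n)) (cgIterate A b n) := by
  have key : ∀ m : ℕ, ∀ w : E, (∀ i < m, inner ℝ w (cgState A b i).q = 0) →
      inner ℝ w (cgState A b m).x = 0 := by
    intro m w hw
    induction m with
    | zero => simp [cgState]
    | succ m ih =>
      rw [cgState_succ_x, inner_add_right, inner_smul_right, hw m (Nat.lt_succ_self m),
        ih fun i hi => hw i (hi.trans (Nat.lt_succ_self m))]
      simp
  have h := key n (cgState A b n).r fun i hi => ((cgState_orthogonality b hA hpos n).2 i hi).2.1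
  rw [cgState_r_eq, inner_sub_left] at h
  exact sub_eq_zero.1 h

end ConjugateGradient

/-! ### Concave functions with a Lipschitz supergradient -/

section Supergradient

variable {E : Type*} [NormedAddCommGroup E] [InnerProductSpace ℝ E]

/-- A Lipschitz selection of supergradients of a function is its gradient. -/
theorem hasGradientAt_of_supergradient [CompleteSpace E] {F : E → ℝ} {Z : E → E} {L : ℝ}
    (hsup : ∀ X Y, F Y ≤ F X + inner ℝ (Z X) (Y - X))
    (hlip : ∀ X Y, ‖Z X - Z Y‖ ≤ L * ‖X - Y‖) (X : E) : HasGradientAt F (Z X) X := by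
  rw [hasGradientAt_iff_isLittleO]
  have hO : (fun Y => F Y - F X - inner ℝ (Z X) (Y - X)) =O[𝓝 X] fun Y => ‖Y - X‖ ^ 2 := by
    refine IsBigO.of_bound L (Eventually.of_forall fun Y => ?_)
    have h1 := hsup X Y
    have h2 := hsup Y X
    have h3 : inner ℝ (Z Y) (X - Y) = - inner ℝ (Z Y) (Y - X) := by
      rw [← neg_sub Y X, inner_neg_right]
    have h4 : -(L * ‖Y - X‖ * ‖Y - X‖) ≤ inner ℝ (Z Y - Z X) (Y - X) := by
      refine (neg_le_neg ?_).trans (neg_le_of_abs_le (abs_real_inner_le_norm _ _))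
      gcongr
      exact hlip Y X
    rw [inner_sub_left] at h4
    rw [Real.norm_eq_abs, Real.norm_eq_abs, abs_of_nonneg (sq_nonneg ‖Y - X‖), abs_le]
    constructor <;> nlinarith [norm_nonneg (Y - X)]
  refine hO.trans_isLittleO ?_
  have h0 : Tendsto (fun Y => ‖Y - X‖) (𝓝 X) (𝓝 0) := by
    have : Continuous fun Y : E => ‖Y - X‖ := by fun_prop
    simpa using this.tendsto X
  rw [← isLittleO_norm_right]
  have := (isLittleO_one_iff ℝ).2 h0
  simpa [sq] using this.mul_isBigO (isBigO_refl (fun Y => ‖Y - X‖) (𝓝 X))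

/-- The lower bound along a step that complements the supergradient inequality. -/
theorem le_of_supergradient {F : E → ℝ} {Z : E → E} {L : ℝ}
    (hsup : ∀ X Y, F Y ≤ F X + inner ℝ (Z X) (Y - X))
    (hlip : ∀ X Y, ‖Z X - Z Y‖ ≤ L * ‖X - Y‖) (X D : E) :
    F X + inner ℝ (Z X) D - L * ‖D‖ ^ 2 ≤ F (X + D) := by
  have h1 := hsup (X + D) X
  have h2 : inner ℝ (Z (X + D)) (X - (X + D)) = - inner ℝ (Z (X + D)) D := by
    rw [← inner_neg_right]; congr 1; abel
  have h3 : -(L * ‖D‖ * ‖D‖) ≤ inner ℝ (Z (X + D) - Z X) D := by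
    refine (neg_le_neg ?_).trans (neg_le_of_abs_le (abs_real_inner_le_norm _ _))
    gcongr
    simpa using hlip (X + D) X
  rw [inner_sub_left] at h3
  nlinarith

end Supergradient

/-! ### Convergence of an inexact semismooth Newton method with line search -/

section Newton

variable {E : Type*} [NormedAddCommGroup E] [InnerProductSpace ℝ E]

/-- The inexactness criterion `min (η, t ^ (1 + τ))` is a fixed fraction of `t`, by weighted
geometric averaging of the two bounds. -/
theorem min_rpow_le_mul {η τ : ℝ} (hη : η ∈ Ioo (0 : ℝ) 1) (hτ : 0 < τ) :
    ∃ κ : ℝ, κ < 1 ∧ ∀ t : ℝ, 0 ≤ t → min η (t ^ (1 + τ)) ≤ κ * t := by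
  have h1 : (0 : ℝ) < 1 + τ := by linarith
  refine ⟨η ^ (τ / (1 + τ)), Real.rpow_lt_one hη.1.le hη.2 (by positivity), fun t ht => ?_⟩
  set m := min η (t ^ (1 + τ)) with hm
  have hm0 : 0 ≤ m := le_min hη.1.le (Real.rpow_nonneg ht _)
  have e : m = m ^ (τ / (1 + τ)) * m ^ (1 / (1 + τ)) := by
    rw [← Real.rpow_add_of_nonneg hm0 (by positivity) (by positivity), ← add_div, add_comm τ,
      div_self h1.ne', Real.rpow_one]
  rw [e]
  have h2 : m ^ (1 / (1 + τ)) ≤ t := by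
    calc m ^ (1 / (1 + τ)) ≤ (t ^ (1 + τ)) ^ (1 / (1 + τ)) :=
          Real.rpow_le_rpow hm0 (min_le_right _ _) (by positivity)
      _ = t := by rw [← Real.rpow_mul ht, mul_one_div_cancel h1.ne', Real.rpow_one]
  have h3 : m ^ (τ / (1 + τ)) ≤ η ^ (τ / (1 + τ)) :=
    Real.rpow_le_rpow hm0 (min_le_left _ _) (by positivity)
  exact mul_le_mul h3 h2 (Real.rpow_nonneg hm0 _) (Real.rpow_nonneg hη.1.le _)

/-- One iteration of an inexact Newton method with line search for maximizing `F` with gradient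
`Z`: from `x` to `x'`, with Jacobian `V`, direction `D` and step length `ρ ^ m`. -/
structure IsNewtonStep (F : E → ℝ) (Z : E → E) (η τ μ ρ : ℝ) (V : E →L[ℝ] E) (D : E) (m : ℕ)
    (x x' : E) : Prop where
  inner_eq : inner ℝ (Z x) D = - inner ℝ (V D) D
  residual : ‖V D + Z x‖ ≤ min η (‖Z x‖ ^ (1 + τ))
  isLeast : IsLeast {l : ℕ | F x + μ * ρ ^ l * inner ℝ (Z x) D ≤ F (x + ρ ^ l • D)} m
  next : x' = x + ρ ^ m • D

/-- Global convergence: if the Jacobians are uniformly definite on bounded sets and the superlevel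
sets are bounded, the gradients along the sequence tend to zero and the sequence stays bounded. -/
theorem newton_global {F : E → ℝ} {Z : E → E} {J : E → Set (E →L[ℝ] E)} {L : ℝ}
    (hsup : ∀ X Y, F Y ≤ F X + inner ℝ (Z X) (Y - X))
    (hlip : ∀ X Y, ‖Z X - Z Y‖ ≤ L * ‖X - Y‖) {Xbar : E} (hmax : ∀ Y, F Y ≤ F Xbar)
    (hlevel : ∀ a, ∃ R, ∀ X, a ≤ F X → ‖X‖ ≤ R)
    (hJ : ∀ R, ∃ c > 0, ∃ C, ∀ X, ‖X‖ ≤ R → ∀ V ∈ J X, ∀ D,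
      c * ‖D‖ ^ 2 ≤ - inner ℝ (V D) D ∧ ‖V D‖ ≤ C * ‖D‖)
    {η τ μ ρ : ℝ} (hη : η ∈ Ioo (0 : ℝ) 1) (hτ : 0 < τ) (hμ : μ ∈ Ioo (0 : ℝ) (1 / 2))
    (hρ : ρ ∈ Ioo (0 : ℝ) 1) {X : ℕ → E} {V : ℕ → E →L[ℝ] E} {D : ℕ → E} {m : ℕ → ℕ}
    (hV : ∀ j, V j ∈ J (X j))
    (hstep : ∀ j, IsNewtonStep F Z η τ μ ρ (V j) (D j) (m j) (X j) (X (j + 1))) :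
    (∃ R, ∀ j, ‖X j‖ ≤ R) ∧ Tendsto (fun j => Z (X j)) atTop (𝓝 0) := by
  have hq0 : ∀ j, 0 ≤ inner ℝ (Z (X j)) (D j) := by
    intro j
    obtain ⟨c, hc, C, h⟩ := hJ ‖X j‖
    rw [(hstep j).inner_eq]
    exact le_trans (by positivity) (h _ le_rfl _ (hV j) (D j)).1
  have hinc : ∀ j, F (X j) + μ * ρ ^ m j * inner ℝ (Z (X j)) (D j) ≤ F (X (j + 1)) := by
    intro j
    rw [(hstep j).next]
    exact (hstep j).isLeast.1
  have hmono : Monotone fun j => F (X j) := monotone_nat_of_le_succ fun j => by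
    have : 0 ≤ μ * ρ ^ m j * inner ℝ (Z (X j)) (D j) :=
      mul_nonneg (mul_nonneg hμ.1.le (pow_nonneg hρ.1.le _)) (hq0 j)
    linarith [hinc j]
  obtain ⟨R, hR⟩ := hlevel (F (X 0))
  have hbdd : ∀ j, ‖X j‖ ≤ R := fun j => hR _ (hmono (Nat.zero_le j))
  refine ⟨⟨R, hbdd⟩, ?_⟩
  obtain ⟨c, hc, C, hcC⟩ := hJ R
  -- Steps that are short compared with `c / L` pass the line search, so `m` is bounded.
  obtain ⟨l0, hl0⟩ : ∃ l0 : ℕ, L * ρ ^ l0 ≤ (1 - μ) * c := by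
    have ht : Tendsto (fun l : ℕ => L * ρ ^ l) atTop (𝓝 (L * 0)) :=
      (tendsto_pow_atTop_nhds_zero_of_lt_one hρ.1.le hρ.2).const_mul L
    rw [mul_zero] at ht
    have hpos : 0 < (1 - μ) * c := mul_pos (by linarith [hμ.2]) hc
    exact (ht.eventually (ge_mem_nhds hpos)).exists
  have hm : ∀ j, m j ≤ l0 := by
    intro j
    refine (hstep j).isLeast.2 ?_
    have h1 := le_of_supergradient hsup hlip (X j) (ρ ^ l0 • D j)
    have h2 := (hcC _ (hbdd j) _ (hV j) (D j)).1
    rw [← (hstep j).inner_eq] at h2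
    rw [inner_smul_right, norm_smul, Real.norm_eq_abs, abs_of_nonneg (pow_nonneg hρ.1.le _)] at h1
    have h3 : 0 < ρ ^ l0 := pow_pos hρ.1 _
    have h4 : L * ρ ^ l0 * ‖D j‖ ^ 2 ≤ (1 - μ) * inner ℝ (Z (X j)) (D j) := by
      calc L * ρ ^ l0 * ‖D j‖ ^ 2 ≤ (1 - μ) * c * ‖D j‖ ^ 2 := by gcongr
        _ = (1 - μ) * (c * ‖D j‖ ^ 2) := by ring
        _ ≤ _ := mul_le_mul_of_nonneg_left h2 (by linarith [hμ.2])
    have h5 := mul_le_mul_of_nonneg_left h4 h3.le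
    simp only [mem_ofPred_eq]
    nlinarith
  -- The bounded increasing sequence of values forces `⟨Z (X j), D j⟩ → 0`.
  have hconv : Tendsto (fun j => F (X (j + 1)) - F (X j)) atTop (𝓝 0) := by
    have h1 := tendsto_atTop_ciSup hmono ⟨F Xbar, by rintro _ ⟨j, rfl⟩; exact hmax _⟩
    simpa using (h1.comp (tendsto_add_atTop_nat 1)).sub h1
  have hD : ∀ j, μ * ρ ^ l0 * c * ‖D j‖ ^ 2 ≤ F (X (j + 1)) - F (X j) := by
    intro j
    have h2 := (hcC _ (hbdd j) _ (hV j) (D j)).1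
    rw [← (hstep j).inner_eq] at h2
    have h3 : ρ ^ l0 ≤ ρ ^ m j := pow_le_pow_of_le_one hρ.1.le hρ.2.le (hm j)
    have h4 : μ * ρ ^ l0 * (c * ‖D j‖ ^ 2) ≤ μ * ρ ^ m j * inner ℝ (Z (X j)) (D j) := by
      have := hμ.1
      have := hρ.1
      gcongr
    linarith [hinc j]
  have hD0 : Tendsto (fun j => ‖D j‖) atTop (𝓝 0) := by
    have hk : 0 < μ * ρ ^ l0 * c := mul_pos (mul_pos hμ.1 (pow_pos hρ.1 _)) hc
    have h1 : Tendsto (fun j => ‖D j‖ ^ 2) atTop (𝓝 0) := by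
      refine squeeze_zero (fun j => by positivity) (fun j => (le_div_iff₀' hk).2 (hD j)) ?_
      simpa using hconv.div_const (μ * ρ ^ l0 * c)
    simpa using h1.sqrt
  obtain ⟨κ, hκ, hκ'⟩ := min_rpow_le_mul hη hτ
  rw [tendsto_zero_iff_norm_tendsto_zero]
  refine squeeze_zero (fun j => norm_nonneg _) (g := fun j => C * ‖D j‖ / (1 - κ)) (fun j => ?_) ?_
  · rw [le_div_iff₀' (by linarith)]
    have h1 := (hstep j).residual.trans (hκ' _ (norm_nonneg _))
    have h2 := (hcC _ (hbdd j) _ (hV j) (D j)).2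
    have h3 : ‖Z (X j)‖ ≤ ‖V j (D j) + Z (X j)‖ + ‖V j (D j)‖ := by
      simpa using norm_sub_le (V j (D j) + Z (X j)) (V j (D j))
    linarith
  · simpa using (hD0.const_mul C).div_const (1 - κ)

/-- Local convergence: near a zero of the gradient at which the Jacobians are strongly semismooth
and the function has a second-order expansion, the unit step is accepted and the error is raised
to the power `1 + τ`. -/
theorem newton_local {F : E → ℝ} {Z : E → E} {J : E → Set (E →L[ℝ] E)} {L : ℝ} (hL : 0 ≤ L)
    (hsup : ∀ X Y, F Y ≤ F X + inner ℝ (Z X) (Y - X))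
    (hlip : ∀ X Y, ‖Z X - Z Y‖ ≤ L * ‖X - Y‖) {Xbar : E} (hzero : Z Xbar = 0)
    (hJ : ∀ R, ∃ c > 0, ∃ C, ∀ X, ‖X‖ ≤ R → ∀ V ∈ J X, ∀ D,
      c * ‖D‖ ^ 2 ≤ - inner ℝ (V D) D ∧ ‖V D‖ ≤ C * ‖D‖)
    (hsemi : ∃ C, ∀ᶠ X in 𝓝 Xbar, ∀ V ∈ J X, ‖Z X - V (X - Xbar)‖ ≤ C * ‖X - Xbar‖ ^ 2)
    (hexp : ∃ C, ∀ᶠ X in 𝓝 Xbar,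
      F X ≤ F Xbar + 1 / 2 * inner ℝ (Z X) (X - Xbar) + C * ‖X - Xbar‖ ^ 3)
    {η τ μ ρ : ℝ} (hτ : τ ∈ Ioc (0 : ℝ) 1) (hμ : μ ∈ Ioo (0 : ℝ) (1 / 2)) :
    ∃ B, ∀ᶠ X in 𝓝 Xbar, ∀ V ∈ J X, ∀ D m X', IsNewtonStep F Z η τ μ ρ V D m X X' →
      ‖X' - Xbar‖ ≤ B * ‖X - Xbar‖ ^ (1 + τ) := by
  obtain ⟨c, hc, C, hcC⟩ := hJ (‖Xbar‖ + 1)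
  obtain ⟨C1, hC1⟩ := hsemi
  obtain ⟨C2, hC2⟩ := hexp
  have hτ1 : 0 < 1 + τ := by linarith [hτ.1]
  set B := (|C1| + L ^ (1 + τ)) / c with hB
  have hB0 : 0 ≤ B := by positivity
  refine ⟨B, ?_⟩
  have hd : Tendsto (fun X => ‖X - Xbar‖) (𝓝 Xbar) (𝓝 0) := by
    have : Continuous fun Y : E => ‖Y - Xbar‖ := by fun_prop
    simpa using this.tendsto Xbar
  have hdτ : Tendsto (fun X => ‖X - Xbar‖ ^ τ) (𝓝 Xbar) (𝓝 0) := by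
    have := hd.rpow_const (p := τ) (Or.inr hτ.1.le)
    rwa [Real.zero_rpow hτ.1.ne'] at this
  have hμ' : 0 < 1 / 2 - μ := by linarith [hμ.2]
  -- The relative error of the step, and that of the comparison in the line search, are small.
  have hs1 : ∀ᶠ X in 𝓝 Xbar, B * ‖X - Xbar‖ ^ τ ≤ 1 / 2 := by
    have := hdτ.const_mul B
    rw [mul_zero] at this
    exact this.eventually (ge_mem_nhds (by norm_num))
  have hs2 : ∀ᶠ X in 𝓝 Xbar, L * (B * ‖X - Xbar‖ ^ τ) ^ 2 + 1 / 2 * L * (B * ‖X - Xbar‖ ^ τ) +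
      C2 * ‖X - Xbar‖ ≤ (1 / 2 - μ) * (c / 4) := by
    have h1 := hdτ.const_mul B
    rw [mul_zero] at h1
    have h2 := (((h1.pow 2).const_mul L).add (h1.const_mul (1 / 2 * L))).add (hd.const_mul C2)
    simp only [ne_eq, OfNat.ofNat_ne_zero, not_false_eq_true, zero_pow, mul_zero, add_zero] at h2
    exact h2.eventually (ge_mem_nhds (by positivity))
  filter_upwards [hC1, hC2, hs1, hs2, hd.eventually (ge_mem_nhds one_pos)]
    with X hX1 hX2 hX3 hX4 hX5 V hV D m X' hst
  have hXR : ‖X‖ ≤ ‖Xbar‖ + 1 := by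
    have := norm_add_le Xbar (X - Xbar)
    rw [add_sub_cancel] at this
    linarith
  set h := X - Xbar with hh
  set e := X + D - Xbar with he
  have hZ : ‖Z X‖ ≤ L * ‖h‖ := by simpa [hzero] using hlip X Xbar
  have hpow : ‖h‖ ^ (1 + τ) = ‖h‖ ^ τ * ‖h‖ := by
    rcases eq_or_lt_of_le (norm_nonneg h) with h0 | h0
    · rw [← h0, Real.zero_rpow hτ1.ne', mul_zero]
    · rw [add_comm, Real.rpow_add h0, Real.rpow_one]
  have hsq : ‖h‖ ^ 2 ≤ ‖h‖ ^ (1 + τ) := by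
    rw [hpow, sq]
    refine mul_le_mul_of_nonneg_right ?_ (norm_nonneg _)
    conv_lhs => rw [← Real.rpow_one ‖h‖]
    rcases eq_or_lt_of_le (norm_nonneg h) with h0 | h0
    · rw [← h0, Real.zero_rpow one_ne_zero, Real.zero_rpow hτ.1.ne']
    · exact Real.rpow_le_rpow_of_exponent_ge h0 hX5 hτ.2
  have hVc : ∀ G, c * ‖G‖ ≤ ‖V G‖ := by
    intro G
    have h1 := (hcC X hXR V hV G).1
    have h2 : - inner ℝ (V G) G ≤ ‖V G‖ * ‖G‖ :=
      (neg_le_abs _).trans (abs_real_inner_le_norm _ _)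
    rcases eq_or_lt_of_le (norm_nonneg G) with h0 | h0
    · rw [← h0, mul_zero]; exact norm_nonneg _
    · nlinarith
  have hVe : V e = (V D + Z X) - (Z X - V h) := by
    have : e = h + D := by rw [he, hh]; abel
    rw [this, map_add]; abel
  have hres : ‖V D + Z X‖ ≤ L ^ (1 + τ) * ‖h‖ ^ (1 + τ) := by
    rw [← Real.mul_rpow hL (norm_nonneg _)]
    exact (hst.residual.trans (min_le_right _ _)).trans
      (Real.rpow_le_rpow (norm_nonneg _) hZ hτ1.le)
  have heB : ‖e‖ ≤ B * ‖h‖ ^ (1 + τ) := by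
    rw [hB, div_mul_eq_mul_div, le_div_iff₀' hc]
    calc c * ‖e‖ ≤ ‖V e‖ := hVc e
      _ ≤ ‖V D + Z X‖ + ‖Z X - V h‖ := by rw [hVe]; exact norm_sub_le _ _
      _ ≤ L ^ (1 + τ) * ‖h‖ ^ (1 + τ) + |C1| * ‖h‖ ^ (1 + τ) := by
          refine add_le_add hres ((hX1 V hV).trans ?_)
          exact (mul_le_mul_of_nonneg_right (le_abs_self _) (by positivity)).trans
            (mul_le_mul_of_nonneg_left hsq (abs_nonneg _))
      _ = _ := by ring
  have heB' : ‖e‖ ≤ B * ‖h‖ ^ τ * ‖h‖ := by rw [mul_assoc, ← hpow]; exact heB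
  -- The unit step is accepted.
  have hm : m = 0 := by
    refine Nat.le_zero.1 (hst.isLeast.2 ?_)
    simp only [mem_ofPred_eq, pow_zero, mul_one, one_smul]
    set ε := B * ‖h‖ ^ τ with hε
    have hε0 : 0 ≤ ε := by positivity
    have h1 := le_of_supergradient hsup hlip Xbar e
    have h2 : Xbar + e = X + D := by rw [he]; abel
    rw [h2, hzero, inner_zero_left, add_zero] at h1
    have h3 := (hcC X hXR V hV D).1
    rw [← hst.inner_eq] at h3
    have h4 : inner ℝ (Z X) h = inner ℝ (Z X) e - inner ℝ (Z X) D := by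
      rw [← inner_sub_right]; congr 1; rw [he, hh]; abel
    have h5 : inner ℝ (Z X) e ≤ L * ‖h‖ * ‖e‖ :=
      (real_inner_le_norm _ _).trans (mul_le_mul_of_nonneg_right hZ (norm_nonneg _))
    have h6 : ‖h‖ / 2 ≤ ‖D‖ := by
      have : h = e - D := by rw [he, hh]; abel
      have h7 := norm_sub_le e D
      rw [← this] at h7
      have : ε * ‖h‖ ≤ 1 / 2 * ‖h‖ := mul_le_mul_of_nonneg_right hX3 (norm_nonneg _)
      linarith
    have h7 : c / 4 * ‖h‖ ^ 2 ≤ inner ℝ (Z X) D := by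
      refine le_trans ?_ h3
      have : (‖h‖ / 2) ^ 2 ≤ ‖D‖ ^ 2 := by gcongr
      nlinarith
    have h8 : L * ‖e‖ ^ 2 ≤ L * ε ^ 2 * ‖h‖ ^ 2 := by
      calc L * ‖e‖ ^ 2 ≤ L * (ε * ‖h‖) ^ 2 := by gcongr
        _ = _ := by ring
    have h9 : L * ‖h‖ * ‖e‖ ≤ L * ε * ‖h‖ ^ 2 := by
      calc L * ‖h‖ * ‖e‖ ≤ L * ‖h‖ * (ε * ‖h‖) := by gcongr
        _ = _ := by ring
    have h10 := mul_le_mul_of_nonneg_right hX4 (sq_nonneg ‖h‖)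
    have h11 := mul_le_mul_of_nonneg_left h7 hμ'.le
    rw [h4] at hX2
    nlinarith
  rw [hst.next, hm, pow_zero, one_smul]
  exact heB

/-- The convergence theorem for the inexact Newton method with line search. -/
theorem newton_convergence [ProperSpace E] {F : E → ℝ} {Z : E → E} {J : E → Set (E →L[ℝ] E)}
    {L : ℝ} (hL : 0 ≤ L)
    (hsup : ∀ X Y, F Y ≤ F X + inner ℝ (Z X) (Y - X))
    (hlip : ∀ X Y, ‖Z X - Z Y‖ ≤ L * ‖X - Y‖) {Xbar : E} (hmax : ∀ Y, F Y ≤ F Xbar)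
    (hzero : ∀ X, Z X = 0 ↔ X = Xbar)
    (hlevel : ∀ a, ∃ R, ∀ X, a ≤ F X → ‖X‖ ≤ R)
    (hJ : ∀ R, ∃ c > 0, ∃ C, ∀ X, ‖X‖ ≤ R → ∀ V ∈ J X, ∀ D,
      c * ‖D‖ ^ 2 ≤ - inner ℝ (V D) D ∧ ‖V D‖ ≤ C * ‖D‖)
    (hsemi : ∃ C, ∀ᶠ X in 𝓝 Xbar, ∀ V ∈ J X, ‖Z X - V (X - Xbar)‖ ≤ C * ‖X - Xbar‖ ^ 2)
    (hexp : ∃ C, ∀ᶠ X in 𝓝 Xbar,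
      F X ≤ F Xbar + 1 / 2 * inner ℝ (Z X) (X - Xbar) + C * ‖X - Xbar‖ ^ 3)
    {η τ μ ρ : ℝ} (hη : η ∈ Ioo (0 : ℝ) 1) (hτ : τ ∈ Ioc (0 : ℝ) 1)
    (hμ : μ ∈ Ioo (0 : ℝ) (1 / 2)) (hρ : ρ ∈ Ioo (0 : ℝ) 1) {X : ℕ → E}
    (hX : ∀ j, ∃ V ∈ J (X j), ∃ D m, IsNewtonStep F Z η τ μ ρ V D m (X j) (X (j + 1))) :
    Tendsto X atTop (𝓝 Xbar) ∧
    ((fun j => ‖X (j + 1) - Xbar‖) =O[atTop] fun j => ‖X j - Xbar‖ ^ (1 + τ)) ∧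
    ((fun j => ‖X (j + 1) - Xbar‖) =o[atTop] fun j => ‖X j - Xbar‖) ∧
    (τ = 1 → (fun j => ‖X (j + 1) - Xbar‖) =O[atTop] fun j => ‖X j - Xbar‖ ^ 2) := by
  choose V hV D m hst using hX
  obtain ⟨⟨R, hR⟩, hZ⟩ := newton_global hsup hlip hmax hlevel hJ hη hτ.1 hμ hρ hV hst
  have hcont : Continuous Z :=
    (LipschitzWith.of_dist_le_mul (K := L.toNNReal) fun x y => by
      rw [dist_eq_norm, dist_eq_norm, Real.coe_toNNReal _ hL]; exact hlip x y).continuous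
  have hlim : Tendsto X atTop (𝓝 Xbar) := by
    refine (isCompact_closedBall (0 : E) R).tendsto_nhds_of_unique_mapClusterPt
      (Eventually.of_forall fun j => by simpa using hR j) fun Y _ hY => (hzero Y).1 ?_
    obtain ⟨φ, hφ, hφY⟩ := hY.tendsto_subseq
    exact tendsto_nhds_unique ((hcont.tendsto Y).comp hφY) (hZ.comp hφ.tendsto_atTop)
  obtain ⟨B, hB⟩ := newton_local (η := η) (ρ := ρ) hL hsup hlip ((hzero Xbar).2 rfl) hJ hsemi hexp
    hτ hμ
  have hO : (fun j => ‖X (j + 1) - Xbar‖) =O[atTop] fun j => ‖X j - Xbar‖ ^ (1 + τ) := by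
    refine IsBigO.of_bound B ?_
    filter_upwards [hlim.eventually hB] with j hj
    rw [norm_norm, Real.norm_of_nonneg (Real.rpow_nonneg (norm_nonneg _) _)]
    exact hj _ (hV j) _ _ _ (hst j)
  refine ⟨hlim, hO, hO.trans_isLittleO ?_, fun h => ?_⟩
  · have h0 : Tendsto (fun j => ‖X j - Xbar‖) atTop (𝓝 0) := by
      simpa using (hlim.sub_const Xbar).norm
    have h1 := h0.rpow_const (p := τ) (Or.inr hτ.1.le)
    rw [Real.zero_rpow hτ.1.ne'] at h1
    have h2 := ((isLittleO_one_iff ℝ).2 h1).mul_isBigO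
      (isBigO_refl (fun j => ‖X j - Xbar‖) atTop)
    simp only [one_mul] at h2
    refine h2.congr_left fun j => ?_
    rcases eq_or_lt_of_le (norm_nonneg (X j - Xbar)) with h0 | h0
    · rw [← h0, mul_zero, Real.zero_rpow (by linarith [hτ.1])]
    · rw [add_comm 1 τ, Real.rpow_add h0, Real.rpow_one]
  · subst h
    refine hO.congr_right fun j => ?_
    rw [one_add_one_eq_two, Real.rpow_two]

end Newton

/-! ### Symmetric matrices and the log-determinant -/

namespace SymMat

variable {p : ℕ}

@[ext]
theorem ext_toMat {A B : SymMat p} (h : A.toMat = B.toMat) : A = B := by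
  apply Subtype.ext
  ext ⟨i, j⟩
  exact congrFun (congrFun h i) j

@[simp]
theorem toMat_ofMat (M : Matrix (Fin p) (Fin p) ℝ) (hM : M.IsHermitian) :
    (ofMat M hM).toMat = M := rfl

@[simp] theorem toMat_add (A B : SymMat p) : (A + B).toMat = A.toMat + B.toMat := rfl
@[simp] theorem toMat_sub (A B : SymMat p) : (A - B).toMat = A.toMat - B.toMat := rfl
@[simp] theorem toMat_smul (c : ℝ) (A : SymMat p) : (c • A).toMat = c • A.toMat := rfl

theorem inner_eq_sum (A B : SymMat p) : inner ℝ A B = ∑ i, ∑ j, A.toMat i j * B.toMat i j := by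
  rw [Submodule.coe_inner, PiLp.inner_apply, Fintype.sum_prod_type]
  simp [toMat, mul_comm]

theorem inner_eq_trace (A B : SymMat p) : inner ℝ A B = (A.toMat * B.toMat).trace := by
  rw [inner_eq_sum, Matrix.trace]
  refine Finset.sum_congr rfl fun i _ => Finset.sum_congr rfl fun j _ => ?_
  rw [← B.isHermitian_toMat.apply i j]
  simp

theorem inner_smul_left' (c : ℝ) (A B : SymMat p) : inner ℝ (c • A) B = c * inner ℝ A B :=
  real_inner_smul_left A B c

theorem inner_smul_right' (c : ℝ) (A B : SymMat p) : inner ℝ A (c • B) = c * inner ℝ A B :=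
  real_inner_smul_right A B c

open scoped Matrix.Norms.Frobenius in
theorem norm_eq (A : SymMat p) : ‖A‖ = ‖A.toMat‖ := by
  rw [Matrix.frobenius_norm_def, ← Real.sqrt_eq_rpow, norm_eq_sqrt_real_inner, inner_eq_sum]
  simp [sq]

/-- The inverse of a symmetric matrix (zero if the determinant vanishes). -/
noncomputable def inv (A : SymMat p) : SymMat p := ofMat A.toMat⁻¹ A.isHermitian_toMat.inv

@[simp] theorem toMat_inv (A : SymMat p) : A.inv.toMat = A.toMat⁻¹ := rfl

/-- The linear map `H ↦ G H G` on symmetric matrices. -/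
noncomputable def sandwich (G : SymMat p) : SymMat p →L[ℝ] SymMat p :=
  LinearMap.toContinuousLinearMap
    { toFun := fun H => ofMat (G.toMat * H.toMat * G.toMat) (by
        have := H.isHermitian_toMat
        rw [Matrix.IsHermitian, Matrix.conjTranspose_mul, Matrix.conjTranspose_mul,
          G.isHermitian_toMat.eq, this.eq, Matrix.mul_assoc])
      map_add' := fun H H' => by
        ext1
        simp [Matrix.mul_add, Matrix.add_mul]
      map_smul' := fun c H => by
        ext1
        simp }

@[simp] theorem toMat_sandwich (G H : SymMat p) :
    (sandwich G H).toMat = G.toMat * H.toMat * G.toMat := rfl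

theorem inner_sandwich_left (G H H' : SymMat p) :
    inner ℝ (sandwich G H) H' = inner ℝ H (sandwich G H') := by
  rw [inner_eq_trace, inner_eq_trace, toMat_sandwich, toMat_sandwich, Matrix.mul_assoc,
    Matrix.mul_assoc, Matrix.trace_mul_comm]
  simp only [Matrix.mul_assoc]

open scoped Matrix.Norms.Frobenius in
theorem norm_sandwich_le (G H : SymMat p) : ‖sandwich G H‖ ≤ ‖G‖ ^ 2 * ‖H‖ := by
  rw [norm_eq, norm_eq G, norm_eq H, toMat_sandwich]
  calc _ ≤ ‖G.toMat * H.toMat‖ * ‖G.toMat‖ := Matrix.frobenius_norm_mul _ _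
    _ ≤ ‖G.toMat‖ * ‖H.toMat‖ * ‖G.toMat‖ := by
      gcongr; exact Matrix.frobenius_norm_mul _ _
    _ = _ := by ring

open scoped MatrixOrder in
theorem exists_eq_conjTranspose_mul {M : Matrix (Fin p) (Fin p) ℝ} (hM : M.PosSemidef) :
    ∃ C : Matrix (Fin p) (Fin p) ℝ, M = C.conjTranspose * C := by
  obtain ⟨C, hC⟩ := CStarAlgebra.nonneg_iff_eq_star_mul_self.1 hM.nonneg
  exact ⟨C, hC⟩

theorem inner_sandwich_nonneg {G : SymMat p} (hG : G.toMat.PosSemidef) (H : SymMat p) :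
    0 ≤ inner ℝ (sandwich G H) H := by
  obtain ⟨C, hC⟩ := exists_eq_conjTranspose_mul hG
  set N := C * H.toMat * C.conjTranspose with hN
  have e : inner ℝ (sandwich G H) H = (N.conjTranspose * N).trace := by
    have hNs : N.conjTranspose = N := by
      rw [hN, Matrix.conjTranspose_mul, Matrix.conjTranspose_mul, H.isHermitian_toMat.eq,
        Matrix.conjTranspose_conjTranspose, Matrix.mul_assoc]
    rw [inner_eq_trace, toMat_sandwich, hNs, hC, hN]
    simp only [Matrix.mul_assoc]
    rw [Matrix.trace_mul_comm]
    simp only [Matrix.mul_assoc]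
  rw [e]
  exact (Matrix.posSemidef_conjTranspose_mul_self N).trace_nonneg

/-- Summing `log x ≤ x - 1` over the eigenvalues. -/
theorem log_det_le_trace {M : Matrix (Fin p) (Fin p) ℝ} (hM : M.PosDef) :
    Real.log M.det ≤ M.trace - p := by
  have hpos := hM.eigenvalues_pos
  rw [hM.isHermitian.det_eq_prod_eigenvalues, hM.isHermitian.trace_eq_sum_eigenvalues]
  simp only [RCLike.ofReal_real_eq_id, id]
  rw [Real.log_prod fun i _ => (hpos i).ne']
  calc _ ≤ ∑ i, (hM.isHermitian.eigenvalues i - 1) :=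
        Finset.sum_le_sum fun i _ => Real.log_le_sub_one_of_pos (hpos i)
    _ = _ := by simp

/-- The subgradient inequality of the convex function `-log det`. -/
theorem log_det_sub_le {A B : SymMat p} (hA : A.toMat.PosDef) (hB : B.toMat.PosDef) :
    Real.log B.toMat.det - Real.log A.toMat.det ≤ inner ℝ A.inv (B - A) := by
  obtain ⟨C, hC⟩ := exists_eq_conjTranspose_mul hA.inv.posSemidef
  have hdet : A.toMat⁻¹.det = C.det * C.det := by
    rw [hC, Matrix.det_mul, Matrix.det_conjTranspose]; simp
  have hdetC : C.det ≠ 0 := fun h => by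
    have := hA.inv.det_pos
    rw [hdet, h] at this
    simp at this
  have hCu : IsUnit C := (Matrix.isUnit_iff_isUnit_det C).2 (isUnit_iff_ne_zero.2 hdetC)
  have hM : (C * B.toMat * C.conjTranspose).PosDef := by
    refine hB.mul_mul_conjTranspose_same ?_
    exact Matrix.vecMul_injective_iff_isUnit.2 hCu
  have h := log_det_le_trace hM
  have hAd := hA.det_pos
  have hBd := hB.det_pos
  have e1 : (C * B.toMat * C.conjTranspose).det = B.toMat.det * A.toMat.det⁻¹ := by
    rw [Matrix.det_mul, Matrix.det_mul, mul_comm C.det, mul_assoc, Matrix.det_conjTranspose,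
      star_trivial, ← hdet, Matrix.det_nonsing_inv, Ring.inverse_eq_inv']
  have e2 : (C * B.toMat * C.conjTranspose).trace = (A.toMat⁻¹ * B.toMat).trace := by
    rw [Matrix.trace_mul_comm, ← Matrix.mul_assoc, ← hC]
  have e3 : inner ℝ A.inv (B - A) = (A.toMat⁻¹ * B.toMat).trace - p := by
    rw [inner_eq_trace, toMat_inv, toMat_sub, Matrix.mul_sub, Matrix.trace_sub,
      Matrix.nonsing_inv_mul _ (isUnit_iff_ne_zero.2 hAd.ne')]
    simp
  rw [e1, e2, Real.log_mul hBd.ne' (inv_pos.2 hAd).ne', Real.log_inv] at h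
  rw [e3]
  linarith

/-- The inverse is an antitone operator on positive definite matrices. -/
theorem inner_inv_sub_inv_nonpos {A B : SymMat p} (hA : A.toMat.PosDef) (hB : B.toMat.PosDef) :
    inner ℝ (A.inv - B.inv) (A - B) ≤ 0 := by
  have h1 := log_det_sub_le hA hB
  have h2 := log_det_sub_le hB hA
  have : inner ℝ A.inv (B - A) = - inner ℝ A.inv (A - B) := by
    rw [← inner_neg_right, neg_sub]
  rw [inner_sub_left]
  linarith

open scoped Matrix.Norms.Frobenius in
theorem norm_inv_sub_inv_le {A B : SymMat p} (hA : A.toMat.PosDef) (hB : B.toMat.PosDef) :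
    ‖A.inv - B.inv‖ ≤ ‖A.inv‖ * ‖A - B‖ * ‖B.inv‖ := by
  have e : (A.inv - B.inv).toMat = A.inv.toMat * (B - A).toMat * B.inv.toMat := by
    simp only [toMat_sub, toMat_inv]
    rw [Matrix.mul_sub, Matrix.sub_mul,
      Matrix.nonsing_inv_mul _ (isUnit_iff_ne_zero.2 hA.det_pos.ne'), Matrix.mul_assoc,
      Matrix.mul_nonsing_inv _ (isUnit_iff_ne_zero.2 hB.det_pos.ne'), Matrix.mul_one,
      Matrix.one_mul]
  rw [norm_eq, e, norm_sub_rev A B, norm_eq A.inv, norm_eq (B - A), norm_eq B.inv]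
  refine (Matrix.frobenius_norm_mul _ _).trans ?_
  gcongr
  exact Matrix.frobenius_norm_mul _ _

end SymMat

/-! ### The spectral function `φ⁺` -/

section PhiPlus

variable {p : ℕ} {β : ℝ}

/-- `φ⁻(x) = φ⁺(x) - x`, for which `φ⁺ φ⁻ = β`. -/
noncomputable def phiMinusScalar (β x : ℝ) : ℝ := (Real.sqrt (x ^ 2 + 4 * β) - x) / 2

theorem continuous_phiScalar (β : ℝ) : Continuous (phiScalar β) := by
  unfold phiScalar; fun_prop

theorem continuous_phiMinusScalar (β : ℝ) : Continuous (phiMinusScalar β) := by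
  unfold phiMinusScalar; fun_prop

theorem phiScalar_mul_phiMinusScalar (hβ : 0 < β) (x : ℝ) :
    phiScalar β x * phiMinusScalar β x = β := by
  have := Real.sq_sqrt (show 0 ≤ x ^ 2 + 4 * β by positivity)
  unfold phiScalar phiMinusScalar
  nlinarith

theorem phiScalar_nonneg (hβ : 0 < β) (x : ℝ) : 0 ≤ phiScalar β x := by
  have : -x ≤ Real.sqrt (x ^ 2 + 4 * β) := Real.le_sqrt_of_sq_le (by nlinarith)
  unfold phiScalar
  linarith

theorem toMat_phiPlus (A : SymMat p) :
    (phiPlus β A).toMat = cfc (phiScalar β) A.toMat :=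
  (A.isHermitian_toMat.cfc_eq _).symm

theorem toMat_phiPlus_mul (hβ : 0 < β) (A : SymMat p) :
    (phiPlus β A).toMat * ((phiPlus β A).toMat - A.toMat) = β • 1 := by
  have hA : IsSelfAdjoint A.toMat := A.isHermitian_toMat
  have h1 : ContinuousOn (phiScalar β) (spectrum ℝ A.toMat) := (continuous_phiScalar β).continuousOn
  have h2 : ContinuousOn (phiMinusScalar β) (spectrum ℝ A.toMat) :=
    (continuous_phiMinusScalar β).continuousOn
  have e : (phiPlus β A).toMat - A.toMat = cfc (phiMinusScalar β) A.toMat := by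
    rw [toMat_phiPlus, sub_eq_iff_eq_add]
    nth_rewrite 3 [← cfc_id ℝ A.toMat hA]
    rw [← cfc_add A.toMat _ _ h2 continuousOn_id]
    refine cfc_congr fun x _ => ?_
    simp only [phiScalar, phiMinusScalar, id]
    ring
  rw [e, toMat_phiPlus, ← cfc_mul _ _ A.toMat h1 h2]
  simp only [phiScalar_mul_phiMinusScalar hβ]
  rw [cfc_const β A.toMat hA, Algebra.algebraMap_eq_smul_one]

open scoped MatrixOrder in
theorem posDef_phiPlus (hβ : 0 < β) (A : SymMat p) : (phiPlus β A).toMat.PosDef := by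
  have h0 : (phiPlus β A).toMat.PosSemidef := by
    rw [toMat_phiPlus, ← Matrix.nonneg_iff_posSemidef]
    exact cfc_nonneg fun x _ => phiScalar_nonneg hβ x
  refine h0.posDef_iff_isUnit.2 ?_
  refine (Matrix.isUnit_iff_isUnit_det _).2 (Matrix.isUnit_det_of_right_inverse
    (B := β⁻¹ • ((phiPlus β A).toMat - A.toMat)) ?_)
  rw [Matrix.mul_smul, toMat_phiPlus_mul hβ, smul_smul, inv_mul_cancel₀ hβ.ne', one_smul]

theorem smul_inv_phiPlus (hβ : 0 < β) (A : SymMat p) :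
    β • (phiPlus β A).inv = phiPlus β A - A := by
  ext1
  have hu : IsUnit (phiPlus β A).toMat.det := isUnit_iff_ne_zero.2 (posDef_phiPlus hβ A).det_pos.ne'
  have h := congrArg (fun M => (phiPlus β A).toMat⁻¹ * M) (toMat_phiPlus_mul hβ A)
  simp only [← Matrix.mul_assoc, Matrix.nonsing_inv_mul _ hu, Matrix.one_mul, Matrix.mul_smul,
    Matrix.mul_one] at h
  simp [h]

/-- `φ⁺` is firmly nonexpansive, being the resolvent of the monotone operator `Ω ↦ -β Ω⁻¹`. -/
theorem norm_phiPlus_sub_sq_le (hβ : 0 < β) (A B : SymMat p) :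
    ‖phiPlus β A - phiPlus β B‖ ^ 2 ≤ inner ℝ (phiPlus β A - phiPlus β B) (A - B) := by
  have h := SymMat.inner_inv_sub_inv_nonpos (posDef_phiPlus hβ A) (posDef_phiPlus hβ B)
  have e : A - B = (phiPlus β A - phiPlus β B) -
      β • ((phiPlus β A).inv - (phiPlus β B).inv) := by
    rw [smul_sub, smul_inv_phiPlus hβ, smul_inv_phiPlus hβ]; abel
  rw [e, inner_sub_right, real_inner_self_eq_norm_sq, SymMat.inner_smul_right', real_inner_comm]
  nlinarith

theorem norm_phiPlus_sub_le (hβ : 0 < β) (A B : SymMat p) :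
    ‖phiPlus β A - phiPlus β B‖ ≤ ‖A - B‖ := by
  have h1 := norm_phiPlus_sub_sq_le hβ A B
  have h2 := real_inner_le_norm (phiPlus β A - phiPlus β B) (A - B)
  rcases eq_or_lt_of_le (norm_nonneg (phiPlus β A - phiPlus β B)) with h0 | h0
  · rw [← h0]; exact norm_nonneg _
  · nlinarith

theorem phiPlus_injective (hβ : 0 < β) : Function.Injective (phiPlus (p := p) β) := by
  intro A B h
  have h1 := smul_inv_phiPlus hβ A
  have h2 := smul_inv_phiPlus hβ B
  rw [h, h2] at h1
  exact (sub_right_inj.1 h1).symm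

/-- The inverse of `φ⁺` is Lipschitz where the inverses of the values of `φ⁺` are bounded. -/
theorem norm_sub_le_phiPlus (hβ : 0 < β) (A B : SymMat p) :
    ‖A - B‖ ≤ (1 + β * (‖(phiPlus β A).inv‖ * ‖(phiPlus β B).inv‖)) *
      ‖phiPlus β A - phiPlus β B‖ := by
  have e : A - B = (phiPlus β A - phiPlus β B) -
      β • ((phiPlus β A).inv - (phiPlus β B).inv) := by
    rw [smul_sub, smul_inv_phiPlus hβ, smul_inv_phiPlus hβ]; abel
  have h := mul_le_mul_of_nonneg_left
    (SymMat.norm_inv_sub_inv_le (posDef_phiPlus hβ A) (posDef_phiPlus hβ B)) hβ.le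
  rw [e]
  refine (norm_sub_le _ _).trans ?_
  rw [norm_smul, Real.norm_of_nonneg hβ.le]
  linarith

theorem norm_inv_phiPlus_le (hβ : 0 < β) (A : SymMat p) :
    ‖(phiPlus β A).inv‖ ≤ (‖phiPlus β (0 : SymMat p)‖ + 2 * ‖A‖) / β := by
  rw [le_div_iff₀' hβ]
  have h1 : β * ‖(phiPlus β A).inv‖ = ‖phiPlus β A - A‖ := by
    rw [← smul_inv_phiPlus hβ, norm_smul, Real.norm_of_nonneg hβ.le]
  have h2 := norm_phiPlus_sub_le hβ A 0
  rw [sub_zero] at h2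
  have h3 := norm_sub_le (phiPlus β A) A
  have h4 := norm_le_norm_sub_add (phiPlus β A) (phiPlus β 0)
  rw [h1]
  linarith

/-- The derivative at `Ω = φ⁺(A)` of the inverse function `Ω ↦ Ω - β Ω⁻¹` of `φ⁺`. -/
noncomputable def phiInvDeriv (β : ℝ) (A : SymMat p) : SymMat p →L[ℝ] SymMat p :=
  ContinuousLinearMap.id ℝ _ + β • SymMat.sandwich (phiPlus β A).inv

theorem phiInvDeriv_apply (A H : SymMat p) : phiInvDeriv β A H =
    H + β • SymMat.sandwich (phiPlus β A).inv H := rfl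

theorem norm_sq_le_inner_phiInvDeriv (hβ : 0 < β) (A H : SymMat p) :
    ‖H‖ ^ 2 ≤ inner ℝ (phiInvDeriv β A H) H := by
  have h := SymMat.inner_sandwich_nonneg (G := (phiPlus β A).inv)
    (posDef_phiPlus hβ A).inv.posSemidef H
  rw [phiInvDeriv_apply, inner_add_left, real_inner_self_eq_norm_sq, SymMat.inner_smul_left']
  nlinarith

theorem norm_le_norm_phiInvDeriv (hβ : 0 < β) (A H : SymMat p) : ‖H‖ ≤ ‖phiInvDeriv β A H‖ := by
  have h1 := norm_sq_le_inner_phiInvDeriv hβ A H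
  have h2 := real_inner_le_norm (phiInvDeriv β A H) H
  rcases eq_or_lt_of_le (norm_nonneg H) with h0 | h0
  · rw [← h0]; exact norm_nonneg _
  · nlinarith

theorem norm_phiInvDeriv_le (hβ : 0 < β) (A H : SymMat p) :
    ‖phiInvDeriv β A H‖ ≤ (1 + β * ‖(phiPlus β A).inv‖ ^ 2) * ‖H‖ := by
  rw [phiInvDeriv_apply]
  refine (norm_add_le _ _).trans ?_
  rw [norm_smul, Real.norm_of_nonneg hβ.le]
  have := mul_le_mul_of_nonneg_left (SymMat.norm_sandwich_le (phiPlus β A).inv H) hβ.le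
  linarith

open scoped Matrix.Norms.Frobenius in
/-- The second-order identity behind the smoothness of `φ⁺`:
`Ω⁻¹ Δ Ω⁻¹ + Ω'⁻¹ - Ω⁻¹ = Ω⁻¹ Δ (Ω⁻¹ - Ω'⁻¹)` for `Δ = Ω' - Ω`. -/
theorem phiInvDeriv_remainder (hβ : 0 < β) (A B : SymMat p) :
    ‖phiInvDeriv β A (phiPlus β B - phiPlus β A) - (B - A)‖ ≤
      2 * ‖(phiPlus β A).inv‖ * ‖B - A‖ ^ 2 := by
  set Ω := phiPlus β A with hΩ
  set Ω' := phiPlus β B with hΩ'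
  have hu : IsUnit Ω.toMat.det := isUnit_iff_ne_zero.2 (posDef_phiPlus hβ A).det_pos.ne'
  have hu' : IsUnit Ω'.toMat.det := isUnit_iff_ne_zero.2 (posDef_phiPlus hβ B).det_pos.ne'
  have hA := smul_inv_phiPlus hβ A
  have hB := smul_inv_phiPlus hβ B
  rw [← hΩ] at hA
  rw [← hΩ'] at hB
  have hlip : ‖Ω' - Ω‖ ≤ ‖B - A‖ := norm_phiPlus_sub_le hβ B A
  have e0 : β • (Ω.inv - Ω'.inv) = (B - A) - (Ω' - Ω) := by
    rw [smul_sub, hA, hB]; abel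
  have e1 : phiInvDeriv β A (Ω' - Ω) - (B - A) =
      β • (SymMat.sandwich Ω.inv (Ω' - Ω) - (Ω.inv - Ω'.inv)) := by
    rw [smul_sub, e0, phiInvDeriv_apply, ← hΩ]; abel
  have e2 : (phiInvDeriv β A (Ω' - Ω) - (B - A)).toMat =
      Ω.inv.toMat * (Ω' - Ω).toMat * (β • (Ω.inv - Ω'.inv)).toMat := by
    rw [e1]
    simp only [SymMat.toMat_smul, SymMat.toMat_sub, SymMat.toMat_sandwich, SymMat.toMat_inv,
      Matrix.mul_smul]
    congr 1
    have a1 : Ω.toMat⁻¹ * (Ω'.toMat - Ω.toMat) * Ω'.toMat⁻¹ = Ω.toMat⁻¹ - Ω'.toMat⁻¹ := by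
      rw [Matrix.mul_sub, Matrix.sub_mul, Matrix.nonsing_inv_mul _ hu, Matrix.mul_assoc,
        Matrix.mul_nonsing_inv _ hu', Matrix.mul_one, Matrix.one_mul]
    rw [Matrix.mul_sub _ Ω.toMat⁻¹, a1]
  have e3 : ‖β • (Ω.inv - Ω'.inv)‖ ≤ 2 * ‖B - A‖ := by
    rw [e0]
    refine (norm_sub_le _ _).trans ?_
    linarith
  rw [SymMat.norm_eq, e2]
  refine (Matrix.frobenius_norm_mul _ _).trans ?_
  refine (mul_le_mul_of_nonneg_right (Matrix.frobenius_norm_mul _ _) (norm_nonneg _)).trans ?_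
  rw [← SymMat.norm_eq, ← SymMat.norm_eq, ← SymMat.norm_eq]
  calc ‖Ω.inv‖ * ‖Ω' - Ω‖ * ‖β • (Ω.inv - Ω'.inv)‖ ≤ ‖Ω.inv‖ * ‖B - A‖ * (2 * ‖B - A‖) := by gcongr
    _ = _ := by ring

/-- The derivative of `φ⁺`, with a quadratic bound of the remainder that is explicit in the base
point, so that it serves both for differentiability and for strong semismoothness. -/
theorem exists_deriv_phiPlus (hβ : 0 < β) (A : SymMat p) :
    ∃ T : SymMat p →L[ℝ] SymMat p, (∀ H, phiInvDeriv β A (T H) = H) ∧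
      ∀ B, ‖phiPlus β B - phiPlus β A - T (B - A)‖ ≤
        2 * ‖(phiPlus β A).inv‖ * ‖B - A‖ ^ 2 := by
  have hinj : Function.Injective (phiInvDeriv β A : SymMat p →ₗ[ℝ] SymMat p) := by
    refine (injective_iff_map_eq_zero _).2 fun H hH => ?_
    have := norm_le_norm_phiInvDeriv hβ A H
    rw [show phiInvDeriv β A H = 0 from hH, norm_zero] at this
    exact norm_le_zero_iff.1 this
  set e := LinearEquiv.ofInjectiveEndo _ hinj
  set T : SymMat p →L[ℝ] SymMat p :=
    LinearMap.toContinuousLinearMap (e.symm : SymMat p →ₗ[ℝ] SymMat p)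
  have hT : ∀ H, phiInvDeriv β A (T H) = H := fun H => e.apply_symm_apply H
  refine ⟨T, hT, fun B => (norm_le_norm_phiInvDeriv hβ A _).trans ?_⟩
  rw [map_sub, hT]
  exact phiInvDeriv_remainder hβ A B

theorem fderiv_phiPlus_spec (hβ : 0 < β) (A : SymMat p) :
    (∀ H, phiInvDeriv β A (fderiv ℝ (phiPlus β) A H) = H) ∧
      ∀ B, ‖phiPlus β B - phiPlus β A - fderiv ℝ (phiPlus β) A (B - A)‖ ≤
        2 * ‖(phiPlus β A).inv‖ * ‖B - A‖ ^ 2 := by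
  obtain ⟨T, hT, hT'⟩ := exists_deriv_phiPlus hβ A
  have hd : HasFDerivAt (phiPlus β) T A := by
    have h1 : (fun B => phiPlus β B - phiPlus β A - T (B - A)) =O[𝓝 A]
        fun B => ‖B - A‖ ^ 2 :=
      IsBigO.of_bound (2 * ‖(phiPlus β A).inv‖) (Eventually.of_forall fun B => by
        rw [Real.norm_of_nonneg (sq_nonneg _)]; exact hT' B)
    exact HasFDerivAt.of_isLittleO (h1.trans_isLittleO (isLittleO_pow_sub_sub A one_lt_two))
  rw [hd.fderiv]
  exact ⟨hT, hT'⟩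

theorem inner_fderiv_phiPlus_comm (hβ : 0 < β) (A H H' : SymMat p) :
    inner ℝ (fderiv ℝ (phiPlus β) A H) H' = inner ℝ H (fderiv ℝ (phiPlus β) A H') := by
  have h := (fderiv_phiPlus_spec hβ A).1
  set T := fderiv ℝ (phiPlus β) A
  have hs : ∀ G G', inner ℝ (phiInvDeriv β A G) G' = inner ℝ G (phiInvDeriv β A G') := by
    intro G G'
    simp only [phiInvDeriv_apply, inner_add_left, inner_add_right, SymMat.inner_smul_left',
      SymMat.inner_smul_right', SymMat.inner_sandwich_left]
  conv_lhs => rw [← h H']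
  conv_rhs => rw [← h H]
  exact (hs _ _).symm

theorem norm_fderiv_phiPlus_le (hβ : 0 < β) (A H : SymMat p) :
    ‖fderiv ℝ (phiPlus β) A H‖ ≤ ‖H‖ := by
  have := norm_le_norm_phiInvDeriv hβ A (fderiv ℝ (phiPlus β) A H)
  rwa [(fderiv_phiPlus_spec hβ A).1] at this

/-- The derivative of `φ⁺` is uniformly positive definite on bounded sets. -/
theorem exists_le_inner_fderiv_phiPlus (hβ : 0 < β) (R : ℝ) :
    ∃ c > 0, ∀ A : SymMat p, ‖A‖ ≤ R → ∀ H,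
      c * ‖H‖ ^ 2 ≤ inner ℝ (fderiv ℝ (phiPlus β) A H) H := by
  set N := 1 + β * ((‖phiPlus β (0 : SymMat p)‖ + 2 * R) / β) ^ 2 with hN
  have hN0 : 0 < N := by positivity
  refine ⟨(N ^ 2)⁻¹, by positivity, fun A hA H => ?_⟩
  set G := fderiv ℝ (phiPlus β) A H with hG
  have hGH : phiInvDeriv β A G = H := (fderiv_phiPlus_spec hβ A).1 H
  have h1 := norm_sq_le_inner_phiInvDeriv hβ A G
  have h2 := norm_phiInvDeriv_le hβ A G
  rw [hGH] at h1 h2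
  rw [real_inner_comm]
  refine le_trans ?_ h1
  rw [inv_mul_le_iff₀ (by positivity), ← mul_pow]
  have h3 : 1 + β * ‖(phiPlus β A).inv‖ ^ 2 ≤ N := by
    rw [hN]
    gcongr
    refine (norm_inv_phiPlus_le hβ A).trans ?_
    gcongr
  have h4 : ‖H‖ ≤ N * ‖G‖ := h2.trans (mul_le_mul_of_nonneg_right h3 (norm_nonneg _))
  gcongr

end PhiPlus

/-! ### Proximal mappings, projections and Clarke Jacobians in general -/

section General

variable {E F : Type*} [NormedAddCommGroup E] [InnerProductSpace ℝ E]

/-- The optimality condition `u - y ∈ ∂g(y)` characterizes the proximal point. -/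
theorem prox_eq_of_subgradient {g : E → ℝ} {u y : E}
    (h : ∀ z, g y + inner ℝ (u - y) (z - y) ≤ g z) : prox g u = y := by
  have key : ∀ z, g y + 1 / 2 * ‖y - u‖ ^ 2 + 1 / 2 * ‖z - y‖ ^ 2 ≤ g z + 1 / 2 * ‖z - u‖ ^ 2 := by
    intro z
    have e : z - u = (z - y) - (u - y) := by abel
    rw [e, norm_sub_sq_real (z - y), real_inner_comm, norm_sub_rev y u]
    linarith [h z]
  have hy : IsMinOn (fun z => g z + 1 / 2 * ‖z - u‖ ^ 2) univ y := fun z _ => by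
    have := key z
    simp only [mem_ofPred_eq]
    nlinarith [sq_nonneg ‖z - y‖]
  have hw := Classical.epsilon_spec
    (p := fun y => IsMinOn (fun z => g z + 1 / 2 * ‖z - u‖ ^ 2) univ y) ⟨y, hy⟩
  have h1 := hw (mem_univ y)
  have h2 := key (prox g u)
  simp only [mem_ofPred_eq] at h1
  change g (prox g u) + 1 / 2 * ‖prox g u - u‖ ^ 2 ≤ _ at h1
  have h3 : ‖prox g u - y‖ ^ 2 ≤ 0 := by linarith
  exact sub_eq_zero.1 (norm_eq_zero.1 (pow_eq_zero_iff two_ne_zero |>.1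
    (le_antisymm h3 (sq_nonneg _))))

/-- The variational inequality characterizes the projection. -/
theorem proj_eq_of_inner_le {C : Set E} {u y : E} (hyC : y ∈ C)
    (h : ∀ z ∈ C, inner ℝ (u - y) (z - y) ≤ 0) : proj C u = y := by
  have key : ∀ z ∈ C, ‖u - y‖ ^ 2 + ‖z - y‖ ^ 2 ≤ ‖u - z‖ ^ 2 := by
    intro z hz
    have e : u - z = (u - y) - (z - y) := by abel
    rw [e, norm_sub_sq_real (u - y)]
    linarith [h z hz]
  have hy : y ∈ C ∧ IsMinOn (fun z => ‖u - z‖) C y := by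
    refine ⟨hyC, fun z hz => ?_⟩
    have := key z hz
    simp only [mem_ofPred_eq]
    exact le_of_sq_le_sq (by nlinarith [sq_nonneg ‖z - y‖]) (norm_nonneg _)
  have hw := Classical.epsilon_spec
    (p := fun y => y ∈ C ∧ IsMinOn (fun z => ‖u - z‖) C y) ⟨y, hy⟩
  have h1 : ‖u - proj C u‖ ≤ ‖u - y‖ := hw.2 hyC
  have h2 := key (proj C u) hw.1
  have h3 : ‖proj C u - y‖ ^ 2 ≤ 0 := by nlinarith [norm_nonneg (u - proj C u)]
  exact sub_eq_zero.1 (norm_eq_zero.1 (pow_eq_zero_iff two_ne_zero |>.1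
    (le_antisymm h3 (sq_nonneg _))))

/-- A property of derivatives that is convex, and stable under limits at `x`, holds for the Clarke
Jacobian at `x` if it holds for all derivatives. -/
theorem clarkeJacobian_induction [NormedAddCommGroup F] [NormedSpace ℝ F] {G : E → F}
    {R : E → (E →L[ℝ] F) → Prop} {x : E} (hconv : Convex ℝ {T | R x T})
    (hclosed : ∀ (u : ℕ → E) (U : ℕ → E →L[ℝ] F) (T : E →L[ℝ] F), Tendsto u atTop (𝓝 x) →
      Tendsto U atTop (𝓝 T) → (∀ n, R (u n) (U n)) → R x T)
    (hd : ∀ y, DifferentiableAt ℝ G y → R y (fderiv ℝ G y)) :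
    ∀ T ∈ clarkeJacobian G x, R x T := by
  intro T hT
  refine convexHull_min ?_ hconv hT
  rintro T ⟨u, hu, hdu, hlim⟩
  exact hclosed u _ T hu hlim fun n => hd _ (hdu n)

/-- The strong semismoothness estimate extends from derivatives to the Clarke Jacobian. -/
theorem clarkeJacobian_semismooth [NormedAddCommGroup F] [NormedSpace ℝ F] {G : E → F}
    (hG : Continuous G) {x : E} {C : ℝ} {U : Set E} (hU : IsOpen U)
    (h : ∀ y ∈ U, DifferentiableAt ℝ G y →
      ‖G y - G x - fderiv ℝ G y (y - x)‖ ≤ C * ‖y - x‖ ^ 2) :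
    ∀ y ∈ U, ∀ T ∈ clarkeJacobian G y, ‖G y - G x - T (y - x)‖ ≤ C * ‖y - x‖ ^ 2 := by
  intro y hy T hT
  refine clarkeJacobian_induction (R := fun y T => y ∈ U → ‖G y - G x - T (y - x)‖ ≤
    C * ‖y - x‖ ^ 2) ?_ ?_ (fun z hz hzU => h z hzU hz) T hT hy
  · intro T₁ h₁ T₂ h₂ a b ha hb hab hyU
    have e : G y - G x - (a • T₁ + b • T₂) (y - x) =
        a • (G y - G x - T₁ (y - x)) + b • (G y - G x - T₂ (y - x)) := by
      obtain rfl : b = 1 - a := by linarith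
      simp only [add_apply, smul_apply]
      module
    rw [e]
    refine (norm_add_le _ _).trans ?_
    rw [norm_smul, norm_smul, Real.norm_of_nonneg ha, Real.norm_of_nonneg hb]
    have := mul_le_mul_of_nonneg_left (h₁ hyU) ha
    have := mul_le_mul_of_nonneg_left (h₂ hyU) hb
    have : a * (C * ‖y - x‖ ^ 2) + b * (C * ‖y - x‖ ^ 2) = C * ‖y - x‖ ^ 2 := by
      rw [← add_mul, hab, one_mul]
    linarith
  · intro u V T hu hV hR hyU
    have hev : ∀ᶠ n in atTop, u n ∈ U := hu.eventually (hU.mem_nhds hyU)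
    have h1 : Tendsto (fun n => ‖G (u n) - G x - V n (u n - x)‖) atTop
        (𝓝 ‖G y - G x - T (y - x)‖) :=
      ((((hG.tendsto y).comp hu).sub_const _).sub
        ((isBoundedBilinearMap_apply (𝕜 := ℝ)).continuous.tendsto (T, y - x) |>.comp
        (hV.prodMk_nhds (hu.sub_const x)))).norm
    have h2 : Tendsto (fun n => C * ‖u n - x‖ ^ 2) atTop (𝓝 (C * ‖y - x‖ ^ 2)) :=
      ((hu.sub_const x).norm.pow 2).const_mul C
    exact le_of_tendsto_of_tendsto h1 h2 (hev.mono fun n hn => hR n hn)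

theorem norm_normalize_sub_le {v w : E} (hv : v ≠ 0) (hw : w ≠ 0) :
    ‖‖v‖⁻¹ • v - ‖w‖⁻¹ • w‖ ≤ 2 * ‖v - w‖ / ‖v‖ := by
  have hv' := norm_pos_iff.2 hv
  have hw' := norm_pos_iff.2 hw
  have e : ‖v‖⁻¹ • v - ‖w‖⁻¹ • w = ‖v‖⁻¹ • (v - w) + (‖v‖⁻¹ * (‖w‖ - ‖v‖)) • ‖w‖⁻¹ • w := by
    have : ‖v‖⁻¹ * (‖w‖ - ‖v‖) * ‖w‖⁻¹ = ‖v‖⁻¹ - ‖w‖⁻¹ := by field_simp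
    rw [smul_smul, this, smul_sub, sub_smul]
    abel
  rw [e]
  refine (norm_add_le _ _).trans ?_
  rw [norm_smul, norm_smul, norm_smul, norm_mul, norm_inv, norm_norm, norm_inv, norm_norm,
    inv_mul_cancel₀ hw'.ne', mul_one, Real.norm_eq_abs]
  have h1 : |‖w‖ - ‖v‖| ≤ ‖v - w‖ := by rw [abs_sub_comm]; exact abs_norm_sub_norm_le v w
  rw [div_eq_inv_mul, two_mul, mul_add]
  gcongr

theorem norm_normalize {v : E} (hv : v ≠ 0) : ‖‖v‖⁻¹ • v‖ = 1 := by
  rw [norm_smul, norm_inv, norm_norm, inv_mul_cancel₀ (norm_ne_zero_iff.2 hv)]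

theorem one_sub_inner_normalize {v w : E} (hv : v ≠ 0) (hw : w ≠ 0) :
    1 - inner ℝ (‖v‖⁻¹ • v) (‖w‖⁻¹ • w) = 1 / 2 * ‖‖v‖⁻¹ • v - ‖w‖⁻¹ • w‖ ^ 2 := by
  rw [norm_sub_sq_real, norm_normalize hv, norm_normalize hw]
  ring

/-- The derivative of `v ↦ v / ‖v‖` at `v`. -/
noncomputable def normalizeDeriv (v : E) : E →L[ℝ] E :=
  ‖v‖⁻¹ • (ContinuousLinearMap.id ℝ E - (‖v‖⁻¹ ^ 2) • (innerSL ℝ v).smulRight v)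

theorem normalizeDeriv_apply (v w : E) : normalizeDeriv v w =
    ‖v‖⁻¹ • (w - (‖v‖⁻¹ ^ 2 * inner ℝ v w) • v) := by
  simp [normalizeDeriv, smul_smul]

/-- The remainder of the first-order expansion of `v ↦ v / ‖v‖` at `v`, with an explicit bound. -/
theorem normalize_remainder {v w : E} (hv : v ≠ 0) (hw : w ≠ 0) :
    ‖‖w‖⁻¹ • w - ‖v‖⁻¹ • v - normalizeDeriv v (w - v)‖ ≤
      2 * (‖v‖ + ‖w‖) / ‖v‖ ^ 3 * ‖w - v‖ ^ 2 := by
  have hv' := norm_pos_iff.2 hv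
  have hw' := norm_pos_iff.2 hw
  set n := ‖v‖⁻¹ • v with hn
  set m := ‖w‖⁻¹ • w with hm
  have hvn : v = ‖v‖ • n := by rw [hn, smul_smul, mul_inv_cancel₀ hv'.ne', one_smul]
  have hwm : w = ‖w‖ • m := by rw [hm, smul_smul, mul_inv_cancel₀ hw'.ne', one_smul]
  have hn1 : ‖n‖ = 1 := norm_normalize hv
  have hnm := one_sub_inner_normalize hv hw
  rw [← hn, ← hm] at hnm
  have e1 : normalizeDeriv v (w - v) = (‖w‖ / ‖v‖) • (m - (inner ℝ n m) • n) := by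
    have a1 : inner ℝ v (w - v) = ‖v‖ * ‖w‖ * inner ℝ n m - ‖v‖ ^ 2 := by
      rw [inner_sub_right, real_inner_self_eq_norm_sq]
      conv_lhs => rw [hvn, hwm, inner_smul_left, inner_smul_right]
      simp [norm_smul, hn1]
      ring
    rw [normalizeDeriv_apply, a1]
    have a2 : w - v - (‖v‖⁻¹ ^ 2 * (‖v‖ * ‖w‖ * inner ℝ n m - ‖v‖ ^ 2)) • v =
        ‖w‖ • m - (‖w‖ * inner ℝ n m) • n := by
      have : (‖v‖⁻¹ ^ 2 * (‖v‖ * ‖w‖ * inner ℝ n m - ‖v‖ ^ 2)) • v =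
          (‖w‖ * inner ℝ n m) • n - v := by
        rw [hn, smul_smul]
        conv_rhs => rw [← one_smul ℝ v, smul_smul, ← sub_smul]
        rw [one_smul]
        congr 1
        field_simp
      rw [this, ← hwm]
      abel
    rw [a2]
    simp only [smul_sub, smul_smul]
    rw [div_eq_inv_mul, mul_assoc]
  have e2 : m - n - normalizeDeriv v (w - v) = ((‖v‖ - ‖w‖) / ‖v‖) • (m - n) -
      (‖w‖ / ‖v‖ * (1 / 2 * ‖n - m‖ ^ 2)) • n := by
    rw [e1, ← hnm]
    have : (‖v‖ - ‖w‖) / ‖v‖ = 1 - ‖w‖ / ‖v‖ := by field_simp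
    rw [this]
    module
  have h1 : ‖n - m‖ ≤ 2 * ‖w - v‖ / ‖v‖ := by
    rw [norm_sub_rev w v]; exact norm_normalize_sub_le hv hw
  have h2 : |‖v‖ - ‖w‖| ≤ ‖w - v‖ := by
    rw [norm_sub_rev w v]; exact abs_norm_sub_norm_le v w
  rw [e2]
  refine (norm_sub_le _ _).trans ?_
  rw [norm_smul, norm_smul, hn1, mul_one, Real.norm_eq_abs, Real.norm_of_nonneg (by positivity),
    abs_div, abs_of_pos hv', norm_sub_rev m n]
  calc |‖v‖ - ‖w‖| / ‖v‖ * ‖n - m‖ + ‖w‖ / ‖v‖ * (1 / 2 * ‖n - m‖ ^ 2)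
      ≤ ‖w - v‖ / ‖v‖ * (2 * ‖w - v‖ / ‖v‖) +
        ‖w‖ / ‖v‖ * (1 / 2 * (2 * ‖w - v‖ / ‖v‖) ^ 2) := by gcongr
    _ = _ := by field_simp

end General

/-! ### Soft thresholding -/

section Soft

/-- The projection of a real number onto `[-lam, lam]`. -/
noncomputable def clip (lam x : ℝ) : ℝ := max (-lam) (min lam x)

/-- Scalar soft thresholding. -/
noncomputable def soft (lam x : ℝ) : ℝ := x - clip lam x

variable {lam : ℝ}

theorem abs_clip_le (h : 0 < lam) (x : ℝ) : |clip lam x| ≤ lam := by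
  rw [abs_le]
  exact ⟨le_max_left _ _, max_le (by linarith) (min_le_left _ _)⟩

theorem clip_of_le {x : ℝ} (h : 0 < lam) (hx : lam ≤ x) : clip lam x = lam := by
  rw [clip, min_eq_left hx, max_eq_right (by linarith)]

theorem clip_of_le_neg {x : ℝ} (h : 0 < lam) (hx : x ≤ -lam) : clip lam x = -lam := by
  rw [clip, min_eq_right (by linarith), max_eq_left hx]

theorem soft_of_abs_le {x : ℝ} (hx : |x| ≤ lam) : soft lam x = 0 := by
  rw [abs_le] at hx
  rw [soft, clip, min_eq_right hx.2, max_eq_right hx.1, sub_self]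

theorem clip_mul_soft (h : 0 < lam) (x : ℝ) : clip lam x * soft lam x = lam * |soft lam x| := by
  rcases le_total |x| lam with hx | hx
  · rw [soft_of_abs_le hx]; simp
  · rcases le_abs.1 hx with hx | hx
    · rw [soft, clip_of_le h hx, abs_of_nonneg (by linarith)]
    · rw [soft, clip_of_le_neg h (by linarith), abs_of_nonpos (by linarith)]
      ring

theorem lt_abs_of_soft_ne_zero {x : ℝ} (hx : soft lam x ≠ 0) : lam < |x| := by
  by_contra h
  exact hx (soft_of_abs_le (not_lt.1 h))

theorem monotone_clip (lam : ℝ) : Monotone (clip lam) := fun _ _ h =>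
  max_le_max le_rfl (min_le_min le_rfl h)

theorem monotone_soft (lam : ℝ) : Monotone (soft lam) := by
  intro x y h
  have : clip lam y ≤ clip lam x + (y - x) := by
    refine max_le ?_ ?_
    · linarith [le_max_left (-lam) (min lam x), show clip lam x = max (-lam) (min lam x) from rfl]
    · have h1 : min lam x ≤ clip lam x := le_max_right _ _
      have h2 : min lam y ≤ min lam x + (y - x) := by
        rcases min_choice lam x with h | h <;> rw [h]
        · exact (min_le_left _ _).trans (by linarith)
        · exact (min_le_right _ _).trans (by linarith)
      linarith
  unfold soft
  linarith

theorem abs_soft_sub_le (lam x y : ℝ) : |soft lam x - soft lam y| ≤ |x - y| := by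
  wlog h : x ≤ y generalizing x y
  · rw [abs_sub_comm, abs_sub_comm x]; exact this y x (le_of_not_ge h)
  have h1 := monotone_soft lam h
  have h2 := monotone_clip lam h
  rw [abs_of_nonpos (by linarith), abs_of_nonpos (by linarith)]
  unfold soft
  linarith

/-- Soft thresholding is affine on each side of any point `x`: for `y ≠ x` near `x`, off the kinks,
either the part removed by thresholding stays the same, or the soft-thresholded values vanish. -/
theorem soft_local (h : 0 < lam) (x : ℝ) : ∀ᶠ y in 𝓝 x, y = x ∨
    (clip lam y = clip lam x ∧ lam < |y|) ∨ (soft lam y = 0 ∧ soft lam x = 0 ∧ |y| < lam) := by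
  have hzero : ∀ y, |y| < lam → |x| ≤ lam → soft lam y = 0 ∧ soft lam x = 0 ∧ |y| < lam :=
    fun y hy hx => ⟨soft_of_abs_le hy.le, soft_of_abs_le hx, hy⟩
  have hpos : ∀ y, lam < y → lam ≤ x → clip lam y = clip lam x ∧ lam < |y| := fun y hy hx =>
    ⟨by rw [clip_of_le h hy.le, clip_of_le h hx], hy.trans_le (le_abs_self _)⟩
  have hneg : ∀ y, y < -lam → x ≤ -lam → clip lam y = clip lam x ∧ lam < |y| := fun y hy hx =>
    ⟨by rw [clip_of_le_neg h hy.le, clip_of_le_neg h hx],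
      (by linarith : lam < -y).trans_le (neg_le_abs _)⟩
  rcases lt_trichotomy |x| lam with hx | hx | hx
  · filter_upwards [(continuous_abs.tendsto x).eventually (gt_mem_nhds hx)] with y hy
    exact Or.inr (Or.inr (hzero y hy hx.le))
  · rcases eq_or_eq_neg_of_abs_eq hx with hx' | hx'
    · filter_upwards [lt_mem_nhds (show -lam < x by linarith)] with y hy
      rcases lt_trichotomy y lam with hy' | hy' | hy'
      · exact Or.inr (Or.inr (hzero y (abs_lt.2 ⟨hy, hy'⟩) hx.le))
      · exact Or.inl (hy'.trans hx'.symm)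
      · exact Or.inr (Or.inl (hpos y hy' hx'.ge))
    · filter_upwards [gt_mem_nhds (show x < lam by linarith)] with y hy
      rcases lt_trichotomy y (-lam) with hy' | hy' | hy'
      · exact Or.inr (Or.inl (hneg y hy' hx'.le))
      · exact Or.inl (hy'.trans hx'.symm)
      · exact Or.inr (Or.inr (hzero y (abs_lt.2 ⟨hy', hy⟩) hx.le))
  · rcases lt_abs.1 hx with hx | hx
    · filter_upwards [lt_mem_nhds hx] with y hy
      exact Or.inr (Or.inl (hpos y hy hx.le))
    · have hx' : x < -lam := by linarith
      filter_upwards [gt_mem_nhds hx'] with y hy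
      exact Or.inr (Or.inl (hneg y hy hx'.le))

/-- Wherever soft thresholding has a derivative, it lies in `[0, 1]`, and it is `1` or `0` away
from the kinks. -/
theorem deriv_soft (h : 0 < lam) {x d : ℝ} (hd : HasDerivAt (soft lam) d x) :
    0 ≤ d ∧ d ≤ 1 ∧ (lam < |x| → d = 1) ∧ (|x| < lam → d = 0) := by
  have hc : HasDerivAt (clip lam) (1 - d) x := by
    have := (hasDerivAt_id x).sub hd
    refine this.congr_of_eventuallyEq (Eventually.of_forall fun y => ?_)
    simp [soft]
  refine ⟨?_, ?_, fun hx => ?_, fun hx => ?_⟩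
  · rw [← hd.deriv]; exact (monotone_soft lam).deriv_nonneg
  · have : 0 ≤ 1 - d := by rw [← hc.deriv]; exact (monotone_clip lam).deriv_nonneg
    linarith
  · have : clip lam =ᶠ[𝓝 x] fun _ => clip lam x := by
      filter_upwards [soft_local h x, (continuous_abs.tendsto x).eventually (lt_mem_nhds hx)]
        with y hy hy'
      exact hy.elim (fun h => by rw [h]) fun h => h.elim (fun h => h.1) fun h =>
        absurd h.2.2 (not_lt.2 hy'.le)
    have := hc.unique ((hasDerivAt_const x _).congr_of_eventuallyEq this)
    linarith
  · have : soft lam =ᶠ[𝓝 x] fun _ => 0 := by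
      filter_upwards [(continuous_abs.tendsto x).eventually (gt_mem_nhds hx)] with y hy
      exact soft_of_abs_le hy.le
    exact hd.unique ((hasDerivAt_const x _).congr_of_eventuallyEq this)

variable {K : ℕ}

theorem proxL1_apply (h : 0 < lam) (u : EuclideanSpace ℝ (Fin K)) (k : Fin K) :
    proxL1 lam u k = soft lam (u k) := by
  have : proxL1 lam u = WithLp.toLp 2 fun k => soft lam (u k) := by
    refine prox_eq_of_subgradient fun z => ?_
    simp only [PiLp.inner_apply, PiLp.sub_apply, Finset.mul_sum, ← Finset.sum_add_distrib]
    refine Finset.sum_le_sum fun k _ => ?_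
    have h1 := clip_mul_soft h (u k)
    have h2 : clip lam (u k) * z k ≤ lam * |z k| :=
      (le_abs_self _).trans (by
        rw [abs_mul]; exact mul_le_mul_of_nonneg_right (abs_clip_le h _) (abs_nonneg _))
    have h3 : u k - soft lam (u k) = clip lam (u k) := by unfold soft; ring
    simp only [h3, RCLike.inner_apply, conj_trivial]
    nlinarith
  rw [this]

theorem norm_proxL1_sub_le (h : 0 < lam) (u w : EuclideanSpace ℝ (Fin K)) :
    ‖proxL1 lam u - proxL1 lam w‖ ≤ ‖u - w‖ := by
  rw [EuclideanSpace.norm_eq, EuclideanSpace.norm_eq]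
  refine Real.sqrt_le_sqrt (Finset.sum_le_sum fun k _ => ?_)
  simp only [PiLp.sub_apply, proxL1_apply h, Real.norm_eq_abs]
  have := abs_soft_sub_le lam (u k) (w k)
  gcongr

theorem continuous_proxL1 (h : 0 < lam) : Continuous (proxL1 (K := K) lam) :=
  (LipschitzWith.of_dist_le_mul (K := 1) fun x y => by
    rw [dist_eq_norm, dist_eq_norm, NNReal.coe_one, one_mul]
    exact norm_proxL1_sub_le h x y).continuous

/-- The elements of the Clarke Jacobian of soft thresholding are diagonal, with entries in `[0, 1]`
that are determined away from the kinks. -/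
theorem clarkeJacobian_proxL1 (h : 0 < lam) {u : EuclideanSpace ℝ (Fin K)}
    {T : EuclideanSpace ℝ (Fin K) →L[ℝ] EuclideanSpace ℝ (Fin K)}
    (hT : T ∈ clarkeJacobian (proxL1 lam) u) :
    ∃ d : Fin K → ℝ, (∀ w k, T w k = d k * w k) ∧
      ∀ k, 0 ≤ d k ∧ d k ≤ 1 ∧ (lam < |u k| → d k = 1) ∧ (|u k| < lam → d k = 0) := by
  -- The diagonal entry, which depends continuously and linearly on the operator.
  set δ : (EuclideanSpace ℝ (Fin K) →L[ℝ] EuclideanSpace ℝ (Fin K)) → Fin K → ℝ :=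
    fun T k => T (EuclideanSpace.single k 1) k with hδ
  have hδc : ∀ (w : EuclideanSpace ℝ (Fin K)) (k : Fin K), Continuous
      fun T : EuclideanSpace ℝ (Fin K) →L[ℝ] EuclideanSpace ℝ (Fin K) => T w k := by
    intro w k
    exact (EuclideanSpace.proj (𝕜 := ℝ) k).continuous.comp
      (ContinuousLinearMap.apply ℝ (EuclideanSpace ℝ (Fin K)) w).continuous
  have key := clarkeJacobian_induction (G := proxL1 (K := K) lam) (x := u)
    (R := fun u T => ∀ k, (∀ w, T w k = δ T k * w k) ∧ 0 ≤ δ T k ∧ δ T k ≤ 1 ∧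
      (max (|u k| - lam) 0 * (1 - δ T k) = 0) ∧ max (lam - |u k|) 0 * δ T k = 0) ?_ ?_ ?_ T hT
  · refine ⟨δ T, fun w k => (key k).1 w, fun k => ⟨(key k).2.1, (key k).2.2.1, fun hk => ?_,
      fun hk => ?_⟩⟩
    · have h1 := (key k).2.2.2.1
      rw [max_eq_left (by linarith)] at h1
      have := (mul_eq_zero.1 h1).resolve_left (by linarith)
      linarith
    · have h1 := (key k).2.2.2.2
      rw [max_eq_left (by linarith)] at h1
      exact (mul_eq_zero.1 h1).resolve_left (by linarith)
  · intro T₁ h₁ T₂ h₂ a b ha hb hab k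
    obtain ⟨p1, p2, p3, p4, p5⟩ := h₁ k
    obtain ⟨q1, q2, q3, q4, q5⟩ := h₂ k
    have e : δ (a • T₁ + b • T₂) k = a * δ T₁ k + b * δ T₂ k := by simp [hδ]
    refine ⟨fun w => ?_, ?_, ?_, ?_, ?_⟩
    · rw [e]
      simp only [add_apply, smul_apply, PiLp.add_apply, PiLp.smul_apply, smul_eq_mul, p1, q1]
      ring
    · rw [e]; positivity
    · rw [e]; nlinarith
    · rw [e]; linear_combination a * p4 + b * q4 - max (|u k| - lam) 0 * hab
    · rw [e]; linear_combination a * p5 + b * q5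
  · intro v U T hv hU hR k
    have hδU : Tendsto (fun n => δ (U n) k) atTop (𝓝 (δ T k)) := ((hδc _ k).tendsto T).comp hU
    have hvk : Tendsto (fun n => |v n k|) atTop (𝓝 |u k|) :=
      (((EuclideanSpace.proj (𝕜 := ℝ) k).continuous.tendsto u).comp hv).abs
    refine ⟨fun w => ?_, ?_, ?_, ?_, ?_⟩
    · refine tendsto_nhds_unique (((hδc w k).tendsto T).comp hU) ?_
      refine (hδU.mul_const (w k)).congr fun n => ?_
      exact ((hR n k).1 w).symm
    · exact ge_of_tendsto' hδU fun n => (hR n k).2.1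
    · exact le_of_tendsto' hδU fun n => (hR n k).2.2.1
    · refine tendsto_nhds_unique (((hvk.sub_const lam).max tendsto_const_nhds).mul
        (hδU.const_sub 1)) ?_
      exact tendsto_const_nhds.congr fun n => (hR n k).2.2.2.1.symm
    · refine tendsto_nhds_unique (((hvk.const_sub lam).max tendsto_const_nhds).mul hδU) ?_
      exact tendsto_const_nhds.congr fun n => (hR n k).2.2.2.2.symm
  · intro y hy k
    set T := fderiv ℝ (proxL1 (K := K) lam) y
    -- The `k`-th component along the `k`-th coordinate axis is scalar soft thresholding.
    have hl : HasDerivAt (fun t : ℝ => y + (t - y k) • EuclideanSpace.single k (1 : ℝ))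
        (EuclideanSpace.single k (1 : ℝ)) (y k) := by
      have := (((hasDerivAt_id (y k)).sub_const (y k)).smul_const
        (EuclideanSpace.single k (1 : ℝ))).const_add y
      simpa using this
    have hfd : HasFDerivAt (proxL1 (K := K) lam) T
        (y + (y k - y k) • EuclideanSpace.single k (1 : ℝ)) := by
      simpa using hy.hasFDerivAt
    have hs : HasDerivAt (soft lam) (δ T k) (y k) := by
      have h1 := ((EuclideanSpace.proj (𝕜 := ℝ) k).hasFDerivAt.comp _ hfd).comp_hasDerivAt _ hl
      refine h1.congr_of_eventuallyEq (Eventually.of_forall fun t => ?_)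
      simp [proxL1_apply h]
    have hc : HasFDerivAt (fun w : EuclideanSpace ℝ (Fin K) => soft lam (w k))
        (δ T k • EuclideanSpace.proj (𝕜 := ℝ) k) y :=
      HasDerivAt.comp_hasFDerivAt (f := fun w : EuclideanSpace ℝ (Fin K) => w k) y hs
        (EuclideanSpace.proj (𝕜 := ℝ) k).hasFDerivAt
    have hc' : HasFDerivAt (fun w : EuclideanSpace ℝ (Fin K) => soft lam (w k))
        ((EuclideanSpace.proj (𝕜 := ℝ) k).comp T) y := by
      have h1 := (EuclideanSpace.proj (𝕜 := ℝ) k).hasFDerivAt.comp y hy.hasFDerivAt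
      refine h1.congr_of_eventuallyEq (Eventually.of_forall fun w => ?_)
      simp [proxL1_apply h]
    obtain ⟨d0, d1, d2, d3⟩ := deriv_soft h hs
    refine ⟨fun w => ?_, d0, d1, ?_, ?_⟩
    · have := congrArg (fun L => L w) (hc'.unique hc)
      simpa using this
    · rcases le_or_gt |y k| lam with hk | hk
      · rw [max_eq_right (by linarith), zero_mul]
      · rw [d2 hk, sub_self, mul_zero]
    · rcases le_or_gt lam |y k| with hk | hk
      · rw [max_eq_right (by linarith), zero_mul]
      · rw [d3 hk, mul_zero]

/-- Soft thresholding is piecewise affine, so that its increments near a point are given exactly by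
the Clarke Jacobian; the last clause records that the part removed by thresholding only changes in
coordinates where both soft-thresholded values vanish. -/
theorem proxL1_local (h : 0 < lam) (u₀ : EuclideanSpace ℝ (Fin K)) : ∀ᶠ u in 𝓝 u₀,
    (∀ T ∈ clarkeJacobian (proxL1 lam) u, proxL1 lam u - proxL1 lam u₀ = T (u - u₀)) ∧
    ∀ k, u k - proxL1 lam u k = u₀ k - proxL1 lam u₀ k ∨
      (proxL1 lam u k = 0 ∧ proxL1 lam u₀ k = 0) := by
  have hev : ∀ᶠ u in 𝓝 u₀, ∀ k : Fin K, u k = u₀ k ∨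
      (clip lam (u k) = clip lam (u₀ k) ∧ lam < |u k|) ∨
      (soft lam (u k) = 0 ∧ soft lam (u₀ k) = 0 ∧ |u k| < lam) := by
    rw [eventually_all]
    exact fun k => ((EuclideanSpace.proj (𝕜 := ℝ) k).continuous.tendsto u₀).eventually
      (soft_local h (u₀ k))
  have hcs : ∀ x, x - soft lam x = clip lam x := fun x => by unfold soft; ring
  filter_upwards [hev] with u hu
  constructor
  · intro T hT
    obtain ⟨d, hd, hd'⟩ := clarkeJacobian_proxL1 h hT
    ext k
    simp only [hd, PiLp.sub_apply, proxL1_apply h]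
    obtain ⟨-, -, d1, d0⟩ := hd' k
    rcases hu k with h1 | ⟨h1, h2⟩ | ⟨h1, h2, h3⟩
    · rw [h1, sub_self, sub_self, mul_zero]
    · rw [d1 h2, soft, soft, h1]; ring
    · rw [d0 h3, h1, h2]; ring
  · intro k
    simp only [proxL1_apply h, hcs]
    rcases hu k with h1 | h1 | h1
    · exact Or.inl (by rw [h1])
    · exact Or.inl h1.1
    · exact Or.inr ⟨h1.1, h1.2.1⟩

end Soft

/-! ### Projection onto the ball -/

section Ball

variable {K : ℕ} {lam : ℝ}

theorem projBall_of_norm_le {v : EuclideanSpace ℝ (Fin K)} (hv : ‖v‖ ≤ lam) :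
    projBall lam v = v :=
  proj_eq_of_inner_le (by simpa using hv) fun z _ => by simp

theorem projBall_of_le_norm (h : 0 < lam) {v : EuclideanSpace ℝ (Fin K)} (hv : lam ≤ ‖v‖) :
    projBall lam v = lam • ‖v‖⁻¹ • v := by
  have hv0 : 0 < ‖v‖ := h.trans_le hv
  have hn : ‖‖v‖⁻¹ • v‖ = 1 := norm_normalize (norm_pos_iff.1 hv0)
  set n := ‖v‖⁻¹ • v with hnd
  have hvn : v = ‖v‖ • n := by rw [hnd, smul_smul, mul_inv_cancel₀ hv0.ne', one_smul]
  refine proj_eq_of_inner_le ?_ fun z hz => ?_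
  · rw [mem_closedBall_zero_iff, norm_smul, hn, mul_one, Real.norm_of_nonneg h.le]
  · rw [mem_closedBall_zero_iff] at hz
    have e : v - lam • n = (‖v‖ - lam) • n := by rw [sub_smul, ← hvn]
    rw [e, inner_smul_left, inner_sub_right, inner_smul_right, real_inner_self_eq_norm_sq, hn]
    have h1 := real_inner_le_norm n z
    rw [hn, one_mul] at h1
    simp only [conj_trivial]
    exact mul_nonpos_of_nonneg_of_nonpos (by linarith) (by linarith)

theorem norm_projBall_le (h : 0 < lam) (v : EuclideanSpace ℝ (Fin K)) :
    ‖projBall lam v‖ ≤ lam := by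
  rcases le_total ‖v‖ lam with hv | hv
  · rw [projBall_of_norm_le hv]; exact hv
  · rw [projBall_of_le_norm h hv, norm_smul, norm_normalize (norm_pos_iff.1 (h.trans_le hv)),
      mul_one, Real.norm_of_nonneg h.le]

theorem continuous_projBall (h : 0 < lam) : Continuous (projBall (K := K) lam) := by
  have e : projBall (K := K) lam = fun v => (lam / max lam ‖v‖) • v := by
    funext v
    rcases le_total ‖v‖ lam with hv | hv
    · rw [projBall_of_norm_le hv, max_eq_left hv, div_self h.ne', one_smul]
    · rw [projBall_of_le_norm h hv, max_eq_right hv, smul_smul, div_eq_mul_inv]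
  rw [e]
  have : ∀ v : EuclideanSpace ℝ (Fin K), max lam ‖v‖ ≠ 0 := fun v =>
    (h.trans_le (le_max_left _ _)).ne'
  fun_prop (disch := assumption)

theorem fderiv_projBall_of_norm_lt {v : EuclideanSpace ℝ (Fin K)} (hv : ‖v‖ < lam) :
    fderiv ℝ (projBall lam) v = ContinuousLinearMap.id ℝ _ := by
  have : projBall lam =ᶠ[𝓝 v] id := by
    filter_upwards [(continuous_norm.tendsto v).eventually (gt_mem_nhds hv)] with w hw
    exact projBall_of_norm_le hw.le
  rw [this.fderiv_eq, fderiv_id]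

theorem fderiv_projBall_of_lt_norm (h : 0 < lam) {v : EuclideanSpace ℝ (Fin K)}
    (hv : lam < ‖v‖) : fderiv ℝ (projBall lam) v = lam • normalizeDeriv v := by
  have hv0 : 0 < ‖v‖ := h.trans hv
  have e : projBall lam =ᶠ[𝓝 v] fun w => lam • ‖w‖⁻¹ • w := by
    filter_upwards [(continuous_norm.tendsto v).eventually (lt_mem_nhds hv)] with w hw
    exact projBall_of_le_norm h hw.le
  have hd : HasFDerivAt (fun w : EuclideanSpace ℝ (Fin K) => ‖w‖⁻¹ • w) (normalizeDeriv v) v := by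
    have h1 : (fun w => ‖w‖⁻¹ • w - ‖v‖⁻¹ • v - normalizeDeriv v (w - v)) =O[𝓝 v]
        fun w => ‖w - v‖ ^ 2 := by
      refine IsBigO.of_bound (2 * (‖v‖ + (‖v‖ + 1)) / ‖v‖ ^ 3) ?_
      filter_upwards [(continuous_norm.tendsto v).eventually (lt_mem_nhds hv0),
        (continuous_norm.tendsto v).eventually (gt_mem_nhds (lt_add_one ‖v‖))] with w hw hw1
      rw [Real.norm_of_nonneg (sq_nonneg _)]
      refine (normalize_remainder (norm_pos_iff.1 hv0) (norm_pos_iff.1 hw)).trans ?_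
      gcongr
    exact HasFDerivAt.of_isLittleO (h1.trans_isLittleO (isLittleO_pow_sub_sub v one_lt_two))
  rw [e.fderiv_eq]
  exact (hd.const_smul lam).fderiv

/-- On the sphere the projection has different one-sided radial derivatives. -/
theorem not_differentiableAt_projBall (h : 0 < lam) {v : EuclideanSpace ℝ (Fin K)}
    (hv : ‖v‖ = lam) : ¬ DifferentiableAt ℝ (projBall lam) v := by
  intro hd
  have hv0 : v ≠ 0 := fun h0 => by rw [h0, norm_zero] at hv; exact h.ne hv
  have hl : HasDerivAt (fun t : ℝ => t • v) v 1 := by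
    simpa using (hasDerivAt_id (1 : ℝ)).smul_const v
  have hfd : HasFDerivAt (projBall lam) (fderiv ℝ (projBall lam) v) ((1 : ℝ) • v) := by
    simpa using hd.hasFDerivAt
  have hg : HasDerivAt (fun t : ℝ => projBall lam (t • v)) (fderiv ℝ (projBall lam) v v) 1 :=
    hfd.comp_hasDerivAt 1 hl
  have hout : ∀ t ∈ Ici (1 : ℝ), projBall lam (t • v) = v := by
    intro t ht
    have ht0 : 0 < t := one_pos.trans_le ht
    have hn : ‖t • v‖ = t * lam := by rw [norm_smul, hv, Real.norm_of_nonneg ht0.le]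
    rw [projBall_of_le_norm h (by rw [hn]; exact le_mul_of_one_le_left h.le ht), hn, smul_smul,
      smul_smul]
    have : lam * (t * lam)⁻¹ * t = 1 := by field_simp
    rw [this, one_smul]
  have hin : ∀ t ∈ Icc (0 : ℝ) 1, projBall lam (t • v) = t • v := by
    intro t ht
    refine projBall_of_norm_le ?_
    rw [norm_smul, hv, Real.norm_of_nonneg ht.1]
    exact mul_le_of_le_one_left h.le ht.2
  have h1 : HasDerivWithinAt (fun t : ℝ => projBall lam (t • v)) 0 (Ici 1) 1 :=
    (hasDerivWithinAt_const _ _ v).congr hout (hout 1 self_mem_Ici)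
  have h2 : HasDerivWithinAt (fun t : ℝ => projBall lam (t • v)) v (Icc 0 1) 1 :=
    hl.hasDerivWithinAt.congr hin (hin 1 (by simp))
  have e1 := (uniqueDiffWithinAt_Ici (1 : ℝ)).eq_deriv _ hg.hasDerivWithinAt h1
  have e2 := (uniqueDiffOn_Icc (zero_lt_one' ℝ) 1 (by simp)).eq_deriv _ hg.hasDerivWithinAt h2
  exact hv0 (e2.symm.trans e1)

/-- The elements of the Clarke Jacobian of the projection at `v` are combinations of the identity
and of `v vᵀ`. -/
theorem clarkeJacobian_projBall (h : 0 < lam) {v : EuclideanSpace ℝ (Fin K)}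
    {T : EuclideanSpace ℝ (Fin K) →L[ℝ] EuclideanSpace ℝ (Fin K)}
    (hT : T ∈ clarkeJacobian (projBall lam) v) :
    ∃ a b : ℝ, 0 ≤ a ∧ a ≤ 1 ∧ 0 ≤ b ∧ b * ‖v‖ ^ 2 ≤ 1 ∧
      ∀ w, w - T w = a • w + (b * inner ℝ v w) • v := by
  have key := clarkeJacobian_induction (G := projBall (K := K) lam) (x := v)
    (R := fun v T => ∃ a ∈ Icc (0 : ℝ) 1, ∃ b ∈ Icc (0 : ℝ) (lam⁻¹ ^ 2), b * ‖v‖ ^ 2 ≤ 1 ∧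
      ∀ w, w - T w = a • w + (b * inner ℝ v w) • v) ?_ ?_ ?_ T hT
  · obtain ⟨a, ha, b, hb, hbv, hw⟩ := key
    exact ⟨a, b, ha.1, ha.2, hb.1, hbv, hw⟩
  · rintro T₁ ⟨a₁, ha₁, b₁, hb₁, hv₁, hw₁⟩ T₂ ⟨a₂, ha₂, b₂, hb₂, hv₂, hw₂⟩ s t hs ht hst
    refine ⟨s * a₁ + t * a₂, convex_Icc _ _ ha₁ ha₂ hs ht hst, s * b₁ + t * b₂,
      convex_Icc _ _ hb₁ hb₂ hs ht hst, ?_, fun w => ?_⟩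
    · nlinarith
    · have e : w - (s • T₁ + t • T₂) w = s • (w - T₁ w) + t • (w - T₂ w) := by
        obtain rfl : t = 1 - s := by linarith
        simp only [add_apply, smul_apply]
        module
      rw [e, hw₁, hw₂]
      module
  · intro u U T hu hU hR
    choose a ha b hb hbv hw using hR
    obtain ⟨⟨a', b'⟩, hab, φ, hφ, hlim⟩ := (isCompact_Icc.prod isCompact_Icc).tendsto_subseq
      (x := fun n => (a n, b n)) fun n => ⟨ha n, hb n⟩
    have ha' : Tendsto (fun n => a (φ n)) atTop (𝓝 a') := (continuous_fst.tendsto _).comp hlim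
    have hb' : Tendsto (fun n => b (φ n)) atTop (𝓝 b') := (continuous_snd.tendsto _).comp hlim
    have hu' := hu.comp hφ.tendsto_atTop
    refine ⟨a', hab.1, b', hab.2, ?_, fun w => ?_⟩
    · exact le_of_tendsto' (hb'.mul (hu'.norm.pow 2)) fun n => hbv _
    · have h1 : Tendsto (fun n => w - U (φ n) w) atTop (𝓝 (w - T w)) :=
        (((ContinuousLinearMap.apply ℝ _ w).continuous.tendsto T).comp
          (hU.comp hφ.tendsto_atTop)).const_sub w
      refine tendsto_nhds_unique h1 ?_
      refine Tendsto.congr (fun n => (hw (φ n) w).symm) ?_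
      exact (ha'.smul_const w).add ((hb'.mul (hu'.inner tendsto_const_nhds)).smul hu')
  · intro y hy
    rcases lt_trichotomy ‖y‖ lam with hy' | hy' | hy'
    · refine ⟨0, by simp, 0, ⟨le_rfl, by positivity⟩, by simp, fun w => ?_⟩
      rw [fderiv_projBall_of_norm_lt hy']
      simp
    · exact absurd hy (not_differentiableAt_projBall h hy')
    · have hy0 : 0 < ‖y‖ := h.trans hy'
      have h1 : lam * ‖y‖⁻¹ ≤ 1 := by
        rw [← div_eq_mul_inv, div_le_one hy0]; exact hy'.le
      refine ⟨1 - lam * ‖y‖⁻¹, ⟨by linarith, by linarith [show 0 < lam * ‖y‖⁻¹ by positivity]⟩,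
        lam * ‖y‖⁻¹ ^ 3, ⟨by positivity, ?_⟩, ?_, fun w => ?_⟩
      · calc lam * ‖y‖⁻¹ ^ 3 = lam * ‖y‖⁻¹ * ‖y‖⁻¹ ^ 2 := by ring
          _ ≤ 1 * lam⁻¹ ^ 2 := by gcongr
          _ = _ := one_mul _
      · calc lam * ‖y‖⁻¹ ^ 3 * ‖y‖ ^ 2 = lam * ‖y‖⁻¹ := by field_simp
          _ ≤ 1 := h1
      · rw [fderiv_projBall_of_lt_norm h hy', smul_apply, normalizeDeriv_apply]
        module

/-- Near any point `v₀`, the two points lie on the same side of the sphere. -/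
theorem eventually_same_side (lam : ℝ) (v₀ : EuclideanSpace ℝ (Fin K)) : ∀ᶠ v in 𝓝 v₀,
    (‖v‖ ≤ lam ∧ ‖v₀‖ ≤ lam) ∨ (lam < ‖v‖ ∧ lam ≤ ‖v₀‖) := by
  rcases lt_or_ge ‖v₀‖ lam with hv | hv
  · filter_upwards [(continuous_norm.tendsto v₀).eventually (gt_mem_nhds hv)] with v hv'
    exact Or.inl ⟨hv'.le, hv.le⟩
  · rcases hv.eq_or_lt with hv | hv
    · refine Eventually.of_forall fun v => ?_
      rcases le_or_gt ‖v‖ lam with hv' | hv'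
      · exact Or.inl ⟨hv', hv.ge⟩
      · exact Or.inr ⟨hv', hv.le⟩
    · filter_upwards [(continuous_norm.tendsto v₀).eventually (lt_mem_nhds hv)] with v hv'
      exact Or.inr ⟨hv', hv.le⟩

/-- The projection onto the ball is strongly semismooth. -/
theorem semismooth_projBall (h : 0 < lam) (v₀ : EuclideanSpace ℝ (Fin K)) :
    ∃ C, 0 ≤ C ∧ ∀ᶠ v in 𝓝 v₀, ∀ T ∈ clarkeJacobian (projBall lam) v,
      ‖projBall lam v - projBall lam v₀ - T (v - v₀)‖ ≤ C * ‖v - v₀‖ ^ 2 := by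
  set C := lam * (2 * ((‖v₀‖ + 1) + ‖v₀‖) / lam ^ 3) with hC
  have hC0 : 0 ≤ C := by positivity
  have hev : ∀ᶠ v in 𝓝 v₀, DifferentiableAt ℝ (projBall lam) v →
      ‖projBall lam v - projBall lam v₀ - fderiv ℝ (projBall lam) v (v - v₀)‖ ≤
        C * ‖v - v₀‖ ^ 2 := by
    filter_upwards [eventually_same_side lam v₀,
      (continuous_norm.tendsto v₀).eventually (gt_mem_nhds (lt_add_one ‖v₀‖))] with v hv hv1 hd
    rcases hv with ⟨h1, h2⟩ | ⟨h1, h2⟩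
    · rcases h1.eq_or_lt with h1 | h1
      · exact absurd hd (not_differentiableAt_projBall h h1)
      · rw [fderiv_projBall_of_norm_lt h1, projBall_of_norm_le h1.le, projBall_of_norm_le h2]
        simp only [ContinuousLinearMap.id_apply, sub_self, norm_zero]
        positivity
    · have hv0 := h.trans h1
      have hv00 := h.trans_le h2
      rw [fderiv_projBall_of_lt_norm h h1, projBall_of_le_norm h h1.le, projBall_of_le_norm h h2,
        smul_apply, ← smul_sub, ← smul_sub, norm_smul, Real.norm_of_nonneg h.le, hC, mul_assoc]
      refine mul_le_mul_of_nonneg_left ?_ h.le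
      have e : ‖v‖⁻¹ • v - ‖v₀‖⁻¹ • v₀ - normalizeDeriv v (v - v₀) =
          -(‖v₀‖⁻¹ • v₀ - ‖v‖⁻¹ • v - normalizeDeriv v (v₀ - v)) := by
        rw [← neg_sub v₀ v, map_neg]; abel
      rw [e, norm_neg]
      refine (normalize_remainder (norm_pos_iff.1 hv0) (norm_pos_iff.1 hv00)).trans ?_
      rw [norm_sub_rev]
      gcongr
  obtain ⟨U, hU, hUo, hvU⟩ := eventually_nhds_iff.1 hev
  refine ⟨C, hC0, ?_⟩
  filter_upwards [hUo.mem_nhds hvU] with v hv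
  exact clarkeJacobian_semismooth (continuous_projBall h) hUo (fun y hy => hU y hy) v hv

end Ball

/-! ### The proximal mapping of `λ₁‖·‖₁ + λ₂‖·‖₂` -/

section Group

variable {K : ℕ} {lam1 lam2 : ℝ}

/-- The norm `φ = λ₁‖·‖₁ + λ₂‖·‖₂` on `ℝ^K`. -/
noncomputable def groupNorm (lam1 lam2 : ℝ) (u : EuclideanSpace ℝ (Fin K)) : ℝ :=
  lam1 * ∑ k, |u k| + lam2 * ‖u‖

/-- `Prox_φ(u)`, in its closed form `(I - Π_B)(Prox_{λ₁‖·‖₁}(u))`. -/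
noncomputable def proxGroup (lam1 lam2 : ℝ) (u : EuclideanSpace ℝ (Fin K)) :
    EuclideanSpace ℝ (Fin K) :=
  proxL1 lam1 u - projBall lam2 (proxL1 lam1 u)

theorem sub_proxGroup (u : EuclideanSpace ℝ (Fin K)) : u - proxGroup lam1 lam2 u =
    (u - proxL1 lam1 u) + projBall lam2 (proxL1 lam1 u) := by
  unfold proxGroup; abel

theorem proxGroup_eq_zero {u : EuclideanSpace ℝ (Fin K)} (hu : ‖proxL1 lam1 u‖ ≤ lam2) :
    proxGroup lam1 lam2 u = 0 := by
  rw [proxGroup, projBall_of_norm_le hu, sub_self]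

theorem proxGroup_eq_smul (h2 : 0 < lam2) {u : EuclideanSpace ℝ (Fin K)}
    (hu : lam2 ≤ ‖proxL1 lam1 u‖) : proxGroup lam1 lam2 u =
      (‖proxL1 lam1 u‖ - lam2) • ‖proxL1 lam1 u‖⁻¹ • proxL1 lam1 u := by
  have h0 : ‖proxL1 lam1 u‖ ≠ 0 := (h2.trans_le hu).ne'
  rw [proxGroup, projBall_of_le_norm h2 hu, sub_smul, smul_smul ‖proxL1 lam1 u‖,
    mul_inv_cancel₀ h0, one_smul]

/-- The proximal point is a nonnegative multiple of the soft-thresholded vector. -/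
theorem exists_proxGroup_eq_smul (h2 : 0 < lam2) (u : EuclideanSpace ℝ (Fin K)) :
    ∃ α : ℝ, 0 ≤ α ∧ proxGroup lam1 lam2 u = α • proxL1 lam1 u := by
  rcases le_total ‖proxL1 lam1 u‖ lam2 with hu | hu
  · exact ⟨0, le_rfl, by rw [proxGroup_eq_zero hu, zero_smul]⟩
  · refine ⟨_, ?_, (proxGroup_eq_smul h2 hu).trans (smul_smul _ _ _)⟩
    exact mul_nonneg (by linarith) (by positivity)

theorem sub_proxL1_apply (h1 : 0 < lam1) (u : EuclideanSpace ℝ (Fin K)) (k : Fin K) :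
    (u - proxL1 lam1 u) k = clip lam1 (u k) := by
  rw [PiLp.sub_apply, proxL1_apply h1, soft]; ring

/-- `u - Prox_φ(u)` lies in the unit ball of the dual norm of `φ`. -/
theorem inner_sub_proxGroup_le (h1 : 0 < lam1) (h2 : 0 < lam2) (u z : EuclideanSpace ℝ (Fin K)) :
    inner ℝ (u - proxGroup lam1 lam2 u) z ≤ groupNorm lam1 lam2 z := by
  rw [sub_proxGroup, inner_add_left]
  refine add_le_add ?_ ?_
  · rw [PiLp.inner_apply, Finset.mul_sum]
    refine Finset.sum_le_sum fun k _ => ?_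
    rw [sub_proxL1_apply h1]
    simp only [RCLike.inner_apply, conj_trivial]
    refine (le_abs_self _).trans ?_
    rw [abs_mul, mul_comm]
    exact mul_le_mul_of_nonneg_right (abs_clip_le h1 _) (abs_nonneg _)
  · exact (real_inner_le_norm _ _).trans
      (mul_le_mul_of_nonneg_right (norm_projBall_le h2 _) (norm_nonneg _))

/-- `u - Prox_φ(u)` is a subgradient of `φ` at `Prox_φ(u)`. -/
theorem inner_sub_proxGroup_self (h1 : 0 < lam1) (h2 : 0 < lam2) (u : EuclideanSpace ℝ (Fin K)) :
    inner ℝ (u - proxGroup lam1 lam2 u) (proxGroup lam1 lam2 u) =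
      groupNorm lam1 lam2 (proxGroup lam1 lam2 u) := by
  rw [sub_proxGroup, inner_add_left]
  congr 1
  · obtain ⟨α, hα, e⟩ := exists_proxGroup_eq_smul (lam1 := lam1) h2 u
    rw [e, PiLp.inner_apply, Finset.mul_sum]
    refine Finset.sum_congr rfl fun k _ => ?_
    rw [sub_proxL1_apply h1]
    simp only [PiLp.smul_apply, proxL1_apply h1, RCLike.inner_apply, conj_trivial, smul_eq_mul,
      abs_mul, abs_of_nonneg hα]
    linear_combination α * clip_mul_soft h1 (u k)
  · rcases le_total ‖proxL1 lam1 u‖ lam2 with hu | hu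
    · rw [proxGroup_eq_zero hu, inner_zero_right, norm_zero, mul_zero]
    · have hv0 := norm_pos_iff.1 (h2.trans_le hu)
      rw [proxGroup_eq_smul h2 hu, projBall_of_le_norm h2 hu, inner_smul_left, inner_smul_right,
        real_inner_self_eq_norm_sq, norm_smul _ (‖proxL1 lam1 u‖⁻¹ • proxL1 lam1 u),
        norm_normalize hv0, Real.norm_of_nonneg (by linarith)]
      simp

/-- The elements `(I - Σ) Λ` of the generalized Jacobian are symmetric, positive semidefinite and
bounded: `I - Σ` is a combination of `I` and `v vᵀ`, and `Λ` fixes the support of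
`v = Prox_{λ₁‖·‖₁}(u)`. -/
theorem jacProxGroup_spec (h1 : 0 < lam1) (h2 : 0 < lam2) {u : EuclideanSpace ℝ (Fin K)}
    {M : EuclideanSpace ℝ (Fin K) →L[ℝ] EuclideanSpace ℝ (Fin K)}
    (hM : M ∈ jacProxGroup lam1 lam2 u) :
    (∀ w z, inner ℝ (M w) z = inner ℝ w (M z)) ∧ (∀ w, 0 ≤ inner ℝ (M w) w) ∧
      ∀ w, ‖M w‖ ≤ 2 * ‖w‖ := by
  obtain ⟨Sg, hSg, Lm, hLm, rfl⟩ := hM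
  obtain ⟨a, b, ha0, ha1, hb0, hb1, hS⟩ := clarkeJacobian_projBall h2 hSg
  obtain ⟨d, hd, hd'⟩ := clarkeJacobian_proxL1 h1 hLm
  set v := proxL1 lam1 u with hv
  have hvL : ∀ w, inner ℝ v (Lm w) = inner ℝ v w := by
    intro w
    rw [PiLp.inner_apply, PiLp.inner_apply]
    refine Finset.sum_congr rfl fun k _ => ?_
    simp only [hd, RCLike.inner_apply, conj_trivial]
    by_cases h0 : v k = 0
    · simp [h0]
    · rw [hv, proxL1_apply h1] at h0
      rw [(hd' k).2.2.1 (lt_abs_of_soft_ne_zero h0), one_mul]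
  have hLs : ∀ w z, inner ℝ (Lm w) z = ∑ k, d k * (w k * z k) := by
    intro w z
    rw [PiLp.inner_apply]
    refine Finset.sum_congr rfl fun k _ => ?_
    simp only [hd, RCLike.inner_apply, conj_trivial]
    ring
  have hLn : ∀ w, ‖Lm w‖ ≤ ‖w‖ := by
    intro w
    rw [EuclideanSpace.norm_eq, EuclideanSpace.norm_eq]
    refine Real.sqrt_le_sqrt (Finset.sum_le_sum fun k _ => ?_)
    rw [hd, norm_mul, Real.norm_of_nonneg (hd' k).1]
    have := mul_le_of_le_one_left (norm_nonneg (w k)) (hd' k).2.1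
    have h0 := (hd' k).1
    gcongr
  have hform : ∀ w, (ContinuousLinearMap.id ℝ _ - Sg).comp Lm w =
      a • Lm w + (b * inner ℝ v w) • v := by
    intro w
    have := hS (Lm w)
    rw [hvL] at this
    exact this
  refine ⟨fun w z => ?_, fun w => ?_, fun w => ?_⟩
  · rw [hform, hform, inner_add_left, inner_add_right, inner_smul_left, inner_smul_right,
      inner_smul_left, inner_smul_right, real_inner_comm (Lm z) w, hLs, hLs, real_inner_comm v w]
    simp only [conj_trivial]
    rw [Finset.sum_congr rfl fun k _ => by rw [mul_comm (w k)]]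
    ring
  · rw [hform, inner_add_left, inner_smul_left, inner_smul_left, hLs]
    simp only [conj_trivial]
    have h3 : 0 ≤ ∑ k, d k * (w k * w k) :=
      Finset.sum_nonneg fun k _ => mul_nonneg (hd' k).1 (mul_self_nonneg _)
    have h4 : b * inner ℝ v w * inner ℝ v w = b * inner ℝ v w ^ 2 := by ring
    rw [h4]
    positivity
  · rw [hform]
    refine (norm_add_le _ _).trans ?_
    rw [norm_smul, norm_smul, norm_mul, Real.norm_of_nonneg ha0, Real.norm_of_nonneg hb0,
      Real.norm_eq_abs]
    have h3 : a * ‖Lm w‖ ≤ 1 * ‖w‖ := mul_le_mul ha1 (hLn w) (norm_nonneg _) zero_le_one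
    have h4 : b * |inner ℝ v w| * ‖v‖ ≤ ‖w‖ := by
      calc b * |inner ℝ v w| * ‖v‖ ≤ b * (‖v‖ * ‖w‖) * ‖v‖ := by
            gcongr; exact abs_real_inner_le_norm _ _
        _ = b * ‖v‖ ^ 2 * ‖w‖ := by ring
        _ ≤ 1 * ‖w‖ := by gcongr
        _ = ‖w‖ := one_mul _
    linarith

/-- `Prox_φ` is strongly semismooth with respect to its generalized Jacobian. -/
theorem semismooth_proxGroup (h1 : 0 < lam1) (h2 : 0 < lam2) (u₀ : EuclideanSpace ℝ (Fin K)) :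
    ∃ C, ∀ᶠ u in 𝓝 u₀, ∀ M ∈ jacProxGroup lam1 lam2 u,
      ‖proxGroup lam1 lam2 u - proxGroup lam1 lam2 u₀ - M (u - u₀)‖ ≤ C * ‖u - u₀‖ ^ 2 := by
  obtain ⟨C, hC, hev⟩ := semismooth_projBall h2 (proxL1 lam1 u₀)
  refine ⟨C, ?_⟩
  filter_upwards [((continuous_proxL1 h1).tendsto u₀).eventually hev, proxL1_local h1 u₀]
    with u hu hu'
  rintro M ⟨Sg, hSg, Lm, hLm, rfl⟩
  have e : (ContinuousLinearMap.id ℝ _ - Sg).comp Lm (u - u₀) =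
      (proxL1 lam1 u - proxL1 lam1 u₀) - Sg (proxL1 lam1 u - proxL1 lam1 u₀) := by
    rw [hu'.1 Lm hLm]; rfl
  have e' : proxGroup lam1 lam2 u - proxGroup lam1 lam2 u₀ -
      (ContinuousLinearMap.id ℝ _ - Sg).comp Lm (u - u₀) =
      -(projBall lam2 (proxL1 lam1 u) - projBall lam2 (proxL1 lam1 u₀) -
        Sg (proxL1 lam1 u - proxL1 lam1 u₀)) := by
    rw [e, proxGroup, proxGroup]; abel
  rw [e', norm_neg]
  refine (hu Sg hSg).trans ?_
  have := norm_proxL1_sub_le h1 u u₀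
  gcongr

/-- The trapezoidal rule for the Moreau envelope of `φ` is exact to third order: its error is
`½⟨y + y₀, (u - u₀) - (y - y₀)⟩` for the proximal points `y` and `y₀`. -/
theorem proxGroup_trapezoidal (h1 : 0 < lam1) (h2 : 0 < lam2) (u₀ : EuclideanSpace ℝ (Fin K)) :
    ∃ C, ∀ᶠ u in 𝓝 u₀,
      inner ℝ (proxGroup lam1 lam2 u + proxGroup lam1 lam2 u₀)
        ((u - u₀) - (proxGroup lam1 lam2 u - proxGroup lam1 lam2 u₀)) ≤ C * ‖u - u₀‖ ^ 3 := by
  refine ⟨2 / lam2, ?_⟩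
  filter_upwards [((continuous_proxL1 h1).tendsto u₀).eventually
    (eventually_same_side lam2 (proxL1 lam1 u₀)), proxL1_local h1 u₀] with u hu hu'
  set v := proxL1 lam1 u with hv
  set v₀ := proxL1 lam1 u₀ with hv₀
  have hlip : ‖v - v₀‖ ≤ ‖u - u₀‖ := norm_proxL1_sub_le h1 u u₀
  rcases hu with ⟨hu1, hu2⟩ | ⟨hu1, hu2⟩
  · rw [proxGroup_eq_zero hu1, proxGroup_eq_zero hu2]
    simp only [add_zero, inner_zero_left]
    positivity
  · have hv0 := h2.trans hu1
    have hv00 := h2.trans_le hu2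
    have e0 : (u - u₀) - (proxGroup lam1 lam2 u - proxGroup lam1 lam2 u₀) =
        ((u - v) - (u₀ - v₀)) + (projBall lam2 v - projBall lam2 v₀) := by
      rw [proxGroup, proxGroup]; abel
    -- The part removed by soft thresholding changes only where both proximal points vanish.
    have e1 : inner ℝ (proxGroup lam1 lam2 u + proxGroup lam1 lam2 u₀)
        ((u - v) - (u₀ - v₀)) = 0 := by
      obtain ⟨α, -, hα⟩ := exists_proxGroup_eq_smul (lam1 := lam1) h2 u
      obtain ⟨α₀, -, hα₀⟩ := exists_proxGroup_eq_smul (lam1 := lam1) h2 u₀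
      rw [hα, hα₀, PiLp.inner_apply]
      refine Finset.sum_eq_zero fun k _ => ?_
      simp only [PiLp.add_apply, PiLp.smul_apply, PiLp.sub_apply, RCLike.inner_apply,
        conj_trivial, smul_eq_mul]
      rcases hu'.2 k with h | ⟨h, h'⟩
      · rw [hv, hv₀, h, sub_self, zero_mul]
      · rw [h, h']; ring
    rw [e0, inner_add_right, e1, zero_add, proxGroup_eq_smul h2 hu1.le, proxGroup_eq_smul h2 hu2,
      projBall_of_le_norm h2 hu1.le, projBall_of_le_norm h2 hu2, ← hv, ← hv₀]
    have hnm := one_sub_inner_normalize (norm_pos_iff.1 hv0) (norm_pos_iff.1 hv00)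
    have hn := norm_normalize (norm_pos_iff.1 hv0)
    have hm := norm_normalize (norm_pos_iff.1 hv00)
    have hle := norm_normalize_sub_le (norm_pos_iff.1 hv0) (norm_pos_iff.1 hv00)
    set n := ‖v‖⁻¹ • v
    set m := ‖v₀‖⁻¹ • v₀
    have e2 : inner ℝ ((‖v‖ - lam2) • n + (‖v₀‖ - lam2) • m) (lam2 • n - lam2 • m) =
        lam2 * (‖v‖ - ‖v₀‖) * (1 / 2 * ‖n - m‖ ^ 2) := by
      rw [← hnm]
      simp only [inner_add_left, inner_sub_right, inner_smul_left, inner_smul_right,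
        real_inner_self_eq_norm_sq, hn, hm, conj_trivial, real_inner_comm n m]
      ring
    rw [e2]
    have h3 : ‖v‖ - ‖v₀‖ ≤ ‖u - u₀‖ := (norm_sub_norm_le _ _).trans hlip
    have h4 : ‖n - m‖ ≤ 2 * ‖u - u₀‖ / lam2 := hle.trans (by gcongr)
    calc lam2 * (‖v‖ - ‖v₀‖) * (1 / 2 * ‖n - m‖ ^ 2)
        ≤ lam2 * ‖u - u₀‖ * (1 / 2 * (2 * ‖u - u₀‖ / lam2) ^ 2) := by gcongr
      _ = 2 / lam2 * ‖u - u₀‖ ^ 3 := by field_simp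

end Group

/-! ### The proximal mapping of the regularizer -/

section Regularizer

variable {K p : ℕ} {lam1 lam2 : ℝ}

theorem group_apply (X : ZSpace K p) (i j : Fin p) (k : Fin K) :
    group X i j k = (X k).toMat i j := rfl

@[simp] theorem group_add (X Y : ZSpace K p) (i j : Fin p) :
    group (X + Y) i j = group X i j + group Y i j := rfl

@[simp] theorem group_sub (X Y : ZSpace K p) (i j : Fin p) :
    group (X - Y) i j = group X i j - group Y i j := rfl

@[simp] theorem group_smul (c : ℝ) (X : ZSpace K p) (i j : Fin p) :
    group (c • X) i j = c • group X i j := rfl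

theorem group_comm (X : ZSpace K p) (i j : Fin p) : group X i j = group X j i := by
  ext k
  exact (X k).2 i j

theorem zspace_inner_eq (X Y : ZSpace K p) : inner ℝ X Y = ∑ k, inner ℝ (X k) (Y k) :=
  PiLp.inner_apply _ _

theorem inner_eq_sum_group (X Y : ZSpace K p) :
    inner ℝ X Y = ∑ i, ∑ j, inner ℝ (group X i j) (group Y i j) := by
  simp only [SymMat.inner_eq_sum, PiLp.inner_apply, group_apply]
  rw [Finset.sum_comm]
  refine Finset.sum_congr rfl fun i _ => ?_
  rw [Finset.sum_comm]
  refine Finset.sum_congr rfl fun j _ => Finset.sum_congr rfl fun k _ => ?_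
  simp [mul_comm]

theorem norm_sq_eq_sum_group (X : ZSpace K p) : ‖X‖ ^ 2 = ∑ i, ∑ j, ‖group X i j‖ ^ 2 := by
  rw [← real_inner_self_eq_norm_sq, inner_eq_sum_group]
  simp only [real_inner_self_eq_norm_sq]

theorem norm_group_le (X : ZSpace K p) (i j : Fin p) : ‖group X i j‖ ≤ ‖X‖ := by
  refine le_of_sq_le_sq ?_ (norm_nonneg _)
  rw [norm_sq_eq_sum_group]
  calc ‖group X i j‖ ^ 2 ≤ ∑ j, ‖group X i j‖ ^ 2 :=
        Finset.single_le_sum (f := fun j => ‖group X i j‖ ^ 2) (fun _ _ => sq_nonneg _)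
          (Finset.mem_univ j)
    _ ≤ _ := Finset.single_le_sum (f := fun i => ∑ j, ‖group X i j‖ ^ 2)
          (fun _ _ => Finset.sum_nonneg fun _ _ => sq_nonneg _) (Finset.mem_univ i)

theorem norm_le_sum_group (X : ZSpace K p) : ‖X‖ ≤ ∑ i, ∑ j, ‖group X i j‖ := by
  have h0 : ∀ i, 0 ≤ ∑ j, ‖group X i j‖ := fun i => Finset.sum_nonneg fun _ _ => norm_nonneg _
  refine le_of_sq_le_sq ?_ (Finset.sum_nonneg fun i _ => h0 i)
  rw [norm_sq_eq_sum_group]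
  refine le_trans (Finset.sum_le_sum fun i _ => ?_)
    (Finset.sum_sq_le_sq_sum_of_nonneg fun i _ => h0 i)
  exact Finset.sum_sq_le_sq_sum_of_nonneg fun j _ => norm_nonneg _

theorem continuous_group (i j : Fin p) : Continuous fun X : ZSpace K p => group X i j :=
  (LipschitzWith.of_dist_le_mul (K := 1) fun X Y => by
    rw [dist_eq_norm, dist_eq_norm, NNReal.coe_one, one_mul, ← group_sub]
    exact norm_group_le _ _ _).continuous

theorem regularizer_eq_sum_group (X : ZSpace K p) : regularizer lam1 lam2 X =
    ∑ i, ∑ j, if i = j then 0 else groupNorm lam1 lam2 (group X i j) := by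
  unfold regularizer
  have e : ∑ k, ∑ i, ∑ j, (if i ≠ j then |(X k).toMat i j| else 0) =
      ∑ i, ∑ j, ∑ k, if i ≠ j then |(X k).toMat i j| else 0 := by
    rw [Finset.sum_comm]
    exact Finset.sum_congr rfl fun i _ => Finset.sum_comm
  rw [e]
  simp only [Finset.mul_sum, ← Finset.sum_add_distrib]
  refine Finset.sum_congr rfl fun i _ => Finset.sum_congr rfl fun j _ => ?_
  by_cases h : i = j
  · simp [h]
  · simp [h, groupNorm, EuclideanSpace.norm_eq, group_apply, Finset.mul_sum]

theorem regularizer_smul {c : ℝ} (hc : 0 ≤ c) (X : ZSpace K p) :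
    regularizer lam1 lam2 (c • X) = c * regularizer lam1 lam2 X := by
  rw [regularizer_eq_sum_group, regularizer_eq_sum_group]
  simp only [Finset.mul_sum]
  refine Finset.sum_congr rfl fun i _ => Finset.sum_congr rfl fun j _ => ?_
  split_ifs
  · simp
  · simp only [groupNorm, group_smul, norm_smul, Real.norm_of_nonneg hc, PiLp.smul_apply,
      smul_eq_mul, abs_mul, abs_of_nonneg hc, ← Finset.mul_sum]
    ring

/-- The proximal mapping of the regularizer: it acts as `Prox_φ` on the off-diagonal groups, and
trivially on the diagonal. -/
noncomputable def proxReg (lam1 lam2 : ℝ) (U : ZSpace K p) : ZSpace K p :=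
  WithLp.toLp 2 fun k => SymMat.ofMat
    (Matrix.of fun i j => (if i = j then group U i j else proxGroup lam1 lam2 (group U i j)) k)
    (by
      ext i j
      simp only [Matrix.conjTranspose_apply, Matrix.of_apply, star_trivial, group_comm U j i,
        eq_comm (a := j)])

theorem group_proxReg (U : ZSpace K p) (i j : Fin p) : group (proxReg lam1 lam2 U) i j =
    if i = j then group U i j else proxGroup lam1 lam2 (group U i j) := rfl

theorem inner_sub_proxReg_le (h1 : 0 < lam1) (h2 : 0 < lam2) (U Y : ZSpace K p) :
    inner ℝ (U - proxReg lam1 lam2 U) Y ≤ regularizer lam1 lam2 Y := by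
  rw [inner_eq_sum_group, regularizer_eq_sum_group]
  refine Finset.sum_le_sum fun i _ => Finset.sum_le_sum fun j _ => ?_
  rw [group_sub, group_proxReg]
  split_ifs
  · simp
  · exact inner_sub_proxGroup_le h1 h2 _ _

theorem inner_sub_proxReg_self (h1 : 0 < lam1) (h2 : 0 < lam2) (U : ZSpace K p) :
    inner ℝ (U - proxReg lam1 lam2 U) (proxReg lam1 lam2 U) =
      regularizer lam1 lam2 (proxReg lam1 lam2 U) := by
  rw [inner_eq_sum_group, regularizer_eq_sum_group]
  refine Finset.sum_congr rfl fun i _ => Finset.sum_congr rfl fun j _ => ?_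
  rw [group_sub, group_proxReg]
  split_ifs
  · simp
  · exact inner_sub_proxGroup_self h1 h2 _

/-- The proximal mapping of the regularizer is firmly nonexpansive. -/
theorem norm_proxReg_sub_sq_le (h1 : 0 < lam1) (h2 : 0 < lam2) (U Y : ZSpace K p) :
    ‖proxReg lam1 lam2 U - proxReg lam1 lam2 Y‖ ^ 2 ≤
      inner ℝ (proxReg lam1 lam2 U - proxReg lam1 lam2 Y) (U - Y) := by
  have a1 := inner_sub_proxReg_self h1 h2 U
  have a2 := inner_sub_proxReg_self h1 h2 Y
  have a3 := inner_sub_proxReg_le h1 h2 U (proxReg lam1 lam2 Y)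
  have a4 := inner_sub_proxReg_le h1 h2 Y (proxReg lam1 lam2 U)
  set P := proxReg lam1 lam2 U
  set Q := proxReg lam1 lam2 Y
  have e : U - Y = (P - Q) + ((U - P) - (Y - Q)) := by abel
  have e2 : inner ℝ (P - Q) ((U - P) - (Y - Q)) = inner ℝ (U - P) P - inner ℝ (U - P) Q -
      (inner ℝ (Y - Q) P - inner ℝ (Y - Q) Q) := by
    rw [real_inner_comm, inner_sub_left, inner_sub_right, inner_sub_right]
  rw [e, inner_add_right, real_inner_self_eq_norm_sq, e2]
  linarith

/-- The elements of the surrogate Jacobian act on the groups separately. -/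
theorem jacProxReg_spec {U : ZSpace K p} {W : ZSpace K p →L[ℝ] ZSpace K p}
    (hW : W ∈ jacProxReg lam1 lam2 U) : ∀ i j, ∃ N : EuclideanSpace ℝ (Fin K) →L[ℝ]
      EuclideanSpace ℝ (Fin K), (∀ Y, group (W Y) i j = N (group Y i j)) ∧
        (i = j ∧ N = ContinuousLinearMap.id ℝ _ ∨
          i ≠ j ∧ N ∈ jacProxGroup lam1 lam2 (group U i j)) := by
  obtain ⟨M, hM, hW⟩ := hW
  intro i j
  rcases lt_trichotomy i j with h | h | h
  · refine ⟨M i j, fun Y => ?_, Or.inr ⟨h.ne, hM i j h⟩⟩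
    rw [hW, if_pos h]
  · refine ⟨_, fun Y => ?_, Or.inl ⟨h, rfl⟩⟩
    rw [hW, if_neg h.not_lt, if_pos h]
    rfl
  · refine ⟨M j i, fun Y => ?_, Or.inr ⟨h.ne', ?_⟩⟩
    · rw [hW, if_neg h.not_gt, if_neg h.ne']
    · rw [group_comm U i j]; exact hM j i h

/-- The elements of the surrogate Jacobian are symmetric, positive semidefinite and bounded, as
their actions on the groups are. -/
theorem jacProxReg_props (h1 : 0 < lam1) (h2 : 0 < lam2) {U : ZSpace K p}
    {W : ZSpace K p →L[ℝ] ZSpace K p} (hW : W ∈ jacProxReg lam1 lam2 U) :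
    (∀ X Y, inner ℝ (W X) Y = inner ℝ X (W Y)) ∧ (∀ X, 0 ≤ inner ℝ (W X) X) ∧
      ∀ X, ‖W X‖ ≤ 2 * ‖X‖ := by
  choose N hN hN' using jacProxReg_spec hW
  have hspec : ∀ i j, (∀ w z, inner ℝ (N i j w) z = inner ℝ w (N i j z)) ∧
      (∀ w, 0 ≤ inner ℝ (N i j w) w) ∧ ∀ w, ‖N i j w‖ ≤ 2 * ‖w‖ := by
    intro i j
    rcases hN' i j with ⟨-, h⟩ | ⟨-, h⟩
    · rw [h]
      refine ⟨fun w z => rfl, fun w => real_inner_self_nonneg, fun w => ?_⟩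
      rw [ContinuousLinearMap.id_apply]
      linarith [norm_nonneg w]
    · exact jacProxGroup_spec h1 h2 h
  refine ⟨fun X Y => ?_, fun X => ?_, fun X => ?_⟩
  · simp only [inner_eq_sum_group, hN, (hspec _ _).1]
  · rw [inner_eq_sum_group]
    refine Finset.sum_nonneg fun i _ => Finset.sum_nonneg fun j _ => ?_
    rw [hN]
    exact (hspec i j).2.1 _
  · refine le_of_sq_le_sq ?_ (by positivity)
    rw [mul_pow, norm_sq_eq_sum_group, norm_sq_eq_sum_group]
    simp only [Finset.mul_sum, ← mul_pow]
    refine Finset.sum_le_sum fun i _ => Finset.sum_le_sum fun j _ => ?_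
    rw [hN]
    have := (hspec i j).2.2 (group X i j)
    gcongr

/-- The proximal mapping of the regularizer is strongly semismooth with respect to its surrogate
Jacobian. -/
theorem semismooth_proxReg (h1 : 0 < lam1) (h2 : 0 < lam2) (U₀ : ZSpace K p) :
    ∃ C, ∀ᶠ U in 𝓝 U₀, ∀ W ∈ jacProxReg lam1 lam2 U,
      ‖proxReg lam1 lam2 U - proxReg lam1 lam2 U₀ - W (U - U₀)‖ ≤ C * ‖U - U₀‖ ^ 2 := by
  choose C hC using fun i j => semismooth_proxGroup (K := K) h1 h2 (group U₀ i j)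
  refine ⟨∑ i, ∑ j, |C i j|, ?_⟩
  have hev : ∀ᶠ U in 𝓝 U₀, ∀ i j : Fin p, ∀ M ∈ jacProxGroup lam1 lam2 (group U i j),
      ‖proxGroup lam1 lam2 (group U i j) - proxGroup lam1 lam2 (group U₀ i j) -
        M (group U i j - group U₀ i j)‖ ≤ C i j * ‖group U i j - group U₀ i j‖ ^ 2 := by
    rw [eventually_all]; intro i
    rw [eventually_all]; intro j
    exact ((continuous_group i j).tendsto U₀).eventually (hC i j)
  filter_upwards [hev] with U hU W hW
  refine (norm_le_sum_group _).trans ?_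
  simp only [Finset.sum_mul]
  refine Finset.sum_le_sum fun i _ => Finset.sum_le_sum fun j _ => ?_
  obtain ⟨N, hN, hN'⟩ := jacProxReg_spec hW i j
  simp only [group_sub, group_proxReg, hN]
  rcases hN' with ⟨rfl, rfl⟩ | ⟨hij, h⟩
  · simp only [if_true, ContinuousLinearMap.id_apply, sub_self, norm_zero]
    positivity
  · rw [if_neg hij, if_neg hij]
    refine (hU i j N h).trans ?_
    have h3 := norm_group_le (U - U₀) i j
    rw [group_sub] at h3
    calc _ ≤ |C i j| * ‖group U i j - group U₀ i j‖ ^ 2 := by gcongr; exact le_abs_self _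
      _ ≤ _ := by gcongr

theorem proxReg_trapezoidal (h1 : 0 < lam1) (h2 : 0 < lam2) (U₀ : ZSpace K p) :
    ∃ C, ∀ᶠ U in 𝓝 U₀,
      inner ℝ (proxReg lam1 lam2 U + proxReg lam1 lam2 U₀)
        ((U - U₀) - (proxReg lam1 lam2 U - proxReg lam1 lam2 U₀)) ≤ C * ‖U - U₀‖ ^ 3 := by
  choose C hC using fun i j => proxGroup_trapezoidal (K := K) h1 h2 (group U₀ i j)
  refine ⟨∑ i, ∑ j, |C i j|, ?_⟩
  have hev : ∀ᶠ U in 𝓝 U₀, ∀ i j : Fin p,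
      inner ℝ (proxGroup lam1 lam2 (group U i j) + proxGroup lam1 lam2 (group U₀ i j))
        ((group U i j - group U₀ i j) - (proxGroup lam1 lam2 (group U i j) -
          proxGroup lam1 lam2 (group U₀ i j))) ≤ C i j * ‖group U i j - group U₀ i j‖ ^ 3 := by
    rw [eventually_all]; intro i
    rw [eventually_all]; intro j
    exact ((continuous_group i j).tendsto U₀).eventually (hC i j)
  filter_upwards [hev] with U hU
  rw [inner_eq_sum_group]
  simp only [Finset.sum_mul]
  refine Finset.sum_le_sum fun i _ => Finset.sum_le_sum fun j _ => ?_
  simp only [group_sub, group_add, group_proxReg]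
  split_ifs
  · rw [sub_self, inner_zero_right]
    positivity
  · refine (hU i j).trans ?_
    have h3 := norm_group_le (U - U₀) i j
    rw [group_sub] at h3
    calc _ ≤ |C i j| * ‖group U i j - group U₀ i j‖ ^ 3 := by gcongr; exact le_abs_self _
      _ ≤ _ := by gcongr

end Regularizer

/-! ### The trapezoidal rule -/

section Trapezoidal

variable {E : Type*} [NormedAddCommGroup E] [InnerProductSpace ℝ E] [CompleteSpace E]

/-- If the gradient has a homogeneous first-order expansion with quadratic remainder, the
trapezoidal rule is exact to third order. -/
theorem trapezoidal_of_hasGradientAt {F : E → ℝ} {Z : E → E} (hF : ∀ X, HasGradientAt F (Z X) X)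
    {X₀ : E} {T : E → E} (hT : ∀ (t : ℝ) H, T (t • H) = t • T H) {C : ℝ}
    (hZ : ∀ X, ‖Z X - Z X₀ - T (X - X₀)‖ ≤ C * ‖X - X₀‖ ^ 2) (X : E) :
    F X ≤ F X₀ + 1 / 2 * inner ℝ (Z X + Z X₀) (X - X₀) + C * ‖X - X₀‖ ^ 3 := by
  set h := X - X₀ with hh
  set g : ℝ → ℝ := fun t => F (X₀ + t • h) - (t * inner ℝ (Z X₀) h + t ^ 2 / 2 * inner ℝ (T h) h +
    t ^ 3 / 3 * (C * ‖h‖ ^ 3)) with hg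
  have hd : ∀ t : ℝ, HasDerivAt g (inner ℝ (Z (X₀ + t • h)) h - (inner ℝ (Z X₀) h +
      t * inner ℝ (T h) h + t ^ 2 * (C * ‖h‖ ^ 3))) t := by
    intro t
    have hl : HasDerivAt (fun t : ℝ => X₀ + t • h) h t := by
      simpa using ((hasDerivAt_id t).smul_const h).const_add X₀
    have h1 := (hF (X₀ + t • h)).hasFDerivAt.comp_hasDerivAt t hl
    have h2 := (((hasDerivAt_id t).mul_const (inner ℝ (Z X₀) h)).add
      (((hasDerivAt_id t).pow 2).div_const 2 |>.mul_const (inner ℝ (T h) h))).add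
      (((hasDerivAt_id t).pow 3).div_const 3 |>.mul_const (C * ‖h‖ ^ 3))
    have h3 : HasDerivAt g _ t := h1.sub h2
    refine h3.congr_deriv ?_
    simp only [InnerProductSpace.toDual_apply_apply, id]
    push_cast
    ring
  have hanti : AntitoneOn g (Icc 0 1) := by
    refine antitoneOn_of_hasDerivWithinAt_nonpos (convex_Icc 0 1)
      (fun t _ => (hd t).continuousAt.continuousWithinAt) (fun t _ => (hd t).hasDerivWithinAt) ?_
    intro t ht
    rw [interior_Icc] at ht
    have h1 := hZ (X₀ + t • h)
    rw [add_sub_cancel_left, hT, norm_smul, Real.norm_of_nonneg ht.1.le] at h1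
    have h2 : inner ℝ (Z (X₀ + t • h) - Z X₀ - t • T h) h ≤ C * (t * ‖h‖) ^ 2 * ‖h‖ :=
      (real_inner_le_norm _ _).trans (mul_le_mul_of_nonneg_right h1 (norm_nonneg _))
    rw [inner_sub_left, inner_sub_left, inner_smul_left] at h2
    simp only [conj_trivial] at h2
    linarith
  have h01 := hanti (left_mem_Icc.2 zero_le_one) (right_mem_Icc.2 zero_le_one) zero_le_one
  have hX : X₀ + h = X := by rw [hh]; abel
  simp only [hg, one_smul, zero_smul, add_zero, hX] at h01
  have h1 : -(C * ‖h‖ ^ 2 * ‖h‖) ≤ inner ℝ (Z X - Z X₀ - T h) h :=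
    neg_le_of_neg_le ((neg_le_abs _).trans ((abs_real_inner_le_norm _ _).trans
      (mul_le_mul_of_nonneg_right (hZ X) (norm_nonneg _))))
  rw [inner_sub_left, inner_sub_left] at h1
  rw [inner_add_left]
  have h2 : 0 ≤ C * ‖h‖ ^ 3 := by
    have : C * ‖h‖ ^ 3 = C * ‖h‖ ^ 2 * ‖h‖ := by ring
    rw [this]
    exact mul_nonneg ((norm_nonneg _).trans (hZ X)) (norm_nonneg _)
  nlinarith

end Trapezoidal

/-! ### The dual objective, its gradient and its generalized Jacobian -/

section Dual

variable {K p : ℕ} {lam1 lam2 σ : ℝ}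

theorem zspace_inner_smul_left (c : ℝ) (X Y : ZSpace K p) :
    inner ℝ (c • X) Y = c * inner ℝ X Y := real_inner_smul_left X Y c

theorem zspace_inner_smul_right (c : ℝ) (X Y : ZSpace K p) :
    inner ℝ X (c • Y) = c * inner ℝ X Y := real_inner_smul_right X Y c

theorem zspace_norm_sq_eq (X : ZSpace K p) : ‖X‖ ^ 2 = ∑ k, ‖X k‖ ^ 2 :=
  PiLp.norm_sq_eq_of_L2 _ _

theorem zspace_norm_le_sum (X : ZSpace K p) : ‖X‖ ≤ ∑ k, ‖X k‖ := by
  refine le_of_sq_le_sq ?_ (Finset.sum_nonneg fun _ _ => norm_nonneg _)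
  rw [zspace_norm_sq_eq]
  exact Finset.sum_sq_le_sq_sum_of_nonneg fun _ _ => norm_nonneg _

theorem zspace_norm_apply_le (X : ZSpace K p) (k : Fin K) : ‖X k‖ ≤ ‖X‖ := PiLp.norm_apply_le X k

/-- The argument `Ωt - σ (S + X)` of `φ⁺` in the dual problem. -/
noncomputable def omegaArg (σ : ℝ) (S Ωt X : ZSpace K p) (k : Fin K) : SymMat p :=
  Ωt k - σ • (S k + X k)

theorem omegaArg_sub (S Ωt X Y : ZSpace K p) (k : Fin K) :
    omegaArg σ S Ωt X k - omegaArg σ S Ωt Y k = -(σ • (X - Y) k) := by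
  rw [omegaArg, omegaArg, PiLp.sub_apply]
  module

/-- The minimizer in `Ω` of the Lagrangian. -/
noncomputable def omegaOpt (σ : ℝ) (S Ωt X : ZSpace K p) : ZSpace K p :=
  WithLp.toLp 2 fun k => phiPlus σ (omegaArg σ S Ωt X k)

theorem omegaOpt_apply (S Ωt X : ZSpace K p) (k : Fin K) :
    omegaOpt σ S Ωt X k = phiPlus σ (omegaArg σ S Ωt X k) := rfl

/-- The argument `(Θt + σ X) / σ` of the proximal mapping in the dual problem. -/
noncomputable def thetaArg (σ : ℝ) (Θt X : ZSpace K p) : ZSpace K p := σ⁻¹ • (Θt + σ • X)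

theorem thetaArg_sub (hσ : 0 < σ) (Θt X Y : ZSpace K p) :
    thetaArg σ Θt X - thetaArg σ Θt Y = X - Y := by
  rw [thetaArg, thetaArg, ← smul_sub, add_sub_add_left_eq_sub, ← smul_sub, smul_smul,
    inv_mul_cancel₀ hσ.ne', one_smul]

/-- The proximal point that determines the minimizer `σ • thetaProx` in `Θ` of the Lagrangian. -/
noncomputable def thetaProx (lam1 lam2 σ : ℝ) (Θt X : ZSpace K p) : ZSpace K p :=
  proxReg lam1 lam2 (thetaArg σ Θt X)

/-- The part of the Lagrangian that depends on `Ω`. -/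
noncomputable def omegaLag (σ : ℝ) (S Ωt Ω X : ZSpace K p) : ℝ :=
  logDetLoss S Ω + inner ℝ Ω X + 1 / (2 * σ) * ‖Ω - Ωt‖ ^ 2

/-- The part of the Lagrangian that depends on `Θ`. -/
noncomputable def thetaLag (lam1 lam2 σ : ℝ) (Θt Θ X : ZSpace K p) : ℝ :=
  regularizer lam1 lam2 Θ - inner ℝ Θ X + 1 / (2 * σ) * ‖Θ - Θt‖ ^ 2

theorem lagrangian_eq (S Ωt Θt Ω Θ X : ZSpace K p) : lagrangian lam1 lam2 σ S Ωt Θt Ω Θ X =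
    omegaLag σ S Ωt Ω X + thetaLag lam1 lam2 σ Θt Θ X := by
  rw [lagrangian, omegaLag, thetaLag, inner_sub_left]
  ring

theorem omegaOpt_mem (hσ : 0 < σ) (S Ωt X : ZSpace K p) :
    omegaOpt σ S Ωt X ∈ posDefTuples K p := fun _ => posDef_phiPlus hσ _

/-- The subgradient inequality for the log-determinant loss. -/
theorem logDetLoss_le {S Ω Ω' : ZSpace K p} (h : Ω ∈ posDefTuples K p)
    (h' : Ω' ∈ posDefTuples K p) :
    logDetLoss S Ω + ∑ k, inner ℝ (S k - (Ω k).inv) (Ω' k - Ω k) ≤ logDetLoss S Ω' := by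
  rw [logDetLoss, logDetLoss, ← Finset.sum_add_distrib]
  refine Finset.sum_le_sum fun k _ => ?_
  have := SymMat.log_det_sub_le (h k) (h' k)
  rw [inner_sub_left, inner_sub_right (S k)]
  linarith

theorem omegaLag_le (hσ : 0 < σ) (S Ωt X : ZSpace K p) {Ω : ZSpace K p}
    (hΩ : Ω ∈ posDefTuples K p) :
    omegaLag σ S Ωt (omegaOpt σ S Ωt X) X ≤ omegaLag σ S Ωt Ω X := by
  have h1 := logDetLoss_le (S := S) (omegaOpt_mem hσ S Ωt X) hΩ
  set W := omegaOpt σ S Ωt X with hW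
  have e1 : ∑ k, inner ℝ (S k - (W k).inv) (Ω k - W k) =
      -(1 / σ * inner ℝ (W - Ωt) (Ω - W)) - inner ℝ X (Ω - W) := by
    simp only [zspace_inner_eq, Finset.mul_sum, PiLp.sub_apply]
    rw [← Finset.sum_neg_distrib, ← Finset.sum_sub_distrib]
    refine Finset.sum_congr rfl fun k _ => ?_
    have h2 := smul_inv_phiPlus hσ (omegaArg σ S Ωt X k)
    rw [← omegaOpt_apply, ← hW] at h2
    have h3 : (W k).inv = (1 / σ) • (W k - Ωt k) + (S k + X k) := by
      rw [one_div, ← inv_smul_smul₀ hσ.ne' (W k).inv, h2, omegaArg,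
        ← inv_smul_smul₀ hσ.ne' (S k + X k), ← smul_add]
      congr 1
      rw [smul_inv_smul₀ hσ.ne']
      abel
    have h4 : S k - (W k).inv = -((1 / σ) • (W k - Ωt k)) - X k := by rw [h3]; abel
    rw [h4, inner_sub_left, inner_neg_left, SymMat.inner_smul_left']
  have e2 : ‖Ω - Ωt‖ ^ 2 = ‖W - Ωt‖ ^ 2 + 2 * inner ℝ (W - Ωt) (Ω - W) + ‖Ω - W‖ ^ 2 := by
    have : Ω - Ωt = (W - Ωt) + (Ω - W) := by abel
    rw [this, norm_add_sq_real]
  have e3 : inner ℝ X (Ω - W) = inner ℝ Ω X - inner ℝ W X := by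
    rw [real_inner_comm, inner_sub_left]
  have e4 : 1 / (2 * σ) * (2 * inner ℝ (W - Ωt) (Ω - W)) = 1 / σ * inner ℝ (W - Ωt) (Ω - W) := by
    field_simp
  have e5 : 0 ≤ 1 / (2 * σ) * ‖Ω - W‖ ^ 2 := by positivity
  rw [omegaLag, omegaLag, e2, mul_add, mul_add, e4]
  rw [e1, e3] at h1
  linarith

/-- Completing the square in the `Θ`-part of the Lagrangian. -/
theorem thetaLag_eq (hσ : 0 < σ) (Θt Θ X : ZSpace K p) : thetaLag lam1 lam2 σ Θt Θ X =
    regularizer lam1 lam2 Θ - inner ℝ (thetaArg σ Θt X) Θ + 1 / (2 * σ) * ‖Θ‖ ^ 2 +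
      1 / (2 * σ) * ‖Θt‖ ^ 2 := by
  have e : inner ℝ (thetaArg σ Θt X) Θ = σ⁻¹ * inner ℝ Θ Θt + inner ℝ Θ X := by
    rw [thetaArg, smul_add, smul_smul, inv_mul_cancel₀ hσ.ne', one_smul, inner_add_left,
      inner_smul_left, real_inner_comm, real_inner_comm Θ X]
    simp
  rw [thetaLag, e, norm_sub_sq_real]
  field_simp
  ring

/-- The minimum over `Θ`; by homogeneity of the regularizer it is explicit in the proximal point. -/
theorem thetaLag_opt (hσ : 0 < σ) (h1 : 0 < lam1) (h2 : 0 < lam2) (Θt X : ZSpace K p) :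
    thetaLag lam1 lam2 σ Θt (σ • thetaProx lam1 lam2 σ Θt X) X =
      -(σ / 2) * ‖thetaProx lam1 lam2 σ Θt X‖ ^ 2 + 1 / (2 * σ) * ‖Θt‖ ^ 2 := by
  have a := inner_sub_proxReg_self h1 h2 (thetaArg σ Θt X)
  rw [inner_sub_left, real_inner_self_eq_norm_sq] at a
  rw [thetaLag_eq hσ, regularizer_smul hσ.le, thetaProx, ← a, zspace_inner_smul_right, norm_smul,
    Real.norm_of_nonneg hσ.le]
  field_simp
  ring

theorem thetaLag_le (hσ : 0 < σ) (h1 : 0 < lam1) (h2 : 0 < lam2) (Θt X Θ : ZSpace K p) :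
    thetaLag lam1 lam2 σ Θt (σ • thetaProx lam1 lam2 σ Θt X) X ≤
      thetaLag lam1 lam2 σ Θt Θ X := by
  have a := inner_sub_proxReg_le h1 h2 (thetaArg σ Θt X) Θ
  rw [inner_sub_left] at a
  rw [thetaLag_opt hσ h1 h2, thetaLag_eq hσ]
  change _ - inner ℝ (thetaProx lam1 lam2 σ Θt X) Θ ≤ _ at a
  set y := thetaProx lam1 lam2 σ Θt X
  have b : 0 ≤ 1 / (2 * σ) * ‖Θ - σ • y‖ ^ 2 := by positivity
  rw [norm_sub_sq_real, zspace_inner_smul_right, norm_smul, Real.norm_of_nonneg hσ.le, mul_pow,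
    real_inner_comm] at b
  have c : 1 / (2 * σ) * (‖Θ‖ ^ 2 - 2 * (σ * inner ℝ y Θ) + σ ^ 2 * ‖y‖ ^ 2) =
      1 / (2 * σ) * ‖Θ‖ ^ 2 - inner ℝ y Θ + σ / 2 * ‖y‖ ^ 2 := by
    field_simp
  rw [c] at b
  linarith

/-- The `Ω`-part of the dual objective. -/
noncomputable def dualOmega (σ : ℝ) (S Ωt X : ZSpace K p) : ℝ :=
  omegaLag σ S Ωt (omegaOpt σ S Ωt X) X

/-- The `Θ`-part of the dual objective. -/
noncomputable def dualTheta (lam1 lam2 σ : ℝ) (Θt X : ZSpace K p) : ℝ :=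
  thetaLag lam1 lam2 σ Θt (σ • thetaProx lam1 lam2 σ Θt X) X

/-- The infimum in the dual objective is attained, and splits. -/
theorem dualObj_eq (hσ : 0 < σ) (h1 : 0 < lam1) (h2 : 0 < lam2) (S Ωt Θt X : ZSpace K p) :
    dualObj lam1 lam2 σ S Ωt Θt X = dualOmega σ S Ωt X + dualTheta lam1 lam2 σ Θt X := by
  refine IsLeast.csInf_eq ⟨⟨_, _, omegaOpt_mem hσ S Ωt X, (lagrangian_eq _ _ _ _ _ _).symm⟩, ?_⟩
  rintro _ ⟨Ω, Θ, hΩ, rfl⟩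
  rw [lagrangian_eq]
  exact add_le_add (omegaLag_le hσ S Ωt X hΩ) (thetaLag_le hσ h1 h2 Θt X Θ)

theorem dualOmega_le (hσ : 0 < σ) (S Ωt X Y : ZSpace K p) :
    dualOmega σ S Ωt Y ≤ dualOmega σ S Ωt X + inner ℝ (omegaOpt σ S Ωt X) (Y - X) := by
  refine (omegaLag_le hσ S Ωt Y (omegaOpt_mem hσ S Ωt X)).trans ?_
  rw [dualOmega, omegaLag, omegaLag, inner_sub_right]
  linarith

theorem dualTheta_le (hσ : 0 < σ) (h1 : 0 < lam1) (h2 : 0 < lam2) (Θt X Y : ZSpace K p) :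
    dualTheta lam1 lam2 σ Θt Y ≤ dualTheta lam1 lam2 σ Θt X +
      inner ℝ (-(σ • thetaProx lam1 lam2 σ Θt X)) (Y - X) := by
  refine (thetaLag_le hσ h1 h2 Θt Y (σ • thetaProx lam1 lam2 σ Θt X)).trans ?_
  rw [dualTheta, thetaLag, thetaLag, inner_neg_left, inner_sub_right]
  linarith

theorem omegaOpt_monotone (hσ : 0 < σ) (S Ωt X Y : ZSpace K p) :
    ‖omegaOpt σ S Ωt X - omegaOpt σ S Ωt Y‖ ^ 2 ≤
      -(σ * inner ℝ (omegaOpt σ S Ωt X - omegaOpt σ S Ωt Y) (X - Y)) := by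
  rw [zspace_norm_sq_eq, zspace_inner_eq, Finset.mul_sum, ← Finset.sum_neg_distrib]
  refine Finset.sum_le_sum fun k _ => ?_
  have h := norm_phiPlus_sub_sq_le hσ (omegaArg σ S Ωt X k) (omegaArg σ S Ωt Y k)
  rw [omegaArg_sub, inner_neg_right, SymMat.inner_smul_right'] at h
  exact h

theorem norm_omegaOpt_sub_le (hσ : 0 < σ) (S Ωt X Y : ZSpace K p) :
    ‖omegaOpt σ S Ωt X - omegaOpt σ S Ωt Y‖ ≤ σ * ‖X - Y‖ := by
  refine le_of_sq_le_sq ?_ (by positivity)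
  rw [mul_pow, zspace_norm_sq_eq, zspace_norm_sq_eq (X - Y), Finset.mul_sum]
  refine Finset.sum_le_sum fun k _ => ?_
  have h := norm_phiPlus_sub_le hσ (omegaArg σ S Ωt X k) (omegaArg σ S Ωt Y k)
  rw [omegaArg_sub, norm_neg, norm_smul, Real.norm_of_nonneg hσ.le] at h
  rw [← mul_pow]
  exact pow_le_pow_left₀ (norm_nonneg _) h 2

theorem thetaProx_monotone (hσ : 0 < σ) (h1 : 0 < lam1) (h2 : 0 < lam2) (Θt X Y : ZSpace K p) :
    ‖thetaProx lam1 lam2 σ Θt X - thetaProx lam1 lam2 σ Θt Y‖ ^ 2 ≤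
      inner ℝ (thetaProx lam1 lam2 σ Θt X - thetaProx lam1 lam2 σ Θt Y) (X - Y) := by
  have h := norm_proxReg_sub_sq_le h1 h2 (thetaArg σ Θt X) (thetaArg σ Θt Y)
  rwa [thetaArg_sub hσ] at h

theorem norm_thetaProx_sub_le (hσ : 0 < σ) (h1 : 0 < lam1) (h2 : 0 < lam2) (Θt X Y : ZSpace K p) :
    ‖thetaProx lam1 lam2 σ Θt X - thetaProx lam1 lam2 σ Θt Y‖ ≤ ‖X - Y‖ := by
  have h := thetaProx_monotone hσ h1 h2 Θt X Y
  have h' := real_inner_le_norm (thetaProx lam1 lam2 σ Θt X - thetaProx lam1 lam2 σ Θt Y) (X - Y)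
  rcases eq_or_lt_of_le
    (norm_nonneg (thetaProx lam1 lam2 σ Θt X - thetaProx lam1 lam2 σ Θt Y)) with h0 | h0
  · rw [← h0]; exact norm_nonneg _
  · nlinarith

/-- The gradient of the dual objective: the primal residual `Ω - Θ` of the minimizers. -/
noncomputable def dualGrad (lam1 lam2 σ : ℝ) (S Ωt Θt X : ZSpace K p) : ZSpace K p :=
  omegaOpt σ S Ωt X - σ • thetaProx lam1 lam2 σ Θt X

theorem dualObj_le (hσ : 0 < σ) (h1 : 0 < lam1) (h2 : 0 < lam2) (S Ωt Θt X Y : ZSpace K p) :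
    dualObj lam1 lam2 σ S Ωt Θt Y ≤ dualObj lam1 lam2 σ S Ωt Θt X +
      inner ℝ (dualGrad lam1 lam2 σ S Ωt Θt X) (Y - X) := by
  have a := dualOmega_le hσ S Ωt X Y
  have b := dualTheta_le hσ h1 h2 Θt X Y
  rw [dualObj_eq hσ h1 h2, dualObj_eq hσ h1 h2, dualGrad, sub_eq_add_neg, inner_add_left]
  linarith

theorem norm_dualGrad_sub_le (hσ : 0 < σ) (h1 : 0 < lam1) (h2 : 0 < lam2)
    (S Ωt Θt X Y : ZSpace K p) :
    ‖dualGrad lam1 lam2 σ S Ωt Θt X - dualGrad lam1 lam2 σ S Ωt Θt Y‖ ≤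
      2 * σ * ‖X - Y‖ := by
  have a := norm_omegaOpt_sub_le hσ S Ωt X Y
  have b := mul_le_mul_of_nonneg_left (norm_thetaProx_sub_le hσ h1 h2 Θt X Y) hσ.le
  have e : dualGrad lam1 lam2 σ S Ωt Θt X - dualGrad lam1 lam2 σ S Ωt Θt Y =
      (omegaOpt σ S Ωt X - omegaOpt σ S Ωt Y) -
        σ • (thetaProx lam1 lam2 σ Θt X - thetaProx lam1 lam2 σ Θt Y) := by
    rw [dualGrad, dualGrad]; module
  rw [e]
  refine (norm_sub_le _ _).trans ?_
  rw [norm_smul, Real.norm_of_nonneg hσ.le]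
  linarith

theorem hasGradientAt_dualObj (hσ : 0 < σ) (h1 : 0 < lam1) (h2 : 0 < lam2)
    (S Ωt Θt X : ZSpace K p) :
    HasGradientAt (dualObj lam1 lam2 σ S Ωt Θt) (dualGrad lam1 lam2 σ S Ωt Θt X) X :=
  hasGradientAt_of_supergradient (dualObj_le hσ h1 h2 S Ωt Θt)
    (norm_dualGrad_sub_le hσ h1 h2 S Ωt Θt) X

/-- The gradient is injective: `φ⁺` is, and both parts of the gradient are monotone. -/
theorem dualGrad_injective (hσ : 0 < σ) (h1 : 0 < lam1) (h2 : 0 < lam2) (S Ωt Θt : ZSpace K p) :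
    Function.Injective (dualGrad lam1 lam2 σ S Ωt Θt) := by
  intro X Y h
  have a := omegaOpt_monotone hσ S Ωt X Y
  have b := thetaProx_monotone hσ h1 h2 Θt X Y
  have e : omegaOpt σ S Ωt X - omegaOpt σ S Ωt Y =
      σ • (thetaProx lam1 lam2 σ Θt X - thetaProx lam1 lam2 σ Θt Y) := by
    rw [dualGrad, dualGrad, sub_eq_sub_iff_add_eq_add] at h
    rw [smul_sub, sub_eq_sub_iff_add_eq_add, h]
    abel
  rw [e, zspace_inner_smul_left] at a
  have c : 0 ≤ σ * (σ * inner ℝ (thetaProx lam1 lam2 σ Θt X - thetaProx lam1 lam2 σ Θt Y)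
      (X - Y)) := by
    have := (sq_nonneg _).trans b
    positivity
  rw [← e] at a
  have d : omegaOpt σ S Ωt X - omegaOpt σ S Ωt Y = 0 :=
    norm_eq_zero.1 (pow_eq_zero_iff two_ne_zero |>.1 (le_antisymm (by linarith) (sq_nonneg _)))
  ext1 k
  have f : omegaArg σ S Ωt X k = omegaArg σ S Ωt Y k := by
    apply phiPlus_injective hσ
    rw [← omegaOpt_apply, ← omegaOpt_apply, sub_eq_zero.1 d]
  rw [← sub_eq_zero, omegaArg_sub, neg_eq_zero, smul_eq_zero] at f
  exact sub_eq_zero.1 (f.resolve_left hσ.ne')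

theorem norm_omegaArg_le (hσ : 0 < σ) (S Ωt X : ZSpace K p) (k : Fin K) :
    ‖omegaArg σ S Ωt X k‖ ≤ ‖Ωt‖ + σ * (‖S‖ + ‖X‖) := by
  rw [omegaArg]
  refine (norm_sub_le _ _).trans (add_le_add (zspace_norm_apply_le _ _) ?_)
  rw [norm_smul, Real.norm_of_nonneg hσ.le]
  exact mul_le_mul_of_nonneg_left ((norm_add_le _ _).trans
    (add_le_add (zspace_norm_apply_le _ _) (zspace_norm_apply_le _ _))) hσ.le

/-- The blockwise derivative `D ↦ ((φ⁺)'(Ωt - σ (S + X)) D⁽ᵏ⁾)ₖ`. -/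
noncomputable def phiBlock (σ : ℝ) (S Ωt X D : ZSpace K p) : ZSpace K p :=
  WithLp.toLp 2 fun k => fderiv ℝ (phiPlus σ) (omegaArg σ S Ωt X k) (D k)

theorem phiBlock_apply (S Ωt X D : ZSpace K p) (k : Fin K) :
    phiBlock σ S Ωt X D k = fderiv ℝ (phiPlus σ) (omegaArg σ S Ωt X k) (D k) := rfl

/-- The first-order expansion of `omegaOpt` between two points with the derivative taken at the
first, with a remainder that is uniform for base points in a bounded set. -/
theorem omegaOpt_expansion (hσ : 0 < σ) (S Ωt : ZSpace K p) (R : ℝ) :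
    ∃ C, ∀ X, ‖X‖ ≤ R → ∀ Y,
      ‖omegaOpt σ S Ωt Y - omegaOpt σ S Ωt X + σ • phiBlock σ S Ωt X (Y - X)‖ ≤
        C * ‖Y - X‖ ^ 2 := by
  set N := (‖phiPlus σ (0 : SymMat p)‖ + 2 * (‖Ωt‖ + σ * (‖S‖ + R))) / σ with hN
  refine ⟨∑ _k : Fin K, 2 * N * σ ^ 2, fun X hX Y => (zspace_norm_le_sum _).trans ?_⟩
  rw [Finset.sum_mul]
  refine Finset.sum_le_sum fun k _ => ?_
  have h := (fderiv_phiPlus_spec hσ (omegaArg σ S Ωt X k)).2 (omegaArg σ S Ωt Y k)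
  have e : (omegaOpt σ S Ωt Y - omegaOpt σ S Ωt X + σ • phiBlock σ S Ωt X (Y - X)) k =
      phiPlus σ (omegaArg σ S Ωt Y k) - phiPlus σ (omegaArg σ S Ωt X k) -
        fderiv ℝ (phiPlus σ) (omegaArg σ S Ωt X k)
          (omegaArg σ S Ωt Y k - omegaArg σ S Ωt X k) := by
    rw [omegaArg_sub, map_neg, map_smul, sub_neg_eq_add]
    rfl
  rw [e]
  refine h.trans ?_
  rw [omegaArg_sub, norm_neg, norm_smul, Real.norm_of_nonneg hσ.le, mul_pow, ← mul_assoc]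
  have h3 : ‖(phiPlus σ (omegaArg σ S Ωt X k)).inv‖ ≤ N := by
    refine (norm_inv_phiPlus_le hσ _).trans ?_
    rw [hN]
    have := norm_omegaArg_le hσ S Ωt X k
    have : σ * ‖X‖ ≤ σ * R := mul_le_mul_of_nonneg_left hX hσ.le
    gcongr
    linarith
  have h4 := zspace_norm_apply_le (Y - X) k
  have h5 : 0 ≤ N := (norm_nonneg _).trans h3
  gcongr

theorem jacGradDual_spec {S Ωt Θt X : ZSpace K p} {V : ZSpace K p →L[ℝ] ZSpace K p}
    (hV : V ∈ jacGradDual lam1 lam2 σ S Ωt Θt X) :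
    ∃ W ∈ jacProxReg lam1 lam2 (thetaArg σ Θt X),
      ∀ D, V D = -(σ • phiBlock σ S Ωt X D) - σ • W D := by
  obtain ⟨W, hW, h⟩ := hV
  refine ⟨W, hW, fun D => ?_⟩
  ext1 k
  exact h D k

theorem jacGradDual_comm (hσ : 0 < σ) (h1 : 0 < lam1) (h2 : 0 < lam2) {S Ωt Θt X : ZSpace K p}
    {V : ZSpace K p →L[ℝ] ZSpace K p} (hV : V ∈ jacGradDual lam1 lam2 σ S Ωt Θt X)
    (D D' : ZSpace K p) : inner ℝ (V D) D' = inner ℝ D (V D') := by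
  obtain ⟨W, hW, h⟩ := jacGradDual_spec hV
  have hΦ : inner ℝ (phiBlock σ S Ωt X D) D' = inner ℝ D (phiBlock σ S Ωt X D') := by
    rw [zspace_inner_eq, zspace_inner_eq]
    exact Finset.sum_congr rfl fun k _ => inner_fderiv_phiPlus_comm hσ _ _ _
  rw [h, h, inner_sub_left, inner_sub_right, inner_neg_left, inner_neg_right,
    zspace_inner_smul_left, zspace_inner_smul_left, zspace_inner_smul_right,
    zspace_inner_smul_right, hΦ, (jacProxReg_props h1 h2 hW).1]

/-- The elements of the generalized Jacobian are uniformly negative definite and bounded on bounded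
sets. -/
theorem jacGradDual_bounds (hσ : 0 < σ) (h1 : 0 < lam1) (h2 : 0 < lam2) (S Ωt Θt : ZSpace K p)
    (R : ℝ) : ∃ c > 0, ∃ C, ∀ X, ‖X‖ ≤ R → ∀ V ∈ jacGradDual lam1 lam2 σ S Ωt Θt X, ∀ D,
      c * ‖D‖ ^ 2 ≤ - inner ℝ (V D) D ∧ ‖V D‖ ≤ C * ‖D‖ := by
  obtain ⟨c, hc, hcA⟩ := exists_le_inner_fderiv_phiPlus (p := p) hσ (‖Ωt‖ + σ * (‖S‖ + R))
  refine ⟨σ * c, by positivity, σ + σ * 2, fun X hX V hV D => ?_⟩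
  obtain ⟨W, hW, h⟩ := jacGradDual_spec hV
  obtain ⟨-, hW0, hW2⟩ := jacProxReg_props h1 h2 hW
  constructor
  · have hΦ : c * ‖D‖ ^ 2 ≤ inner ℝ (phiBlock σ S Ωt X D) D := by
      rw [zspace_inner_eq, zspace_norm_sq_eq, Finset.mul_sum]
      refine Finset.sum_le_sum fun k _ => hcA _ ((norm_omegaArg_le hσ S Ωt X k).trans ?_) _
      gcongr
    have e : - inner ℝ (V D) D = σ * inner ℝ (phiBlock σ S Ωt X D) D + σ * inner ℝ (W D) D := by
      rw [h, inner_sub_left, inner_neg_left, zspace_inner_smul_left, zspace_inner_smul_left]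
      ring
    have a := mul_le_mul_of_nonneg_left hΦ hσ.le
    have b := mul_nonneg hσ.le (hW0 D)
    rw [e]
    linarith
  · have hΦ : ‖phiBlock σ S Ωt X D‖ ≤ ‖D‖ := by
      refine le_of_sq_le_sq ?_ (norm_nonneg _)
      rw [zspace_norm_sq_eq, zspace_norm_sq_eq D]
      exact Finset.sum_le_sum fun k _ =>
        pow_le_pow_left₀ (norm_nonneg _) (norm_fderiv_phiPlus_le hσ _ _) 2
    rw [h]
    refine (norm_sub_le _ _).trans ?_
    rw [norm_neg, norm_smul, norm_smul, Real.norm_of_nonneg hσ.le]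
    have a := mul_le_mul_of_nonneg_left hΦ hσ.le
    have b := mul_le_mul_of_nonneg_left (hW2 D) hσ.le
    linarith

/-- The gradient of the dual objective is strongly semismooth with respect to its generalized
Jacobian. -/
theorem semismooth_dualGrad (hσ : 0 < σ) (h1 : 0 < lam1) (h2 : 0 < lam2)
    (S Ωt Θt X₀ : ZSpace K p) :
    ∃ C, ∀ᶠ X in 𝓝 X₀, ∀ V ∈ jacGradDual lam1 lam2 σ S Ωt Θt X,
      ‖dualGrad lam1 lam2 σ S Ωt Θt X - dualGrad lam1 lam2 σ S Ωt Θt X₀ - V (X - X₀)‖ ≤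
        C * ‖X - X₀‖ ^ 2 := by
  obtain ⟨C1, hC1⟩ := omegaOpt_expansion hσ S Ωt (‖X₀‖ + 1)
  obtain ⟨C2, hC2⟩ := semismooth_proxReg h1 h2 (thetaArg σ Θt X₀)
  have hcont : Continuous (thetaArg σ Θt) := by unfold thetaArg; fun_prop
  refine ⟨C1 + σ * C2, ?_⟩
  filter_upwards [(hcont.tendsto X₀).eventually hC2,
    (continuous_norm.tendsto X₀).eventually (gt_mem_nhds (lt_add_one ‖X₀‖))] with X hX hXR V hV
  obtain ⟨W, hW, h⟩ := jacGradDual_spec hV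
  have a := hC1 X hXR.le X₀
  have b := mul_le_mul_of_nonneg_left (hX W hW) hσ.le
  rw [thetaArg_sub hσ] at b
  have hΦ : phiBlock σ S Ωt X (X₀ - X) = - phiBlock σ S Ωt X (X - X₀) := by
    ext1 k
    rw [PiLp.neg_apply, phiBlock_apply, phiBlock_apply, ← map_neg, ← PiLp.neg_apply, neg_sub]
  have e : dualGrad lam1 lam2 σ S Ωt Θt X - dualGrad lam1 lam2 σ S Ωt Θt X₀ - V (X - X₀) =
      -(omegaOpt σ S Ωt X₀ - omegaOpt σ S Ωt X + σ • phiBlock σ S Ωt X (X₀ - X)) -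
        σ • (proxReg lam1 lam2 (thetaArg σ Θt X) - proxReg lam1 lam2 (thetaArg σ Θt X₀) -
          W (X - X₀)) := by
    rw [h, hΦ, dualGrad, dualGrad, thetaProx, thetaProx]
    module
  rw [e]
  refine (norm_sub_le _ _).trans ?_
  rw [norm_neg, norm_smul, Real.norm_of_nonneg hσ.le]
  rw [norm_sub_rev X₀ X] at a
  linarith

/-- The second-order expansion of the dual objective at a zero of its gradient. -/
theorem dualObj_expansion (hσ : 0 < σ) (h1 : 0 < lam1) (h2 : 0 < lam2)
    (S Ωt Θt : ZSpace K p) {X₀ : ZSpace K p} (hX₀ : dualGrad lam1 lam2 σ S Ωt Θt X₀ = 0) :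
    ∃ C, ∀ᶠ X in 𝓝 X₀, dualObj lam1 lam2 σ S Ωt Θt X ≤ dualObj lam1 lam2 σ S Ωt Θt X₀ +
      1 / 2 * inner ℝ (dualGrad lam1 lam2 σ S Ωt Θt X) (X - X₀) + C * ‖X - X₀‖ ^ 3 := by
  obtain ⟨C1, hC1⟩ := omegaOpt_expansion hσ S Ωt ‖X₀‖
  obtain ⟨C2, hC2⟩ := proxReg_trapezoidal h1 h2 (thetaArg σ Θt X₀)
  have hcont : Continuous (thetaArg σ Θt) := by unfold thetaArg; fun_prop
  refine ⟨C1 + σ / 2 * C2, ?_⟩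
  filter_upwards [(hcont.tendsto X₀).eventually hC2] with X hX
  have a := trapezoidal_of_hasGradientAt (F := dualOmega σ S Ωt) (Z := omegaOpt σ S Ωt)
    (hasGradientAt_of_supergradient (dualOmega_le hσ S Ωt) (norm_omegaOpt_sub_le hσ S Ωt))
    (X₀ := X₀) (T := fun H => -(σ • phiBlock σ S Ωt X₀ H)) (C := C1) (fun t H => ?_)
    (fun Y => ?_) X
  · rw [thetaArg_sub hσ] at hX
    change inner ℝ (thetaProx lam1 lam2 σ Θt X + thetaProx lam1 lam2 σ Θt X₀) ((X - X₀) -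
      (thetaProx lam1 lam2 σ Θt X - thetaProx lam1 lam2 σ Θt X₀)) ≤ _ at hX
    have e1 := thetaLag_opt hσ h1 h2 Θt X
    have e2 := thetaLag_opt hσ h1 h2 Θt X₀
    have e3 : inner ℝ (dualGrad lam1 lam2 σ S Ωt Θt X) (X - X₀) =
        inner ℝ (omegaOpt σ S Ωt X + omegaOpt σ S Ωt X₀) (X - X₀) -
        σ * inner ℝ (thetaProx lam1 lam2 σ Θt X + thetaProx lam1 lam2 σ Θt X₀) (X - X₀) := by
      have : dualGrad lam1 lam2 σ S Ωt Θt X = (omegaOpt σ S Ωt X + omegaOpt σ S Ωt X₀) -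
          σ • (thetaProx lam1 lam2 σ Θt X + thetaProx lam1 lam2 σ Θt X₀) := by
        rw [← add_zero (dualGrad lam1 lam2 σ S Ωt Θt X), ← hX₀, dualGrad, dualGrad]
        module
      rw [this, inner_sub_left, zspace_inner_smul_left]
    rw [dualObj_eq hσ h1 h2, dualObj_eq hσ h1 h2, e3, dualTheta, dualTheta, e1, e2]
    set y := thetaProx lam1 lam2 σ Θt X
    set y₀ := thetaProx lam1 lam2 σ Θt X₀
    have e4 : inner ℝ (y + y₀) ((X - X₀) - (y - y₀)) =
        inner ℝ (y + y₀) (X - X₀) - (‖y‖ ^ 2 - ‖y₀‖ ^ 2) := by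
      rw [inner_sub_right (y + y₀) (X - X₀), inner_sub_right (y + y₀) y, inner_add_left y y₀ y,
        inner_add_left y y₀ y₀, real_inner_self_eq_norm_sq, real_inner_self_eq_norm_sq,
        real_inner_comm y y₀]
      ring
    rw [e4] at hX
    have b := mul_le_mul_of_nonneg_left hX (show 0 ≤ σ / 2 by positivity)
    nlinarith
  · ext1 k
    change -(σ • fderiv ℝ (phiPlus σ) _ (t • H k)) = t • -(σ • fderiv ℝ (phiPlus σ) _ (H k))
    rw [map_smul]
    module
  · rw [sub_neg_eq_add]
    exact hC1 X₀ le_rfl Y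

end Dual

/-! ### Existence and uniqueness of the dual solution -/

section Existence

variable {K p : ℕ} {lam1 lam2 σ : ℝ}

/-- Evaluating the Lagrangian at `Ω = φ⁺(-X / ‖X‖)` and `Θ = φ⁺(0)` bounds the dual objective by an
affine function of `‖X‖` with negative slope. -/
theorem exists_dualObj_le (hσ : 0 < σ) (h1 : 0 < lam1) (h2 : 0 < lam2) (S Ωt Θt : ZSpace K p) :
    ∃ c > 0, ∃ C, ∀ X, dualObj lam1 lam2 σ S Ωt Θt X ≤ C - c * ‖X‖ := by
  set Ω₀ : ZSpace K p := WithLp.toLp 2 fun _ => phiPlus σ 0 with hΩ₀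
  have hΩ₀m : Ω₀ ∈ posDefTuples K p := fun _ => posDef_phiPlus hσ _
  set N := (‖phiPlus σ (0 : SymMat p)‖ + 2) / σ with hN
  set d := 1 + σ * (N * N) with hd
  have hd0 : 0 < d := by positivity
  refine ⟨(d ^ 2)⁻¹, by positivity, logDetLoss S Ω₀ + (∑ _k : Fin K, (‖S‖ + N) * 1) +
    regularizer lam1 lam2 Ω₀ + 1 / (2 * σ) * (1 + ‖Ω₀ - Ωt‖) ^ 2 +
      1 / (2 * σ) * ‖Ω₀ - Θt‖ ^ 2, fun X => ?_⟩
  set B : ZSpace K p := -(‖X‖⁻¹ • X) with hB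
  have hB1 : ‖B‖ ≤ 1 := by
    rw [hB, norm_neg, norm_smul, norm_inv, norm_norm]
    exact inv_mul_le_one
  have hBk : ∀ k, ‖B k‖ ≤ 1 := fun k => (zspace_norm_apply_le B k).trans hB1
  set Ω : ZSpace K p := WithLp.toLp 2 fun k => phiPlus σ (B k) with hΩ
  have hΩm : Ω ∈ posDefTuples K p := fun _ => posDef_phiPlus hσ _
  have hlip : ∀ k, ‖Ω k - Ω₀ k‖ ≤ ‖B k‖ := fun k => by
    simpa using norm_phiPlus_sub_le hσ (B k) 0
  have hinv : ∀ k, ‖(Ω k).inv‖ ≤ N := fun k => by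
    refine (norm_inv_phiPlus_le hσ (B k)).trans ?_
    rw [hN]
    have := hBk k
    gcongr
    linarith
  have hinv₀ : ∀ k, ‖(Ω₀ k).inv‖ ≤ N := fun k => by
    refine (norm_inv_phiPlus_le hσ (0 : SymMat p)).trans ?_
    rw [hN]
    gcongr
    simp
  have hlog : logDetLoss S Ω ≤ logDetLoss S Ω₀ + ∑ _k : Fin K, (‖S‖ + N) * 1 := by
    have a := logDetLoss_le (S := S) hΩm hΩ₀m
    have b : ∑ _k : Fin K, -((‖S‖ + N) * 1) ≤ ∑ k, inner ℝ (S k - (Ω k).inv) (Ω₀ k - Ω k) := by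
      refine Finset.sum_le_sum fun k _ => neg_le_of_neg_le ((neg_le_abs _).trans
        ((abs_real_inner_le_norm _ _).trans ?_))
      refine mul_le_mul ((norm_sub_le _ _).trans
        (add_le_add (zspace_norm_apply_le S k) (hinv k))) ?_ (norm_nonneg _)
        (add_nonneg (norm_nonneg _) ((norm_nonneg _).trans (hinv k)))
      rw [norm_sub_rev]
      exact (hlip k).trans (hBk k)
    rw [Finset.sum_neg_distrib] at b
    linarith
  have hΩΩ₀ : ‖Ω - Ω₀‖ ≤ 1 := by
    refine le_trans (le_of_sq_le_sq ?_ (norm_nonneg B)) hB1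
    rw [zspace_norm_sq_eq, zspace_norm_sq_eq B]
    exact Finset.sum_le_sum fun k _ => pow_le_pow_left₀ (norm_nonneg _) (hlip k) 2
  have hΩt : ‖Ω - Ωt‖ ≤ 1 + ‖Ω₀ - Ωt‖ := by
    refine le_trans (norm_sub_le_norm_sub_add_norm_sub Ω Ω₀ Ωt) ?_
    linarith
  -- The linear term: `φ⁺` is firmly nonexpansive, and its increment is bounded below.
  have hlin : inner ℝ (Ω - Ω₀) X ≤ -((d ^ 2)⁻¹ * ‖X‖) := by
    rcases eq_or_ne X 0 with hX | hX
    · rw [hX, inner_zero_right, norm_zero, mul_zero, neg_zero]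
    · have hX0 : 0 < ‖X‖ := norm_pos_iff.2 hX
      have hBn : ‖B‖ = 1 := by
        rw [hB, norm_neg, norm_smul, norm_inv, norm_norm, inv_mul_cancel₀ hX0.ne']
      have a : ‖Ω - Ω₀‖ ^ 2 ≤ inner ℝ (Ω - Ω₀) B := by
        rw [zspace_norm_sq_eq, zspace_inner_eq]
        refine Finset.sum_le_sum fun k _ => ?_
        simpa using norm_phiPlus_sub_sq_le hσ (B k) 0
      have b : ‖B‖ ^ 2 ≤ d ^ 2 * ‖Ω - Ω₀‖ ^ 2 := by
        rw [zspace_norm_sq_eq, zspace_norm_sq_eq (Ω - Ω₀), Finset.mul_sum]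
        refine Finset.sum_le_sum fun k _ => ?_
        rw [← mul_pow]
        refine pow_le_pow_left₀ (norm_nonneg _) ?_ 2
        have := norm_sub_le_phiPlus hσ (B k) 0
        rw [sub_zero] at this
        refine this.trans (mul_le_mul_of_nonneg_right ?_ (norm_nonneg _))
        rw [hd]
        have h3 := hinv k
        have h4 := hinv₀ k
        have h5 : 0 ≤ N := (norm_nonneg _).trans h3
        gcongr
      have e : X = -(‖X‖ • B) := by
        rw [hB, smul_neg, neg_neg, smul_smul, mul_inv_cancel₀ hX0.ne', one_smul]
      rw [hBn, one_pow, ← inv_le_iff_one_le_mul₀' (by positivity)] at b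
      have f : inner ℝ (Ω - Ω₀) X = -(‖X‖ * inner ℝ (Ω - Ω₀) B) := by
        conv_lhs => rw [e, inner_neg_right, zspace_inner_smul_right]
      rw [f]
      have := mul_le_mul_of_nonneg_left (b.trans a) hX0.le
      linarith
  have hL : dualObj lam1 lam2 σ S Ωt Θt X ≤ lagrangian lam1 lam2 σ S Ωt Θt Ω Ω₀ X := by
    rw [dualObj_eq hσ h1 h2, lagrangian_eq]
    exact add_le_add (omegaLag_le hσ S Ωt X hΩm) (thetaLag_le hσ h1 h2 Θt X Ω₀)
  have hq : 1 / (2 * σ) * ‖Ω - Ωt‖ ^ 2 ≤ 1 / (2 * σ) * (1 + ‖Ω₀ - Ωt‖) ^ 2 := by gcongr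
  rw [lagrangian] at hL
  linarith

theorem dualObj_level_bounded (hσ : 0 < σ) (h1 : 0 < lam1) (h2 : 0 < lam2) (S Ωt Θt : ZSpace K p)
    (a : ℝ) : ∃ R, ∀ X, a ≤ dualObj lam1 lam2 σ S Ωt Θt X → ‖X‖ ≤ R := by
  obtain ⟨c, hc, C, hC⟩ := exists_dualObj_le hσ h1 h2 S Ωt Θt
  refine ⟨(C - a) / c, fun X hX => ?_⟩
  rw [le_div_iff₀' hc]
  linarith [hC X]

theorem exists_dualObj_maximizer (hσ : 0 < σ) (h1 : 0 < lam1) (h2 : 0 < lam2)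
    (S Ωt Θt : ZSpace K p) :
    ∃ Xbar, ∀ Y, dualObj lam1 lam2 σ S Ωt Θt Y ≤ dualObj lam1 lam2 σ S Ωt Θt Xbar := by
  have hcont : Continuous (dualObj lam1 lam2 σ S Ωt Θt) := continuous_iff_continuousAt.2 fun X =>
    (hasGradientAt_dualObj hσ h1 h2 S Ωt Θt X).continuousAt
  obtain ⟨R, hR⟩ := dualObj_level_bounded hσ h1 h2 S Ωt Θt (dualObj lam1 lam2 σ S Ωt Θt 0)
  have h0 : (0 : ZSpace K p) ∈ Metric.closedBall 0 R :=
    mem_closedBall_zero_iff.2 (hR 0 le_rfl)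
  obtain ⟨Xbar, -, hX⟩ := (isCompact_closedBall (0 : ZSpace K p) R).exists_isMaxOn ⟨0, h0⟩
    hcont.continuousOn
  refine ⟨Xbar, fun Y => ?_⟩
  rcases le_total (dualObj lam1 lam2 σ S Ωt Θt 0) (dualObj lam1 lam2 σ S Ωt Θt Y) with h | h
  · exact hX (mem_closedBall_zero_iff.2 (hR Y h))
  · exact h.trans (hX h0)

theorem dualGrad_eq_zero_of_max (hσ : 0 < σ) (h1 : 0 < lam1) (h2 : 0 < lam2)
    {S Ωt Θt X : ZSpace K p}
    (hX : ∀ Y, dualObj lam1 lam2 σ S Ωt Θt Y ≤ dualObj lam1 lam2 σ S Ωt Θt X) :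
    dualGrad lam1 lam2 σ S Ωt Θt X = 0 := by
  have h := (hasGradientAt_dualObj hσ h1 h2 S Ωt Θt X).hasFDerivAt
  have hl : IsLocalMax (dualObj lam1 lam2 σ S Ωt Θt) X := Eventually.of_forall hX
  have := hl.hasFDerivAt_eq_zero h
  exact (InnerProductSpace.toDual ℝ (ZSpace K p)).map_eq_zero_iff.1 this

end Existence

/-- The iterations of the dual semismooth Newton method are Newton steps in the sense of
`IsNewtonStep`. -/
theorem IsDualNewtonSeq.exists_isNewtonStep {K p : ℕ} {lam1 lam2 σ : ℝ} (hσ : 0 < σ)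
    (h1 : 0 < lam1) (h2 : 0 < lam2) {S Ωt Θt : ZSpace K p} {η τ μ ρ : ℝ} {X : ℕ → ZSpace K p}
    (hX : IsDualNewtonSeq lam1 lam2 σ S Ωt Θt η τ μ ρ X) (j : ℕ) :
    ∃ V ∈ jacGradDual lam1 lam2 σ S Ωt Θt (X j), ∃ D m,
      IsNewtonStep (dualObj lam1 lam2 σ S Ωt Θt) (dualGrad lam1 lam2 σ S Ωt Θt) η τ μ ρ V D m
        (X j) (X (j + 1)) := by
  obtain ⟨V, hV, D, m, ⟨n, hD⟩, hres, hm, hnext⟩ := hX.step j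
  rw [(hasGradientAt_dualObj hσ h1 h2 S Ωt Θt (X j)).gradient] at hD hres hm
  refine ⟨V, hV, D, m, ?_, hres, hm, hnext⟩
  obtain ⟨c, hc, C, hcC⟩ := jacGradDual_bounds hσ h1 h2 S Ωt Θt ‖X j‖
  have hcg := inner_cgIterate (A := -V) (dualGrad lam1 lam2 σ S Ωt Θt (X j)) (fun x y => by
      rw [neg_apply, neg_apply, inner_neg_left, inner_neg_right, jacGradDual_comm hσ h1 h2 hV])
    (fun x hx => by
      have a := (hcC (X j) le_rfl V hV x).1
      rw [neg_apply, inner_neg_right, real_inner_comm] at hx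
      rw [hx] at a
      have b : ‖x‖ ^ 2 ≤ 0 := by nlinarith
      exact norm_eq_zero.1 (pow_eq_zero_iff two_ne_zero |>.1 (le_antisymm b (sq_nonneg _)))) n
  rw [← hD, neg_apply, inner_neg_left] at hcg
  exact hcg

end GGL

theorem mainTheorem3 (K p : ℕ) (lam1 lam2 σ : ℝ) (hlam1 : 0 < lam1) (hlam2 : 0 < lam2)
    (hσ : 0 < σ) (S Ωt Θt : GGL.ZSpace K p) :
    ∃ Xbar : GGL.ZSpace K p,
      IsMaxOn (GGL.dualObj lam1 lam2 σ S Ωt Θt) univ Xbar ∧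
      (∀ Y : GGL.ZSpace K p, IsMaxOn (GGL.dualObj lam1 lam2 σ S Ωt Θt) univ Y → Y = Xbar) ∧
      ∀ η τ μ ρ : ℝ, η ∈ Ioo (0 : ℝ) 1 → τ ∈ Ioc (0 : ℝ) 1 → μ ∈ Ioo (0 : ℝ) (1 / 2) →
        ρ ∈ Ioo (0 : ℝ) 1 →
        ∀ X : ℕ → GGL.ZSpace K p,
          GGL.IsDualNewtonSeq lam1 lam2 σ S Ωt Θt η τ μ ρ X →
          Tendsto X atTop (𝓝 Xbar) ∧
          ((fun j => ‖X (j + 1) - Xbar‖) =O[atTop] fun j => ‖X j - Xbar‖ ^ (1 + τ)) ∧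
          ((fun j => ‖X (j + 1) - Xbar‖) =o[atTop] fun j => ‖X j - Xbar‖) ∧
          (τ = 1 → (fun j => ‖X (j + 1) - Xbar‖) =O[atTop] fun j => ‖X j - Xbar‖ ^ 2) := by
  obtain ⟨Xbar, hmax⟩ := GGL.exists_dualObj_maximizer hσ hlam1 hlam2 S Ωt Θt
  have hgrad := GGL.dualGrad_eq_zero_of_max hσ hlam1 hlam2 hmax
  have hzero : ∀ X, GGL.dualGrad lam1 lam2 σ S Ωt Θt X = 0 ↔ X = Xbar := fun X =>
    ⟨fun h => GGL.dualGrad_injective hσ hlam1 hlam2 S Ωt Θt (h.trans hgrad.symm),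
      fun h => h ▸ hgrad⟩
  refine ⟨Xbar, fun Y _ => hmax Y, fun Y hY => (hzero Y).1
    (GGL.dualGrad_eq_zero_of_max hσ hlam1 hlam2 fun Z => hY (mem_univ Z)), ?_⟩
  intro η τ μ ρ hη hτ hμ hρ X hX
  refine GGL.newton_convergence (by positivity) (GGL.dualObj_le hσ hlam1 hlam2 S Ωt Θt)
    (GGL.norm_dualGrad_sub_le hσ hlam1 hlam2 S Ωt Θt) hmax hzero
    (GGL.dualObj_level_bounded hσ hlam1 hlam2 S Ωt Θt)
    (GGL.jacGradDual_bounds hσ hlam1 hlam2 S Ωt Θt) ?_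
    (GGL.dualObj_expansion hσ hlam1 hlam2 S Ωt Θt hgrad) hη hτ hμ hρ
    (GGL.IsDualNewtonSeq.exists_isNewtonStep hσ hlam1 hlam2 hX)
  obtain ⟨C, hC⟩ := GGL.semismooth_dualGrad hσ hlam1 hlam2 S Ωt Θt Xbar
  refine ⟨C, ?_⟩
  filter_upwards [hC] with Y hY V hV
  have := hY V hV
  rwa [hgrad, sub_zero] at this
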